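/- Let $\mathbb F_q$ be a finite field and fix a nontrivial character $t\mapsto\varepsilon^t$ of its additive group with values in $\mathbb C^*$. Let $[1,n]=I_1\cup\dots\cup I_\ell$ be a decomposition into consecutive nonempty segments, $n_k=|I_k|$, and let $G=L\ltimes U\subseteq \mathrm{GL}(n,\mathbb F_q)$ be the corresponding parabolic subgroup of block-upper-triangular matrices, where $L=\mathrm{GL}(n_1)\times\dots\times\mathrm{GL}(n_\ell)$ consists of the block-diagonal matrices and $U=1+J$ with $J$ the algebra of strictly block-upper-triangular matrices. *Supercharacter theory.* A supercharacter theory of a finite group $G$ consists of a finite system of nonzero, pairwise orthogonal complex characters of $G$ (supercharacters) and a partition of $G$ into equally many nonempty subsets (superclasses), one of which is $\{1\}$, such that every supercharacter is constant on every superclass. *$GG$-supercharacters.* $G$ acts on $J$ by left and right multiplication and on $J^*$ by $(a\lambda b)(x)=\lambda(bxa)$. For $\lambda\in J^*$ let $H_{G\lambda G}\subseteq L$ be the subgroup of all $h\in L$ with $\mu(hxh^{-1})=\mu(x)$ for all $\mu\in G\lambda G$, $x\in J$; let $U_{\lambda,\mathrm{rt}}=\{u\in U:\lambda(ux)=\lambda(x)\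 \forall x\in J\}$. For $H_0=H_{G\lambda G}$ and a character $\theta$ of $H_0$ let $\chi_{\theta,\lambda}$ be the character of $G$ induced from the character $h(1+x)\mapsto\theta(h)\sum_{p\in L}\varepsilon^{\lambda(xp)}$ of $H_0\ltimes U_{\lambda,\mathrm{rt}}$. The $GG$-supercharacters are the $\chi_{\theta,\lambda}$ with $\lambda\in J^*$ and $\theta$ an $L$-irreducible character of $H_{G\lambda G}$ (a nonzero $L$-invariant character that is not a sum of two nonzero $L$-invariant characters). *$GG$-superclasses.* For $h\in L$ let $J_h\subseteq J$ be the orthogonal complement of the sum of all subspaces $\langle G\lambda G\rangle\subseteq J^*$ with $h\in H_{G\lambda G}$, and $\pi_h:J\to J/J_h$ the projection. The $GG$-superclasses are the sets $\mathrm{Cl}_L(h)\,(1+\pi_h^{-1}(\omega))$, where $h\in L$, $\mathrm{Cl}_L(h)$ is its conjugacy class in $L$, and $\omega$ is a $G\times G$ orbit in $J/J_h$. *Rook placements.* A $J$-root is a pair $\gamma=(i,j)$ with $E_\gamma=E_{ij}\in J$; let $\Delta_J$ be the set of $J$-roots and $\Delta_h=\{\gamma\in\Delta_J: E_\gamma\notin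 J_h\}$ for $h\in L$. A rook placement $D$ in a set $\Delta\subseteq\Delta_J$ is a subset with at most one root in each row and each column; two rook placements $D,D'$ are equivalent if $|D\cap(I_k\times I_m)|=|D'\cap(I_k\times I_m)|$ for all $1\le k<m\le\ell$. Put $x_D=\sum_{\gamma\in D}E_\gamma\in J$ and $\lambda_D=\sum_{\gamma\in D}E_\gamma^*\in J^*$. For $\gamma=(i,j)\in\Delta_J$ with $i\in I_k$, $j\in I_m$, let $H(\gamma)$ be the subgroup of all $h=(h_1,\dots,h_\ell)\in L$ such that $\mathrm{diag}(h_k,\dots,h_m)$ is a scalar matrix, and put $H(D)=\bigcap_{\gamma\in D}H(\gamma)\subseteq L$ (with $H(\emptyset)=L$). **Theorem.** Let $\mathcal A$ be the set of pairs $(\theta,D)$, where $D$ runs through a system of representatives of the classes of rook placements in $\Delta_J$ and $\theta$ runs through all irreducible characters of $H(D)$. Let $\mathcal B$ be the set of pairs $(h,D)$, where $h$ runs through a system of representatives of the conjugacy classes of $L$ and $D$ runs through a system of representatives of the classes of rook placements in $\Delta_h$. For $\alpha=(\theta,D)\in\mathcal A$ let $\chi_\alpha=\chi_{\theta,\lambda_D}$,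 formed with $H_0=H(D)$, and for $\beta=(h,D)\in\mathcal B$ let $K_\beta=\mathrm{Cl}_L(h)(1+\pi_h^{-1}(\omega))$ with $\omega$ the $G\times G$ orbit of $\pi_h(x_D)$. Then: 1. the systems $\{\chi_\alpha\}_{\alpha\in\mathcal A}$ and $\{K_\beta\}_{\beta\in\mathcal B}$ form a supercharacter theory of $G$; in particular $|\mathcal A|=|\mathcal B|$, and different parameters give different supercharacters, respectively superclasses; 2. $\{\chi_\alpha:\alpha\in\mathcal A\}$ is the set of all $GG$-supercharacters of $G$, and $\{K_\beta:\beta\in\mathcal B\}$ is the set of all $GG$-superclasses of $G$; 3. $H(D)=H_{G\lambda_DG}$ for every rook placement $D$ in $\Delta_J$; 4. for every $h=(h_1,\dots,h_\ell)\in L$ there is a coarsest decomposition of $[1,\ell]$ into consecutive segments such that for each segment $[k,m]$ either $k=m$ or $\mathrm{diag}(h_k,\dots,h_m)$ is scalar; and $J_h$ is the set of all $x\in J$ with $x_{ij}=0$ whenever $i\in I_k$, $j\in I_m$ with $k,m$ in the same segment of this decomposition. -/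

import Mathlib

noncomputable section

namespace GGParabolic

open Matrix

/-! ### Characters and supercharacter theories of finite groups -/

/-- `f` is the character of a finite-dimensional complex representation of `G`
(in coordinates; the zero representation is allowed here). -/
def IsCharacter {G : Type*} [Group G] (f : G → ℂ) : Prop :=
  ∃ (d : ℕ) (ρ : Representation ℂ G (Fin d → ℂ)), ρ.character = f

/-- `f` is the character of an irreducible finite-dimensional complex representation of `G`. -/
def IsIrreducibleCharacter {G : Type*} [Group G] (f : G → ℂ) : Prop :=
  ∃ (d : ℕ) (ρ : Representation ℂ G (Fin d → ℂ)), ρ.IsIrreducible ∧ ρ.character = f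

/-- The set of irreducible complex characters of `G`, as a type. -/
abbrev Irr (G : Type*) [Group G] : Type _ := {f : G → ℂ // IsIrreducibleCharacter f}

/-- The Hermitian scalar product of complex functions on a finite group. -/
def scalarProduct {G : Type*} [Group G] (f f' : G → ℂ) : ℂ :=
  (Nat.card G : ℂ)⁻¹ * ∑ᶠ g : G, f g * starRingEnd ℂ (f' g)

/-- The systems of characters `χ a`, `a ∈ A`, and of subsets `K b`, `b ∈ B`, form a supercharacter
theory of the finite group `G`. Different indices give different supercharacters (they are nonzero
and orthogonal) and different superclasses (they are nonempty and disjoint). -/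
structure IsSupercharacterTheory {G A B : Type*} [Group G]
    (χ : A → G → ℂ) (K : B → Set G) : Prop where
  isCharacter : ∀ a, IsCharacter (χ a)
  ne_zero : ∀ a, χ a ≠ 0
  orthogonal : ∀ a a', a ≠ a' → scalarProduct (χ a) (χ a') = 0
  nonempty : ∀ b, (K b).Nonempty
  disjoint : ∀ b b', b ≠ b' → Disjoint (K b) (K b')
  cover : ⋃ b, K b = Set.univ
  one : ∃ b, K b = {1}
  constant : ∀ a b, ∀ g ∈ K b, ∀ g' ∈ K b, χ a g = χ a g'
  finite_left : Finite A
  finite_right : Finite B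
  card_eq : Nat.card A = Nat.card B

open Classical in
/-- Extension by zero of a function on a subgroup. -/
def extendByZero {G : Type*} [Group G] (H : Subgroup G) (f : H → ℂ) (g : G) : ℂ :=
  if hg : g ∈ H then f ⟨g, hg⟩ else 0

/-- The class function of `G` induced from a class function of a subgroup `H`. -/
def induced {G : Type*} [Group G] (H : Subgroup G) (f : H → ℂ) (g : G) : ℂ :=
  (Nat.card H : ℂ)⁻¹ * ∑ᶠ s : G, extendByZero H f (s * g * s⁻¹)

/-- `f` is invariant under conjugation by elements of `L`. -/
def ConjInvariant {G : Type*} [Group G] (L : Subgroup G) {H : Subgroup G} (f : H → ℂ) : Prop :=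
  ∀ p ∈ L, ∀ x y : H, (y : G) = p * x * p⁻¹ → f y = f x

/-- `L`-irreducible characters of a subgroup `H` normalized by `L`: nonzero `L`-invariant characters
that are not a sum of two nonzero `L`-invariant characters. -/
structure IsRelIrreducible {G : Type*} [Group G] (L : Subgroup G) {H : Subgroup G}
    (θ : H → ℂ) : Prop where
  isCharacter : IsCharacter θ
  invariant : ConjInvariant L θ
  ne_zero : θ ≠ 0
  indecomposable : ∀ θ₁ θ₂ : H → ℂ, IsCharacter θ₁ → IsCharacter θ₂ →
    ConjInvariant L θ₁ → ConjInvariant L θ₂ → θ = θ₁ + θ₂ → θ₁ = 0 ∨ θ₂ = 0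

/-! ### Parabolic subgroups -/

variable {n : ℕ} (c : Composition n) (F : Type*) [Field F]

/-- The block-upper-triangular invertible matrices; `c.index i` is the number of the segment of the
decomposition `c` of the index set that contains `i`. -/
def parabolic : Subgroup (GL (Fin n) F) where
  carrier := {g | BlockTriangular (g : Matrix (Fin n) (Fin n) F) c.index}
  one_mem' := by
    simpa using (blockTriangular_one : BlockTriangular (1 : Matrix (Fin n) (Fin n) F) c.index)
  mul_mem' := by
    intro a b ha hb
    simpa using BlockTriangular.mul ha hb
  inv_mem' := by
    intro a ha
    have : Invertible (a : Matrix (Fin n) (Fin n) F) := a.invertible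
    have h := blockTriangular_inv_of_blockTriangular (M := (a : Matrix (Fin n) (Fin n) F)) ha
    simpa [Matrix.coe_units_inv] using h

/-- The parabolic subgroup, as a type. -/
abbrev Par : Type _ := parabolic c F

variable {c F}

/-- The underlying matrix of an element of the parabolic subgroup. -/
def mat (g : Par c F) : Matrix (Fin n) (Fin n) F := ((g : GL (Fin n) F) : Matrix (Fin n) (Fin n) F)

theorem mat_block (g : Par c F) (i j : Fin n) (h : c.index j < c.index i) : mat g i j = 0 :=
  g.2 h

@[simp] theorem mat_one : mat (1 : Par c F) = 1 := rfl

@[simp] theorem mat_mul (g h : Par c F) : mat (g * h) = mat g * mat h := rfl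

theorem mat_mul_inv (g : Par c F) : mat g * mat g⁻¹ = 1 := by
  rw [← mat_mul, mul_inv_cancel, mat_one]

theorem mat_inv_mul (g : Par c F) : mat g⁻¹ * mat g = 1 := by
  rw [← mat_mul, inv_mul_cancel, mat_one]

theorem mat_injective : Function.Injective (mat : Par c F → _) :=
  fun _ _ h => Subtype.ext (Units.ext h)

/-- The block-diagonal part of a matrix. -/
def diagPart (c : Composition n) (M : Matrix (Fin n) (Fin n) F) : Matrix (Fin n) (Fin n) F :=
  Matrix.of fun i j => if c.index i = c.index j then M i j else 0

theorem diagPart_mul (g h : Par c F) :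
    diagPart c (mat g) * diagPart c (mat h) = diagPart c (mat (g * h)) := by
  ext i j
  simp only [diagPart, mat_mul, Matrix.mul_apply, Matrix.of_apply]
  split_ifs with hij
  · refine Finset.sum_congr rfl fun k _ => ?_
    rcases lt_trichotomy (c.index i) (c.index k) with hk | hk | hk
    · rw [mat_block h k j (hij ▸ hk)]; simp
    · simp [hk, ← hij]
    · rw [mat_block g i k hk]; simp
  · refine Finset.sum_eq_zero fun k _ => ?_
    by_cases hk : c.index i = c.index k
    · rw [if_neg (fun h' => hij (hk.trans h')), mul_zero]
    · rw [if_neg hk, zero_mul]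

theorem diagPart_one : diagPart c (mat (1 : Par c F)) = 1 := by
  ext i j
  by_cases hij : i = j
  · subst hij
    simp [diagPart]
  · simp [diagPart, Matrix.one_apply_ne hij]

/-- The Levi component `h` of `g = h (1 + x)`, that is, the block-diagonal part of `g`. -/
def leviPart (g : Par c F) : Par c F :=
  ⟨⟨diagPart c (mat g), diagPart c (mat g⁻¹),
      by rw [diagPart_mul, mul_inv_cancel, diagPart_one],
      by rw [diagPart_mul, inv_mul_cancel, diagPart_one]⟩,
    fun i j hij => by simp [diagPart, hij.ne']⟩

theorem mat_leviPart (g : Par c F) : mat (leviPart g) = diagPart c (mat g) := rfl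

theorem mat_inv_leviPart (g : Par c F) : mat (leviPart g)⁻¹ = diagPart c (mat g⁻¹) := rfl

variable (c F)

/-- The Levi subgroup `L = GL(n₁) × ⋯ × GL(n_ℓ)` of block-diagonal matrices. -/
def levi : Subgroup (Par c F) where
  carrier := {g | ∀ i j, c.index i ≠ c.index j → mat g i j = 0}
  one_mem' := by
    intro i j hij
    rw [mat_one, Matrix.one_apply_ne (fun h : i = j => hij (congrArg c.index h))]
  mul_mem' := by
    intro a b ha hb i j hij
    rw [mat_mul, Matrix.mul_apply]
    refine Finset.sum_eq_zero fun k _ => ?_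
    by_cases hk : c.index i = c.index k
    · rw [hb k j (fun h => hij (hk.trans h)), mul_zero]
    · rw [ha i k hk, zero_mul]
  inv_mem' := by
    intro a ha i j hij
    have h : leviPart a = a := by
      apply mat_injective
      ext i j
      by_cases h : c.index i = c.index j
      · simp [mat_leviPart, diagPart, h]
      · simp [mat_leviPart, diagPart, h, ha i j h]
    rw [← h, mat_inv_leviPart]
    simp [diagPart, hij]

/-- The nilpotent algebra `J` of strictly block-upper-triangular matrices. -/
def radical : Submodule F (Matrix (Fin n) (Fin n) F) where
  carrier := {x | ∀ i j, c.index j ≤ c.index i → x i j = 0}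
  zero_mem' := by intro i j _; rfl
  add_mem' := by
    intro a b ha hb i j h
    rw [Matrix.add_apply, ha i j h, hb i j h, add_zero]
  smul_mem' := by
    intro t a ha i j h
    rw [Matrix.smul_apply, ha i j h, smul_zero]

variable {c F}

theorem mul_mem_radical (g : Par c F) {x : Matrix (Fin n) (Fin n) F} (hx : x ∈ radical c F) :
    mat g * x ∈ radical c F := by
  intro i j hij
  rw [Matrix.mul_apply]
  refine Finset.sum_eq_zero fun k _ => ?_
  rcases lt_or_ge (c.index k) (c.index i) with hk | hk
  · rw [mat_block g i k hk, zero_mul]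
  · rw [hx k j (hij.trans hk), mul_zero]

theorem mem_radical_mul (g : Par c F) {x : Matrix (Fin n) (Fin n) F} (hx : x ∈ radical c F) :
    x * mat g ∈ radical c F := by
  intro i j hij
  rw [Matrix.mul_apply]
  refine Finset.sum_eq_zero fun k _ => ?_
  rcases lt_or_ge (c.index j) (c.index k) with hk | hk
  · rw [mat_block g k j hk, mul_zero]
  · rw [hx i k (hk.trans hij), zero_mul]

/-- Left multiplication `x ↦ g x` on `J`. -/
def lmul (g : Par c F) : radical c F →ₗ[F] radical c F where
  toFun x := ⟨mat g * x, mul_mem_radical g x.2⟩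
  map_add' x y := Subtype.ext (by simp [Matrix.mul_add])
  map_smul' t x := Subtype.ext (by simp)

/-- Right multiplication `x ↦ x g` on `J`. -/
def rmul (g : Par c F) : radical c F →ₗ[F] radical c F where
  toFun x := ⟨(x : Matrix (Fin n) (Fin n) F) * mat g, mem_radical_mul g x.2⟩
  map_add' x y := Subtype.ext (by simp [Matrix.add_mul])
  map_smul' t x := Subtype.ext (by simp)

theorem lmul_mul (g h : Par c F) (x : radical c F) : lmul (g * h) x = lmul g (lmul h x) :=
  Subtype.ext (by simp [lmul, Matrix.mul_assoc])

theorem rmul_mul (g h : Par c F) (x : radical c F) : rmul (g * h) x = rmul h (rmul g x) :=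
  Subtype.ext (by simp [rmul, Matrix.mul_assoc])

theorem lmul_one (x : radical c F) : lmul (1 : Par c F) x = x := Subtype.ext (by simp [lmul])

theorem rmul_one (x : radical c F) : rmul (1 : Par c F) x = x := Subtype.ext (by simp [rmul])

theorem lmul_rmul (g h : Par c F) (x : radical c F) : lmul g (rmul h x) = rmul h (lmul g x) :=
  Subtype.ext (by simp [lmul, rmul, Matrix.mul_assoc])

theorem sub_one_mem_radical (g : Par c F) : mat ((leviPart g)⁻¹ * g) - 1 ∈ radical c F := by
  intro i j hij
  have key : mat ((leviPart g)⁻¹ * g) i j = (1 : Matrix (Fin n) (Fin n) F) i j := by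
    rcases hij.lt_or_eq with h | h
    · rw [mat_block _ i j h, Matrix.one_apply_ne]
      rintro rfl
      exact lt_irrefl _ h
    · have h1 : diagPart c (mat ((leviPart g)⁻¹ * g)) = 1 := by
        rw [← diagPart_mul, mat_inv_leviPart]
        have : diagPart c (diagPart c (mat g⁻¹)) = diagPart c (mat g⁻¹) := by
          ext i j
          simp only [diagPart, Matrix.of_apply]
          split_ifs <;> rfl
        rw [this, diagPart_mul, inv_mul_cancel, diagPart_one]
      rw [← h1]
      simp [diagPart, h]
  rw [Matrix.sub_apply, key, sub_self]

/-- The component `x ∈ J` of `g = h (1 + x)`, with `h` the Levi component of `g`. -/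
def radPart (g : Par c F) : radical c F := ⟨mat ((leviPart g)⁻¹ * g) - 1, sub_one_mem_radical g⟩

/-! ### Linear forms, orbits and stabilizers -/

variable (c F) in
/-- The dual space `J*`. -/
abbrev Forms : Type _ := Module.Dual F (radical c F)

/-- The `G × G` orbit `G x G` of `x ∈ J`. -/
def orbit (x : radical c F) : Set (radical c F) := {y | ∃ a b : Par c F, y = lmul a (rmul b x)}

/-- The linear form `a lam b : x ↦ lam (b x a)`. -/
def formAct (a : Par c F) (lam : Forms c F) (b : Par c F) : Forms c F :=
  lam ∘ₗ lmul b ∘ₗ rmul a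

/-- The `G × G` orbit `G lam G` of a linear form. -/
def formOrbit (lam : Forms c F) : Set (Forms c F) := {μ | ∃ a b : Par c F, μ = formAct a lam b}

/-- The subgroup `H_{G lam G}` of the elements of `L` whose coadjoint action fixes every linear form
in `G lam G`. -/
def orbitStabilizer (lam : Forms c F) : Subgroup (Par c F) where
  carrier := {h | h ∈ levi c F ∧ ∀ μ ∈ formOrbit lam, ∀ x, μ (lmul h (rmul h⁻¹ x)) = μ x}
  one_mem' := ⟨one_mem _, fun μ _ x => by rw [inv_one, rmul_one, lmul_one]⟩
  mul_mem' := by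
    rintro a b ⟨ha, ha'⟩ ⟨hb, hb'⟩
    refine ⟨mul_mem ha hb, fun μ hμ x => ?_⟩
    rw [_root_.mul_inv_rev, rmul_mul, lmul_mul, lmul_rmul b, ha' μ hμ, hb' μ hμ]
  inv_mem' := by
    rintro a ⟨ha, ha'⟩
    refine ⟨inv_mem ha, fun μ hμ x => ?_⟩
    rw [← ha' μ hμ (lmul a⁻¹ (rmul a⁻¹⁻¹ x)), inv_inv, ← lmul_rmul, ← lmul_mul, ← rmul_mul,
      mul_inv_cancel, lmul_one, rmul_one]

/-- The right stabilizer `U_{lam,rt}` of `lam` in `U = 1 + J`: the elements `u ∈ U` such that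
`lam (u x) = lam x` for all `x ∈ J`. -/
def rightStabilizer (lam : Forms c F) : Subgroup (Par c F) where
  carrier := {u | mat u - 1 ∈ radical c F ∧ ∀ x, lam (lmul u x) = lam x}
  one_mem' := ⟨by simp, fun x => by rw [lmul_one]⟩
  mul_mem' := by
    rintro a b ⟨ha, ha'⟩ ⟨hb, hb'⟩
    refine ⟨?_, fun x => by rw [lmul_mul, ha', hb']⟩
    have : mat (a * b) - 1 = (mat a - 1) * mat b + (mat b - 1) := by
      rw [mat_mul, sub_mul, one_mul]; abel
    rw [this]
    exact add_mem (mem_radical_mul b ha) hb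
  inv_mem' := by
    rintro a ⟨ha, ha'⟩
    refine ⟨?_, fun x => by rw [← ha' (lmul a⁻¹ x), ← lmul_mul, mul_inv_cancel, lmul_one]⟩
    have : mat a⁻¹ - 1 = -(mat a⁻¹ * (mat a - 1)) := by
      rw [mul_sub, mat_inv_mul, mul_one]; abel
    rw [this]
    exact neg_mem (mul_mem_radical a⁻¹ ha)

/-- The subgroup `G_{0,lam} = H₀ ⋉ U_{lam,rt}`, for a subgroup `H₀` of the stabilizer of `lam`
in `L`. -/
def semidirect (H₀ : Subgroup (Par c F)) (lam : Forms c F) : Subgroup (Par c F) :=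
  H₀ ⊔ rightStabilizer lam

/-- The function `h (1 + x) ↦ θ(h) ε^{lam(x)}`, where `θ` is extended by zero. -/
def xi (ε : AddChar F ℂ) (H₀ : Subgroup (Par c F)) (θ : H₀ → ℂ) (lam : Forms c F)
    (g : Par c F) : ℂ :=
  extendByZero H₀ θ (leviPart g) * ε (lam (radPart g))

/-- The character of `G` induced from the character `∑_{p ∈ L} ξ_{θ, p lam}` of the subgroup
`H₀ ⋉ U_{lam,rt}`. -/
def chi (ε : AddChar F ℂ) (H₀ : Subgroup (Par c F)) (θ : H₀ → ℂ) (lam : Forms c F) :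
    Par c F → ℂ :=
  induced (semidirect H₀ lam) fun g => ∑ᶠ p : levi c F, xi ε H₀ θ (formAct p lam 1) g

variable (c) in
/-- The set of all `GG`-supercharacters `χ_{θ,lam}`, where `lam ∈ J*` and `θ` is an
`L`-irreducible character of `H_{G lam G}`. -/
def ggSupercharacters (ε : AddChar F ℂ) : Set (Par c F → ℂ) :=
  {f | ∃ (lam : Forms c F) (θ : orbitStabilizer lam → ℂ),
    IsRelIrreducible (levi c F) θ ∧ f = chi ε (orbitStabilizer lam) θ lam}

/-! ### Superclasses -/

/-- The sum of all subspaces of `J*` spanned by the orbits `G lam G` with `h ∈ H_{G lam G}`. -/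
def fixedForms (h : levi c F) : Submodule F (Forms c F) :=
  ⨆ (lam : Forms c F) (_ : (h : Par c F) ∈ orbitStabilizer lam), Submodule.span F (formOrbit lam)

/-- The ideal `J_h`, the orthogonal complement of `fixedForms h` in `J`. -/
def idealOf (h : levi c F) : Submodule F (radical c F) := (fixedForms h).dualCoannihilator

/-- The superclass `Cl_L(h) (1 + π_h⁻¹(ω))`, where `π_h : J → J / J_h` is the projection and
`ω = π_h(G x G)` is the `G × G` orbit of `π_h x` in `J / J_h`. -/
def superclass (h : levi c F) (x : radical c F) : Set (Par c F) :=
  {g | ∃ (h' : levi c F) (y : radical c F), IsConj h h' ∧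
    (idealOf h).mkQ y ∈ (idealOf h).mkQ '' orbit x ∧
    mat g = mat (h' : Par c F) * (1 + (y : Matrix (Fin n) (Fin n) F))}

variable (c F) in
/-- The set of all `GG`-superclasses. -/
def ggSuperclasses : Set (Set (Par c F)) :=
  {K | ∃ (h : levi c F) (x : radical c F), K = superclass h x}

/-! ### Roots and rook placements -/

/-- The set `Δ_J` of the `J`-roots: the pairs `(i, j)`, with `i` in an earlier segment than `j`. -/
def jRoots (c : Composition n) : Set (Fin n × Fin n) := {γ | c.index γ.1 < c.index γ.2}

/-- The `J`-roots are exactly the pairs whose matrix unit belongs to `J`. -/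
theorem mem_jRoots_iff (γ : Fin n × Fin n) :
    γ ∈ jRoots c ↔ Matrix.single γ.1 γ.2 (1 : F) ∈ radical c F := by
  constructor
  · intro h i j hij
    rw [Matrix.single_apply, if_neg]
    rintro ⟨rfl, rfl⟩
    exact absurd h (not_lt.mpr hij)
  · intro h
    by_contra hlt
    have := h γ.1 γ.2 (not_lt.mp hlt)
    simp at this

open Classical in
/-- The matrix unit `E_γ` as an element of `J`, for a `J`-root `γ` (and zero for other pairs). -/
def rootUnit (γ : Fin n × Fin n) : radical c F :=
  if h : γ ∈ jRoots c then ⟨Matrix.single γ.1 γ.2 1, (mem_jRoots_iff γ).mp h⟩ else 0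

/-- The element `E_γ*` of the dual basis of `J*`: the matrix entry at `γ`. -/
def rootForm (γ : Fin n × Fin n) : Forms c F :=
  Matrix.entryLinearMap F F γ.1 γ.2 ∘ₗ (radical c F).subtype

/-- `x_D`, the sum of the `E_γ` over `γ ∈ D`. -/
def rookElement (D : Finset (Fin n × Fin n)) : radical c F := ∑ γ ∈ D, rootUnit γ

/-- `lam_D`, the sum of the `E_γ*` over `γ ∈ D`. -/
def rookForm (D : Finset (Fin n × Fin n)) : Forms c F := ∑ γ ∈ D, rootForm γ

/-- `D` is a rook placement in `Δ`: it has at most one root in any row and any column. -/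
structure IsRookPlacement (Δ : Set (Fin n × Fin n)) (D : Finset (Fin n × Fin n)) : Prop where
  subset : ∀ γ ∈ D, γ ∈ Δ
  row : ∀ γ ∈ D, ∀ γ' ∈ D, γ.1 = γ'.1 → γ = γ'
  col : ∀ γ ∈ D, ∀ γ' ∈ D, γ.2 = γ'.2 → γ = γ'

/-- The number `d_{km}` of the roots of `D` in `I_k × I_m`. -/
def blockCount (c : Composition n) (D : Finset (Fin n × Fin n)) (k m : Fin c.length) : ℕ :=
  (D.filter fun γ => c.index γ.1 = k ∧ c.index γ.2 = m).card

/-- Equivalence of rook placements. -/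
def RookEquiv (c : Composition n) (D D' : Finset (Fin n × Fin n)) : Prop :=
  ∀ k m : Fin c.length, k < m → blockCount c D k m = blockCount c D' k m

/-- `R` is a system of representatives of the classes of rook placements in `Δ`. -/
def IsRookTransversal (c : Composition n) (Δ : Set (Fin n × Fin n))
    (R : Set (Finset (Fin n × Fin n))) : Prop :=
  (∀ D ∈ R, IsRookPlacement Δ D) ∧
    ∀ D, IsRookPlacement Δ D → ∃! D', D' ∈ R ∧ RookEquiv c D D'

/-- `T` is a system of representatives of the conjugacy classes of a group. -/
def IsConjTransversal {G : Type*} [Group G] (T : Set G) : Prop :=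
  ∀ g : G, ∃! t, t ∈ T ∧ IsConj g t

/-- The submatrix `diag(h_k, …, h_m)` of a block-diagonal matrix is scalar. -/
def IsScalarOn (h : Par c F) (k m : Fin c.length) : Prop :=
  ∃ a : F, ∀ s t : Fin n, c.index s ∈ Set.Icc k m → c.index t ∈ Set.Icc k m →
    mat h s t = if s = t then a else 0

theorem IsScalarOn.row {h : Par c F} (hh : h ∈ levi c F) {k m : Fin c.length} {a : F}
    (ha : ∀ s t : Fin n, c.index s ∈ Set.Icc k m → c.index t ∈ Set.Icc k m →
      mat h s t = if s = t then a else 0) (s t : Fin n) (hs : c.index s ∈ Set.Icc k m) :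
    mat h s t = if s = t then a else 0 := by
  by_cases hst : c.index s = c.index t
  · exact ha s t hs (hst ▸ hs)
  · rw [hh s t hst, if_neg (fun h' : s = t => hst (congrArg c.index h'))]

variable (F) in
/-- The subgroup `H(γ)` for `γ = (i, j)` with `i ∈ I_k`, `j ∈ I_m`: the elements
`(h_1, …, h_ℓ)` of `L` such that `(h_k, …, h_m)` is scalar. -/
def rootSubgroup (c : Composition n) (γ : Fin n × Fin n) : Subgroup (Par c F) where
  carrier := {h | h ∈ levi c F ∧ IsScalarOn h (c.index γ.1) (c.index γ.2)}
  one_mem' := ⟨one_mem _, 1, fun s t _ _ => by rw [mat_one, Matrix.one_apply]⟩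
  mul_mem' := by
    rintro g h ⟨hg, a, ha⟩ ⟨hh, b, hb⟩
    refine ⟨mul_mem hg hh, a * b, fun s t hs ht => ?_⟩
    rw [mat_mul, Matrix.mul_apply]
    simp [IsScalarOn.row hg ha s _ hs, hb s t hs ht]
  inv_mem' := by
    rintro g ⟨hg, a, ha⟩
    refine ⟨inv_mem hg, a⁻¹, fun s t hs ht => ?_⟩
    have key : ∀ u, a * mat g⁻¹ s u = if s = u then 1 else 0 := by
      intro u
      have := congrFun (congrFun (mat_mul_inv g) s) u
      rw [Matrix.mul_apply, Matrix.one_apply] at this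
      simpa [IsScalarOn.row hg ha s _ hs] using this
    have ha0 : a ≠ 0 := by
      rintro rfl
      simpa using key s
    have := key t
    split_ifs at this ⊢ with hst
    · exact eq_inv_of_mul_eq_one_right this
    · exact (mul_eq_zero.mp this).resolve_left ha0

variable (F) in
/-- The subgroup `H(D)` of `L`, the intersection of the `H(γ)` over `γ ∈ D`. -/
def rookSubgroup (c : Composition n) (D : Finset (Fin n × Fin n)) : Subgroup (Par c F) :=
  levi c F ⊓ ⨅ γ ∈ D, rootSubgroup F c γ

/-- The set `Δ_h` of the `J`-roots `γ` with `E_γ ∉ J_h`. -/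
def rootsOf (h : levi c F) : Set (Fin n × Fin n) :=
  {γ | γ ∈ jRoots c ∧ (rootUnit γ : radical c F) ∉ idealOf h}

/-- A decomposition of `[1, ℓ]` into consecutive segments (an equivalence relation with
order-connected classes) such that, for each segment `[k, m]`, either `k = m` or `(h_k, …, h_m)`
is scalar. -/
def IsScalarDecomposition (h : levi c F) (r : Setoid (Fin c.length)) : Prop :=
  ∀ k m : Fin c.length, k ≤ m → r k m →
    (∀ t ∈ Set.Icc k m, r k t) ∧ (k = m ∨ IsScalarOn (h : Par c F) k m)

/-- The radical of the coarser parabolic subgroup whose segments are the unions of the `I_k` over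
the classes of `r`, where the classes of `r` are segments. -/
def coarseRadical (r : Setoid (Fin c.length)) : Set (radical c F) :=
  {x | ∀ i j, r (c.index i) (c.index j) → (x : Matrix (Fin n) (Fin n) F) i j = 0}

end GGParabolic

end

/-!
Write the elements of `G` as `h (1 + x)` with `h ∈ L` and `x ∈ J`. Evaluating the induced character
gives `χ_{θ,λ}(h (1 + x)) = C_λ θ(h) ∑_{a, b ∈ G} ε^{λ(a x b)}` with `C_λ ≠ 0` and `θ` extended by
zero to `L`. For `h ∈ H_{GλG}` the sum only depends on the orbit of `x` in `J / J_h`, so `χ_{θ,λ}`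
is constant on the superclasses. The scalar product of `χ_{θ,λ}` and `χ_{θ',λ'}` splits into a sum
over `L` and a sum over `J`: the latter vanishes if `λ` and `λ'` lie in different orbits, since
distinct additive characters of `J` are orthogonal, and otherwise the former vanishes for `θ ≠ θ'`.

Gaussian elimination by the row and column operations of `G` brings every orbit in `J`, `J*` and
`J / J_h` to a rook placement, whose class is recovered from the ranks of the corner blocks.

Elements of `H(D)` that are conjugate in `L` are already conjugate in `H(D)`. Hence every
character of `H(D)` is `L`-invariant, and the irreducible characters of `H(D)` are as many as
the conjugacy classes of `L` that meet `H(D)`. Since `D ⊆ Δ_h` means `h ∈ H(D)`, both `𝒜` and `ℬ`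
have as many elements as there are pairs of a class of rook placements `D` and a conjugacy class of
`L` that meets `H(D)`.
-/

open GGParabolic

noncomputable section

namespace GGParabolic

open Matrix

/-! ### Characters of finite groups -/

section Representations

variable {k G V W : Type*} [Field k] [Group G] [AddCommGroup V] [Module k V] [AddCommGroup W]
  [Module k W]

theorem isIrreducible_of_equiv {ρ : Representation k G V} {σ : Representation k G W}
    (φ : ρ.Equiv σ) (h : ρ.IsIrreducible) : σ.IsIrreducible := by
  rw [Representation.irreducible_iff_isSimpleModule_asModule] at h ⊢
  have : IsSimpleModule (MonoidAlgebra k G) ρ.asModule := h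
  exact IsSimpleModule.congr (LinearEquiv.ofBijective
    (Representation.IntertwiningMap.equivLinearMapAsModule _ _ φ.symm.toIntertwiningMap)
    φ.symm.toLinearEquiv.bijective)

theorem isIrreducible_toRepresentation_of_isAtom {ρ : Representation k G V}
    {X : Subrepresentation ρ} (hX : IsAtom X) : X.toRepresentation.IsIrreducible := by
  have hX_ne : X.toSubmodule ≠ ⊥ := fun h => hX.1 (Subrepresentation.toSubmodule_injective h)
  have : Nontrivial (Subrepresentation X.toRepresentation) := by
    refine ⟨⊥, ⊤, fun h => hX_ne ?_⟩
    have hbot : (⊥ : Submodule k X.toSubmodule) = ⊤ :=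
      congrArg Subrepresentation.toSubmodule h
    simpa using congrArg (Submodule.map X.toSubmodule.subtype) hbot.symm
  refine ⟨fun Y => ?_⟩
  let Y' : Subrepresentation ρ := ⟨Y.toSubmodule.map X.toSubmodule.subtype, by
    rintro g _ ⟨y, hy, rfl⟩
    exact ⟨_, Y.apply_mem_toSubmodule g hy, rfl⟩⟩
  have hY' : Y' ≤ X := Submodule.map_subtype_le X.toSubmodule Y.toSubmodule
  have hinj := Submodule.map_injective_of_injective X.toSubmodule.subtype_injective
  refine (hX.le_iff.mp hY').imp (fun h => ?_) (fun h => ?_) <;>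
  · refine Subrepresentation.toSubmodule_injective (hinj ?_)
    refine (congrArg Subrepresentation.toSubmodule h).trans ?_
    first | exact (Submodule.map_bot _).symm | exact (Submodule.map_subtype_top _).symm

theorem intertwiningMap_eq_zero_of_isAtom {ρ : Representation k G V} {σ : Representation k G W}
    [ρ.IsSemisimpleRepresentation] (T : ρ.IntertwiningMap σ)
    (h : ∀ X : Subrepresentation ρ, IsAtom X → ∀ x ∈ X, T x = 0) : T = 0 := by
  have hsemi : IsSemisimpleModule (MonoidAlgebra k G) ρ.asModule :=
    Representation.isSemisimpleRepresentation_iff_isSemisimpleModule_asModule ρ |>.mp ‹_›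
  have : IsAtomic (Subrepresentation ρ) :=
    Subrepresentation.subrepresentationSubmoduleOrderIso.isAtomic_iff.mpr inferInstance
  obtain ⟨K', hK'⟩ := exists_isCompl T.ker
  rcases eq_bot_or_exists_atom_le K' with rfl | ⟨X, hX, hXK'⟩
  · ext x
    have hx : x ∈ T.ker := eq_top_of_isCompl_bot hK' ▸ Submodule.mem_top (x := x)
    exact hx
  · have hXK : X ≤ T.ker := fun x hx => h X hX x hx
    exact absurd (le_bot_iff.mp (hK'.disjoint hXK hXK')) hX.1

end Representations

section Characters

variable {G : Type*} [Group G] {V : Type*} [AddCommGroup V] [Module ℂ V]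

theorem exists_equiv_fin [FiniteDimensional ℂ V] (ρ : Representation ℂ G V) :
    ∃ σ : Representation ℂ G (Fin (Module.finrank ℂ V) → ℂ), Nonempty (ρ.Equiv σ) := by
  let e := (Module.finBasis ℂ V).equivFun
  let σ : Representation ℂ G (Fin (Module.finrank ℂ V) → ℂ) :=
    (e.conjAlgEquiv ℂ : Module.End ℂ V →* _).comp ρ
  exact ⟨σ, ⟨.mk e fun g => by ext v i; simp [σ]⟩⟩

theorem isCharacter_character [FiniteDimensional ℂ V] (ρ : Representation ℂ G V) :
    IsCharacter ρ.character := by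
  obtain ⟨σ, ⟨φ⟩⟩ := exists_equiv_fin ρ
  exact ⟨_, σ, (Representation.char_iso φ).symm⟩

theorem isIrreducibleCharacter_character [FiniteDimensional ℂ V] (ρ : Representation ℂ G V)
    (h : ρ.IsIrreducible) : IsIrreducibleCharacter ρ.character := by
  obtain ⟨σ, ⟨φ⟩⟩ := exists_equiv_fin ρ
  exact ⟨_, σ, isIrreducible_of_equiv φ h, (Representation.char_iso φ).symm⟩

theorem IsIrreducibleCharacter.isCharacter {f : G → ℂ} (h : IsIrreducibleCharacter f) :
    IsCharacter f := by
  obtain ⟨d, ρ, -, h⟩ := h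
  exact ⟨d, ρ, h⟩

theorem isCharacter_zero : IsCharacter (0 : G → ℂ) :=
  ⟨0, 1, by ext; simp [Representation.character]⟩

theorem IsCharacter.add {f f' : G → ℂ} (h : IsCharacter f) (h' : IsCharacter f') :
    IsCharacter (f + f') := by
  obtain ⟨d, ρ, rfl⟩ := h
  obtain ⟨d', ρ', rfl⟩ := h'
  convert isCharacter_character (ρ.prod ρ') using 1
  ext g
  simp [Representation.character, Representation.prod, LinearMap.trace_prodMap']

theorem IsCharacter.sum {ι : Type*} (s : Finset ι) {f : ι → G → ℂ}
    (h : ∀ i ∈ s, IsCharacter (f i)) : IsCharacter (∑ i ∈ s, f i) :=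
  Finset.sum_induction f IsCharacter (fun _ _ => IsCharacter.add) isCharacter_zero h

theorem IsCharacter.nsmul {f : G → ℂ} (h : IsCharacter f) (m : ℕ) : IsCharacter (m • f) := by
  rw [← Fin.sum_const]
  exact .sum _ fun _ _ => h

theorem IsCharacter.comp {H : Type*} [Group H] {f : G → ℂ} (h : IsCharacter f) (φ : H →* G) :
    IsCharacter (f ∘ φ) := by
  obtain ⟨d, ρ, rfl⟩ := h
  exact ⟨d, MonoidHom.comp ρ φ, rfl⟩

theorem IsCharacter.mul_monoidHom {f : G → ℂ} (h : IsCharacter f) (ψ : G →* ℂ) :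
    IsCharacter fun g => f g * ψ g := by
  obtain ⟨d, ρ, rfl⟩ := h
  refine ⟨d, { toFun := fun g => ψ g • ρ g, map_one' := by simp, map_mul' := fun a b => ?_ }, ?_⟩
  · rw [map_mul, map_mul, smul_mul_smul_comm]
  · ext g
    simp [Representation.character, mul_comm]

/-- Class functions: the functions on a group that are constant on conjugacy classes. -/
def IsClassFunction (f : G → ℂ) : Prop := ∀ s g : G, f (s * g * s⁻¹) = f g

theorem IsCharacter.isClassFunction {f : G → ℂ} (h : IsCharacter f) : IsClassFunction f := by
  obtain ⟨d, ρ, rfl⟩ := h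
  exact fun s g => ρ.char_conj g s

section UnitaryTrick

variable {ι : Type*} [Fintype ι] [DecidableEq ι]

open scoped ComplexOrder in
theorem posDef_sum_conjTranspose_mul_self [Fintype G] (A : G →* Matrix ι ι ℂ) :
    (∑ s, (A s)ᴴ * A s).PosDef := by
  classical
  rw [← Finset.add_sum_erase _ _ (Finset.mem_univ (1 : G)), map_one, conjTranspose_one, one_mul]
  exact PosDef.one.add_posSemidef
    (posSemidef_sum _ fun s _ => posSemidef_conjTranspose_mul_self (A s))

theorem conjTranspose_mul_sum_mul [Fintype G] (A : G →* Matrix ι ι ℂ) (g : G) :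
    (A g)ᴴ * (∑ s, (A s)ᴴ * A s) * A g = ∑ s, (A s)ᴴ * A s := by
  simp only [Finset.mul_sum, Finset.sum_mul]
  exact Fintype.sum_equiv (Equiv.mulRight g) _ _ fun s => by simp [Matrix.mul_assoc]

open scoped ComplexOrder in
theorem star_trace_eq_trace_inv [Finite G] (A : G →* Matrix ι ι ℂ) (g : G) :
    star (A g).trace = (A g⁻¹).trace := by
  have := Fintype.ofFinite G
  let P := ∑ s, (A s)ᴴ * A s
  have hP_unit : IsUnit P.det :=
    (isUnit_iff_isUnit_det _).mp (posDef_sum_conjTranspose_mul_self A).isUnit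
  have hadj : (A g)ᴴ * P = P * A g⁻¹ := by
    have hinv : (A g)ᴴ * P * A g = P := conjTranspose_mul_sum_mul A g
    calc (A g)ᴴ * P = (A g)ᴴ * P * (A g * A g⁻¹) := by simp [← map_mul]
      _ = P * A g⁻¹ := by rw [← Matrix.mul_assoc, hinv]
  calc star (A g).trace = ((A g)ᴴ * P * P⁻¹).trace := by
        rw [mul_nonsing_inv_cancel_right _ _ hP_unit, trace_conjTranspose]
    _ = (P⁻¹ * (P * A g⁻¹)).trace := by rw [hadj, trace_mul_comm]
    _ = (A g⁻¹).trace := by rw [nonsing_inv_mul_cancel_left _ _ hP_unit]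

end UnitaryTrick

theorem IsCharacter.conj_apply [Finite G] {f : G → ℂ} (h : IsCharacter f) (g : G) :
    starRingEnd ℂ (f g) = f g⁻¹ := by
  obtain ⟨d, ρ, rfl⟩ := h
  have htrace : ∀ g, ρ.character g = (LinearMap.toMatrix' (ρ g)).trace := fun g => by
    rw [Representation.character, LinearMap.trace_eq_matrix_trace ℂ (Pi.basisFun ℂ (Fin d)),
      LinearMap.toMatrix_eq_toMatrix']
  rw [htrace, htrace]
  exact star_trace_eq_trace_inv
    ((LinearMap.toMatrixAlgEquiv' : _ ≃ₐ[ℂ] _).toMonoidHom.comp ρ) g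

theorem scalarProduct_eq_sum [Fintype G] (f f' : G → ℂ) :
    scalarProduct f f' = (Nat.card G : ℂ)⁻¹ * ∑ g, f g * starRingEnd ℂ (f' g) := by
  rw [scalarProduct, finsum_eq_sum_of_fintype]

/-- The scalar product with `f'`, as a linear form in the first argument. -/
def scalarProductLeft [Finite G] (f' : G → ℂ) : (G → ℂ) →ₗ[ℂ] ℂ where
  toFun f := scalarProduct f f'
  map_add' f₁ f₂ := by
    have := Fintype.ofFinite G
    simp only [scalarProduct_eq_sum, Pi.add_apply, add_mul, Finset.sum_add_distrib, mul_add]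
  map_smul' a f := by
    have := Fintype.ofFinite G
    simp only [scalarProduct_eq_sum, Pi.smul_apply, smul_eq_mul, RingHom.id_apply, Finset.mul_sum]
    exact Finset.sum_congr rfl fun g _ => by ring

theorem scalarProductLeft_apply [Finite G] (f f' : G → ℂ) :
    scalarProductLeft f' f = scalarProduct f f' := rfl

theorem IsCharacter.scalarProduct_eq_sum_inv [Fintype G] (f : G → ℂ) {f' : G → ℂ}
    (h : IsCharacter f') :
    scalarProduct f f' = (Nat.card G : ℂ)⁻¹ * ∑ g, f g * f' g⁻¹ := by
  simp only [scalarProduct_eq_sum, h.conj_apply]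

theorem IsCharacter.exists_scalarProduct_eq [Finite G] {f f' : G → ℂ} (h : IsCharacter f)
    (h' : IsCharacter f') : ∃ m : ℕ, scalarProduct f f' = m := by
  have := Fintype.ofFinite G
  have : Invertible (Nat.card G : ℂ) :=
    invertibleOfNonzero (Nat.cast_ne_zero.mpr Nat.card_pos.ne')
  rw [h'.scalarProduct_eq_sum_inv]
  obtain ⟨d, ρ, rfl⟩ := h
  obtain ⟨d', ρ', rfl⟩ := h'
  exact ⟨_, Representation.card_inv_mul_sum_char_mul_char_eq_finrank ρ' ρ⟩

theorem IsIrreducibleCharacter.scalarProduct_self [Finite G] {ψ : G → ℂ}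
    (h : IsIrreducibleCharacter ψ) : scalarProduct ψ ψ = 1 := by
  classical
  have := Fintype.ofFinite G
  have : Invertible (Nat.card G : ℂ) :=
    invertibleOfNonzero (Nat.cast_ne_zero.mpr Nat.card_pos.ne')
  rw [h.isCharacter.scalarProduct_eq_sum_inv]
  obtain ⟨d, ρ, hρ, rfl⟩ := h
  exact (Representation.char_orthonormal ρ ρ).trans (if_pos ⟨.refl ρ⟩)

theorem IsIrreducibleCharacter.scalarProduct_eq_zero [Finite G] {ψ φ : G → ℂ}
    (hψ : IsIrreducibleCharacter ψ) (hφ : IsIrreducibleCharacter φ) (hne : ψ ≠ φ) :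
    scalarProduct ψ φ = 0 := by
  classical
  have := Fintype.ofFinite G
  have : Invertible (Nat.card G : ℂ) :=
    invertibleOfNonzero (Nat.cast_ne_zero.mpr Nat.card_pos.ne')
  rw [hφ.isCharacter.scalarProduct_eq_sum_inv]
  obtain ⟨d, ρ, hρ, rfl⟩ := hψ
  obtain ⟨d', σ, hσ, rfl⟩ := hφ
  exact (Representation.char_orthonormal ρ σ).trans
    (if_neg fun ⟨e⟩ => hne (Representation.char_iso e).symm)

theorem IsIrreducibleCharacter.ne_zero [Finite G] {ψ : G → ℂ} (h : IsIrreducibleCharacter ψ) :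
    ψ ≠ 0 := by
  rintro rfl
  simpa [scalarProduct] using h.scalarProduct_self

theorem linearIndependent_irr [Finite G] : LinearIndependent ℂ fun ψ : Irr G => ψ.1 := by
  rw [linearIndependent_iff']
  intro s a hsum φ hφ
  have h := congrArg (scalarProductLeft φ.1) hsum
  rw [map_sum, map_zero, Finset.sum_eq_single φ] at h
  · simpa [scalarProductLeft_apply, φ.2.scalarProduct_self] using h
  · intro ψ _ hne
    rw [map_smul, scalarProductLeft_apply,
      ψ.2.scalarProduct_eq_zero φ.2 (Subtype.coe_injective.ne hne), smul_zero]
  · exact fun h => absurd hφ h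

instance finite_irr [Finite G] : Finite (Irr G) := linearIndependent_irr.finite

section Completeness

/-- The operator `∑ f(g) ρ(g⁻¹)` attached to a class function `f`. It commutes with `ρ`, so it is
a scalar if `ρ` is irreducible. -/
def classOperator [Fintype G] (ρ : Representation ℂ G V) {f : G → ℂ} (hf : IsClassFunction f) :
    ρ.IntertwiningMap ρ :=
  ⟨∑ g, f g • ρ g⁻¹, fun s => by
    rw [← Module.End.mul_eq_comp, ← Module.End.mul_eq_comp, Finset.sum_mul, Finset.mul_sum]
    refine Fintype.sum_equiv (MulAut.conj s⁻¹).toEquiv _ _ fun g => ?_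
    have hconj : s * (s⁻¹ * g * s⁻¹⁻¹)⁻¹ = g⁻¹ * s := by group
    simp only [MulEquiv.toEquiv_eq_coe, EquivLike.coe_coe, MulAut.conj_apply, hf s⁻¹ g,
      smul_mul_assoc, mul_smul_comm, ← map_mul, hconj]⟩

variable [Fintype G] {f : G → ℂ} (hf : IsClassFunction f)

theorem classOperator_apply (ρ : Representation ℂ G V) (v : V) :
    classOperator ρ hf v = ∑ g, f g • ρ g⁻¹ v := by
  simp [classOperator]

theorem trace_classOperator [FiniteDimensional ℂ V] (ρ : Representation ℂ G V) :
    LinearMap.trace ℂ V (classOperator ρ hf).toLinearMap =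
      Nat.card G * scalarProduct f ρ.character := by
  have hcard : (Nat.card G : ℂ) ≠ 0 := Nat.cast_ne_zero.mpr Nat.card_pos.ne'
  rw [(isCharacter_character ρ).scalarProduct_eq_sum_inv, mul_inv_cancel_left₀ hcard]
  simp [classOperator, Representation.character]

theorem classOperator_eq_zero_of_isIrreducible [FiniteDimensional ℂ V]
    {ρ : Representation ℂ G V} (hρ : ρ.IsIrreducible) (h : scalarProduct f ρ.character = 0) :
    classOperator ρ hf = 0 := by
  obtain ⟨z, hz⟩ :=
    (Representation.IsIrreducible.algebraMap_intertwiningMap_bijective_of_isAlgClosed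
      (ρ := ρ)).2 (classOperator ρ hf)
  have hV : Nontrivial V := by
    by_contra hV
    rw [not_nontrivial_iff_subsingleton] at hV
    exact bot_ne_top (α := Subrepresentation ρ)
      (Subrepresentation.toSubmodule_injective (Subsingleton.elim _ _))
  have hscalar : (classOperator ρ hf).toLinearMap = z • (1 : Module.End ℂ V) :=
    (congrArg Representation.IntertwiningMap.toLinearMap hz).symm
  have htrace := trace_classOperator hf ρ
  rw [h, mul_zero, hscalar, map_smul, LinearMap.trace_one, smul_eq_mul] at htrace
  have hz0 : z = 0 := (mul_eq_zero.mp htrace).resolve_right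
    (Nat.cast_ne_zero.mpr (Module.finrank_pos (R := ℂ) (M := V)).ne')
  rw [← hz, hz0, map_zero]

theorem classOperator_eq_zero [FiniteDimensional ℂ V] (ρ : Representation ℂ G V)
    (h : ∀ ψ : G → ℂ, IsIrreducibleCharacter ψ → scalarProduct f ψ = 0) :
    classOperator ρ hf = 0 := by
  have : NeZero (Nat.card G : ℂ) := ⟨Nat.cast_ne_zero.mpr Nat.card_pos.ne'⟩
  refine intertwiningMap_eq_zero_of_isAtom _ fun X hX x hx => ?_
  have hX' := isIrreducible_toRepresentation_of_isAtom hX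
  have h0 := classOperator_eq_zero_of_isIrreducible hf hX'
    (h _ (isIrreducibleCharacter_character _ hX'))
  have hx0 := congrArg Subtype.val (DFunLike.congr_fun h0 ⟨x, hx⟩)
  rw [classOperator_apply] at hx0 ⊢
  rw [AddSubmonoidClass.coe_finsetSum] at hx0
  exact hx0

end Completeness

theorem IsClassFunction.eq_zero [Finite G] {f : G → ℂ} (hf : IsClassFunction f)
    (h : ∀ ψ : G → ℂ, IsIrreducibleCharacter ψ → scalarProduct f ψ = 0) : f = 0 := by
  classical
  have := Fintype.ofFinite G
  have h0 := DFunLike.congr_fun (classOperator_eq_zero hf (Representation.leftRegular ℂ G) h)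
    (MonoidAlgebra.single 1 1)
  rw [classOperator_apply] at h0
  ext g
  have hg := DFunLike.congr_fun (congrArg MonoidAlgebra.coeff h0) g⁻¹
  simpa [Finsupp.single_apply] using hg

theorem IsClassFunction.eq_sum [Finite G] [Fintype (Irr G)] {f : G → ℂ} (hf : IsClassFunction f) :
    f = ∑ ψ : Irr G, scalarProduct f ψ.1 • ψ.1 := by
  refine sub_eq_zero.mp (IsClassFunction.eq_zero (fun s g => ?_) fun φ hφ => ?_)
  · simp only [Pi.sub_apply, Finset.sum_apply, Pi.smul_apply, hf s g,
      (Subtype.prop _ : IsIrreducibleCharacter _).isCharacter.isClassFunction s g]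
  · rw [← scalarProductLeft_apply, map_sub, map_sum, Finset.sum_eq_single ⟨φ, hφ⟩]
    · simp [scalarProductLeft_apply, hφ.scalarProduct_self]
    · intro ψ _ hne
      rw [map_smul, scalarProductLeft_apply,
        ψ.2.scalarProduct_eq_zero hφ (fun h => hne (Subtype.ext h)), smul_zero]
    · exact fun h => absurd (Finset.mem_univ _) h

theorem isClassFunction_iff_mem_range {f : G → ℂ} :
    IsClassFunction f ↔ f ∈ LinearMap.range (LinearMap.funLeft ℂ ℂ (ConjClasses.mk (α := G))) := by
  constructor
  · intro hf
    refine ⟨Quotient.lift f fun a b hab => ?_, rfl⟩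
    obtain ⟨s, rfl⟩ := isConj_iff.mp hab
    exact (hf s a).symm
  · rintro ⟨F, rfl⟩ s g
    exact congrArg F (ConjClasses.mk_eq_mk_iff_isConj.mpr (isConj_iff.mpr ⟨s, rfl⟩)).symm

theorem span_irr_eq_range [Finite G] : Submodule.span ℂ (Set.range fun ψ : Irr G => ψ.1) =
    LinearMap.range (LinearMap.funLeft ℂ ℂ (ConjClasses.mk (α := G))) := by
  have := Fintype.ofFinite (Irr G)
  refine le_antisymm (Submodule.span_le.mpr ?_) fun f hf => ?_
  · rintro _ ⟨ψ, rfl⟩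
    exact isClassFunction_iff_mem_range.mp ψ.2.isCharacter.isClassFunction
  · rw [(isClassFunction_iff_mem_range.mpr hf).eq_sum]
    exact Submodule.sum_mem _ fun ψ _ => Submodule.smul_mem _ _ (Submodule.subset_span ⟨ψ, rfl⟩)

theorem card_irr [Finite G] : Nat.card (Irr G) = Nat.card (ConjClasses G) := by
  have := Fintype.ofFinite (Irr G)
  have := Fintype.ofFinite (ConjClasses G)
  have hinj := LinearMap.funLeft_injective_of_surjective ℂ ℂ _ (ConjClasses.mk_surjective (α := G))
  rw [Nat.card_eq_fintype_card, ← finrank_span_eq_card linearIndependent_irr, span_irr_eq_range,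
    LinearMap.finrank_range_of_inj hinj, Module.finrank_fintype_fun_eq_card,
    Nat.card_eq_fintype_card]

theorem isCharacter_of_scalarProduct [Finite G] {f : G → ℂ} (hf : IsClassFunction f)
    (h : ∀ ψ : G → ℂ, IsIrreducibleCharacter ψ → ∃ m : ℕ, scalarProduct f ψ = m) :
    IsCharacter f := by
  have := Fintype.ofFinite (Irr G)
  rw [hf.eq_sum]
  refine IsCharacter.sum _ fun ψ _ => ?_
  obtain ⟨m, hm⟩ := h ψ.1 ψ.2
  rw [hm, Nat.cast_smul_eq_nsmul]
  exact ψ.2.isCharacter.nsmul m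

theorem IsCharacter.exists_eq_add [Finite G] {f : G → ℂ} (hf : IsCharacter f) (hf0 : f ≠ 0) :
    ∃ ψ f', IsIrreducibleCharacter ψ ∧ IsCharacter f' ∧ f = ψ + f' := by
  obtain ⟨ψ, hψ, hfψ⟩ : ∃ ψ, IsIrreducibleCharacter ψ ∧ scalarProduct f ψ ≠ 0 := by
    by_contra! h
    exact hf0 (hf.isClassFunction.eq_zero h)
  refine ⟨ψ, f - ψ, hψ, isCharacter_of_scalarProduct (fun s g => ?_) fun φ hφ => ?_, by simp⟩
  · rw [Pi.sub_apply, Pi.sub_apply, hf.isClassFunction, hψ.isCharacter.isClassFunction]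
  · obtain ⟨m, hm⟩ := hf.exists_scalarProduct_eq hφ.isCharacter
    rw [← scalarProductLeft_apply, map_sub, scalarProductLeft_apply, scalarProductLeft_apply, hm]
    obtain rfl | hne := eq_or_ne ψ φ
    · have hm1 : 1 ≤ m := Nat.one_le_iff_ne_zero.mpr fun h => hfψ (by simp [hm, h])
      exact ⟨m - 1, by rw [hψ.scalarProduct_self]; push_cast [hm1]; rfl⟩
    · exact ⟨m, by rw [hψ.scalarProduct_eq_zero hφ hne, sub_zero]⟩

theorem IsIrreducibleCharacter.scalarProduct_add_ne_zero [Finite G] {ψ f : G → ℂ}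
    (hψ : IsIrreducibleCharacter ψ) (hf : IsCharacter f) : scalarProduct (ψ + f) ψ ≠ 0 := by
  obtain ⟨m, hm⟩ := hf.exists_scalarProduct_eq hψ.isCharacter
  rw [← scalarProductLeft_apply, map_add, scalarProductLeft_apply, scalarProductLeft_apply, hm,
    hψ.scalarProduct_self, add_comm]
  exact Nat.cast_add_one_ne_zero m

theorem IsCharacter.eq_zero_of_add_eq_zero [Finite G] {f f' : G → ℂ} (hf : IsCharacter f)
    (hf' : IsCharacter f') (h : f + f' = 0) : f = 0 := by
  by_contra hf0
  obtain ⟨ψ, k, hψ, hk, rfl⟩ := hf.exists_eq_add hf0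
  apply hψ.scalarProduct_add_ne_zero (hk.add hf')
  rw [← add_assoc, h, ← scalarProductLeft_apply, map_zero]

theorem IsIrreducibleCharacter.eq_zero_or_eq_zero [Finite G] {f f' : G → ℂ}
    (h : IsIrreducibleCharacter (f + f')) (hf : IsCharacter f) (hf' : IsCharacter f') :
    f = 0 ∨ f' = 0 := by
  refine or_iff_not_imp_left.mpr fun hf0 => ?_
  obtain ⟨ψ, k, hψ, hk, rfl⟩ := hf.exists_eq_add hf0
  have heq : ψ + k + f' = ψ := by
    by_contra hne
    apply hψ.scalarProduct_add_ne_zero (hk.add hf')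
    rw [← add_assoc, h.scalarProduct_eq_zero hψ hne]
  refine hf'.eq_zero_of_add_eq_zero hk ?_
  rwa [add_assoc, add_eq_left, add_comm] at heq

section Induction

variable (H : Subgroup G) (f : H → ℂ)

theorem extendByZero_of_mem {g : G} (hg : g ∈ H) : extendByZero H f g = f ⟨g, hg⟩ :=
  dif_pos hg

theorem extendByZero_of_notMem {g : G} (hg : g ∉ H) : extendByZero H f g = 0 :=
  dif_neg hg

theorem sum_extendByZero_mul [Fintype G] [Fintype H] (k : G → ℂ) :
    ∑ g, extendByZero H f g * k g = ∑ h : H, f h * k h := by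
  refine (Fintype.sum_of_injective (Subtype.val : H → G) Subtype.val_injective _ _
    (fun g hg => ?_) fun h => ?_).symm
  · rw [extendByZero_of_notMem H f (by simpa using hg), zero_mul]
  · rw [extendByZero_of_mem H f h.2]

theorem induced_eq_sum [Fintype G] (g : G) :
    induced H f g = (Nat.card H : ℂ)⁻¹ * ∑ s : G, extendByZero H f (s * g * s⁻¹) := by
  rw [induced, finsum_eq_sum_of_fintype]

theorem isClassFunction_induced [Finite G] : IsClassFunction (induced H f) := by
  have := Fintype.ofFinite G
  intro t g
  rw [induced_eq_sum, induced_eq_sum]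
  congr 1
  exact Fintype.sum_equiv (Equiv.mulRight t) _ _ fun s => by simp [mul_assoc]

theorem scalarProduct_induced [Finite G] {ψ : G → ℂ} (hψ : IsClassFunction ψ) :
    scalarProduct (induced H f) ψ = scalarProduct f (ψ ∘ H.subtype) := by
  classical
  have := Fintype.ofFinite G
  have hcard : (Nat.card G : ℂ) ≠ 0 := Nat.cast_ne_zero.mpr Nat.card_pos.ne'
  have hconj : ∀ s : G, ∑ g, extendByZero H f (s * g * s⁻¹) * starRingEnd ℂ (ψ g) =
      ∑ h : H, f h * starRingEnd ℂ (ψ h) := fun s => by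
    rw [← sum_extendByZero_mul H f fun g => starRingEnd ℂ (ψ g)]
    exact Fintype.sum_equiv (MulAut.conj s).toEquiv _ _ fun g => by
      simp [MulAut.conj_apply, hψ s g]
  calc scalarProduct (induced H f) ψ = (Nat.card G : ℂ)⁻¹ * ((Nat.card H : ℂ)⁻¹ * ∑ s : G,
        ∑ g, extendByZero H f (s * g * s⁻¹) * starRingEnd ℂ (ψ g)) := by
        simp only [scalarProduct_eq_sum, induced_eq_sum]
        rw [Finset.sum_comm]
        simp only [Finset.mul_sum, Finset.sum_mul, mul_assoc]
    _ = scalarProduct f (ψ ∘ H.subtype) := by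
        simp only [hconj, Finset.sum_const, Finset.card_univ, nsmul_eq_mul, scalarProduct_eq_sum,
          Function.comp_apply, Subgroup.subtype_apply, ← Nat.card_eq_fintype_card (α := G)]
        field_simp

variable {f} in
theorem IsCharacter.induced [Finite G] (hf : IsCharacter f) : IsCharacter (induced H f) := by
  refine isCharacter_of_scalarProduct (isClassFunction_induced H f) fun ψ hψ => ?_
  rw [scalarProduct_induced H f hψ.isCharacter.isClassFunction]
  exact hf.exists_scalarProduct_eq (hψ.isCharacter.comp H.subtype)

end Induction

end Characters

/-! ### The parabolic group -/

section Orbits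

variable {n : ℕ} {c : Composition n} {F : Type*} [Field F]

theorem index_mono : Monotone c.index := by
  intro i j hij
  by_contra! h
  have h_succ : c.sizeUpTo (c.index j).succ ≤ c.sizeUpTo (c.index i) :=
    c.monotone_sizeUpTo (by simpa using h)
  have : (i : ℕ) ≤ j := hij
  have := c.lt_sizeUpTo_index_succ j
  have := c.sizeUpTo_index_le i
  omega

theorem index_surjective : Function.Surjective c.index := fun k =>
  ⟨c.embedding k ⟨0, c.blocks_pos' _ k.2⟩, c.index_embedding _ _⟩

theorem exists_mat_eq {A : Matrix (Fin n) (Fin n) F} (hdet : A.det ≠ 0)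
    (hA : ∀ i j, c.index j < c.index i → A i j = 0) : ∃ g : Par c F, mat g = A :=
  ⟨⟨Matrix.GeneralLinearGroup.mkOfDetNeZero A hdet, hA⟩, rfl⟩

theorem exists_mat_eq_of_upper {A : Matrix (Fin n) (Fin n) F} (hA : ∀ i j, j < i → A i j = 0)
    (hdiag : ∀ i, A i i ≠ 0) : ∃ g : Par c F, mat g = A := by
  refine exists_mat_eq ?_ fun i j hij => hA i j (index_mono.reflect_lt hij)
  rw [Matrix.det_of_isUpperTriangular (fun i j hij => hA i j hij)]
  exact Finset.prod_ne_zero_iff.mpr fun i _ => hdiag i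

theorem exists_mat_eq_permMatrix {σ : Equiv.Perm (Fin n)} (hσ : ∀ i, c.index (σ i) = c.index i) :
    ∃ g : Par c F, mat g = σ.permMatrix F := by
  refine exists_mat_eq ?_ fun i j hij => ?_
  · rcases Int.units_eq_one_or σ.sign with h | h <;> simp [Matrix.det_permutation, h]
  · have hne : j ≠ σ i := by
      rintro rfl
      exact hij.ne (hσ i)
    simp [Equiv.Perm.permMatrix, PEquiv.toMatrix_apply, hne.symm]

/-! ### Gaussian elimination by parabolic row and column operations -/

theorem exists_mul_mul_eq_pivot (c : Composition n) {M : Matrix (Fin n) (Fin n) F} {i j : Fin n}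
    (hij : M i j ≠ 0) (hleft : ∀ t < j, M i t = 0) (hbelow : ∀ s > i, M s j = 0) :
    ∃ a b : Par c F, (∀ t, (mat a * M * mat b) i t = if t = j then 1 else 0) ∧
      (∀ s, (mat a * M * mat b) s j = if s = i then 1 else 0) ∧
      ∀ s t, s ≠ i → t ≠ j → (mat a * M * mat b) s t = M s t - M s j * M i t / M i j := by
  let α : Fin n → F := fun s => if s = i then (M i j)⁻¹ - 1 else -(M s j / M i j)
  let β : Fin n → F := fun t => if t = j then 0 else -(M i t / M i j)
  obtain ⟨a, ha⟩ := exists_mat_eq_of_upper (c := c) (A := 1 + Matrix.of fun s u =>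
      if u = i then α s else 0) (fun s u hus => by
        rcases eq_or_ne u i with rfl | hu
        · simp [hus.ne', α, hbelow s hus]
        · simp [Matrix.one_apply_ne hus.ne', hu]) (fun u => by
        rcases eq_or_ne u i with rfl | hu <;> simp [α, *])
  obtain ⟨b, hb⟩ := exists_mat_eq_of_upper (c := c) (A := 1 + Matrix.of fun u t =>
      if u = j then β t else 0) (fun u t htu => by
        rcases eq_or_ne u j with rfl | hu
        · simp [htu.ne, htu.ne', β, hleft t htu]
        · simp [Matrix.one_apply_ne htu.ne', hu]) (fun u => by
        rcases eq_or_ne u j with rfl | hu <;> simp [β, *])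
  have hMb (s t) : (M * mat b) s t = M s t + M s j * β t := by
    rw [hb, Matrix.mul_add, Matrix.mul_one, Matrix.add_apply]
    simp [Matrix.mul_apply]
  have haMb (s t) : (mat a * M * mat b) s t =
      (M s t + M s j * β t) + α s * (M i t + M i j * β t) := by
    rw [Matrix.mul_assoc, ha, Matrix.add_mul, Matrix.one_mul, Matrix.add_apply,
      Matrix.mul_apply (M := Matrix.of _), ← hMb, ← hMb]
    simp
  refine ⟨a, b, fun t => ?_, fun s => ?_, fun s t hs ht => ?_⟩
  · rcases eq_or_ne t j with rfl | ht
    · simp [haMb, α, β, sub_mul, hij]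
    · simp [haMb, α, β, ht, mul_div_cancel₀ _ hij]
  · rcases eq_or_ne s i with rfl | hs
    · simp [haMb, α, β, sub_mul, hij]
    · simp [haMb, α, β, hs, hij]
  · simp only [haMb, α, β, if_neg hs, if_neg ht]
    field_simp
    ring

variable (F) in
/-- The partial permutation matrix of a rook placement. -/
def rookMatrix (D : Finset (Fin n × Fin n)) : Matrix (Fin n) (Fin n) F :=
  Matrix.of fun i j => if (i, j) ∈ D then 1 else 0

theorem rookMatrix_apply (D : Finset (Fin n × Fin n)) (i j : Fin n) :
    rookMatrix F D i j = if (i, j) ∈ D then 1 else 0 := rfl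

/-- The rows of `M` with numbers at least `k` are those of a partial permutation matrix, whose
nonzero columns are cleared in all of `M`. -/
def IsReduced (k : ℕ) (M : Matrix (Fin n) (Fin n) F) : Prop :=
  ∀ s t, k ≤ s.val → M s t ≠ 0 →
    M s t = 1 ∧ (∀ t', t' ≠ t → M s t' = 0) ∧ ∀ s', s' ≠ s → M s' t = 0

theorem IsReduced.exists_pred (c : Composition n) {i : Fin n} {M : Matrix (Fin n) (Fin n) F}
    (h : IsReduced (i + 1) M) : ∃ a b : Par c F, IsReduced i (mat a * M * mat b) := by
  have hlt {s : Fin n} (hs : i ≤ s) (hsi : s ≠ i) : (i : ℕ) + 1 ≤ s := hs.lt_of_ne' hsi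
  by_cases hrow : ∀ t, M i t = 0
  · refine ⟨1, 1, fun s t hs hst => ?_⟩
    simp only [mat_one, Matrix.one_mul, Matrix.mul_one] at hst ⊢
    exact h s t (hlt hs fun hsi => hst (hsi ▸ hrow t)) hst
  push Not at hrow
  classical
  obtain ⟨j, hij, hmin⟩ := (Finset.univ.filter fun t => M i t ≠ 0).exists_min_image id
    (hrow.imp fun t ht => by simpa using ht)
  simp only [Finset.mem_filter, Finset.mem_univ, true_and, id] at hij hmin
  have hleft (t) (ht : t < j) : M i t = 0 := by_contra fun h0 => (hmin t h0).not_gt ht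
  have hbelow (s) (hs : i < s) : M s j = 0 := by_contra fun h0 =>
    hij ((h s j hs h0).2.2 i hs.ne)
  obtain ⟨a, b, hrow_i, hcol_j, hschur⟩ := exists_mul_mul_eq_pivot c hij hleft hbelow
  refine ⟨a, b, fun s t hs hst => ?_⟩
  rcases eq_or_ne s i with rfl | hsi
  · obtain rfl : t = j := by_contra fun ht => hst (by rw [hrow_i, if_neg ht])
    exact ⟨by rw [hrow_i, if_pos rfl], fun t' ht' => by rw [hrow_i, if_neg ht'],
      fun s' hs' => by rw [hcol_j, if_neg hs']⟩
  have htj : t ≠ j := by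
    rintro rfl
    exact hst (by rw [hcol_j, if_neg hsi])
  have hs_row (t') (ht' : t' ≠ j) : (mat a * M * mat b) s t' = M s t' := by
    rw [hschur s t' hsi ht', hbelow s (hlt hs hsi), zero_mul, zero_div, sub_zero]
  obtain ⟨h_one, h_row, h_col⟩ := h s t (hlt hs hsi) (hs_row t htj ▸ hst)
  refine ⟨by rw [hs_row t htj, h_one], fun t' ht' => ?_, fun s' hs' => ?_⟩
  · rcases eq_or_ne t' j with rfl | ht'j
    · rw [hcol_j, if_neg hsi]
    · rw [hs_row t' ht'j, h_row t' ht']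
  · rcases eq_or_ne s' i with rfl | hs'i
    · rw [hrow_i, if_neg htj]
    · rw [hschur s' t hs'i htj, h_col s' hs', h_col i hsi.symm, mul_zero, zero_div, sub_zero]

theorem exists_isReduced (c : Composition n) (M : Matrix (Fin n) (Fin n) F) {k : ℕ} (hk : k ≤ n) :
    ∃ a b : Par c F, IsReduced k (mat a * M * mat b) := by
  induction hk using Nat.decreasingInduction with
  | self => exact ⟨1, 1, fun s _ hs => absurd s.2 hs.not_gt⟩
  | of_succ k hk ih =>
    obtain ⟨a, b, hab⟩ := ih
    obtain ⟨a', b', h⟩ := hab.exists_pred c (i := ⟨k, hk⟩)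
    exact ⟨a' * a, b * b', by simpa only [mat_mul, Matrix.mul_assoc] using h⟩

theorem exists_mul_mul_eq_rookMatrix (c : Composition n) (M : Matrix (Fin n) (Fin n) F) :
    ∃ (a b : Par c F) (D : Finset (Fin n × Fin n)),
      IsRookPlacement Set.univ D ∧ mat a * M * mat b = rookMatrix F D := by
  classical
  obtain ⟨a, b, h⟩ := exists_isReduced c M n.zero_le
  set N := mat a * M * mat b
  refine ⟨a, b, Finset.univ.filter fun γ => N γ.1 γ.2 ≠ 0, ⟨by simp, ?_, ?_⟩, ?_⟩
  · rintro ⟨i, j⟩ hγ ⟨_, j'⟩ hγ' rfl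
    simp only [Finset.mem_filter, Finset.mem_univ, true_and] at hγ hγ'
    by_contra hne
    exact hγ' ((h i j i.val.zero_le hγ).2.1 j' fun h' => hne (by rw [h']))
  · rintro ⟨i, j⟩ hγ ⟨i', _⟩ hγ' rfl
    simp only [Finset.mem_filter, Finset.mem_univ, true_and] at hγ hγ'
    by_contra hne
    exact hγ' ((h i j i.val.zero_le hγ).2.2 i' fun h' => hne (by rw [h']))
  · ext i j
    simp only [rookMatrix_apply, Finset.mem_filter, Finset.mem_univ, true_and]
    split_ifs with hij
    · exact (h i j i.val.zero_le hij).1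
    · exact not_not.mp hij

/-! ### Orbits of rook matrices -/

theorem exists_perm_apply_eq {α β ι : Type*} [Finite ι] (f : α → β) {u v : ι → α}
    (hu : Function.Injective u) (hv : Function.Injective v) (huv : ∀ i, f (u i) = f (v i)) :
    ∃ σ : Equiv.Perm α, (∀ x, f (σ x) = f x) ∧ ∀ i, σ (u i) = v i := by
  classical
  have := Fintype.ofFinite ι
  suffices H : ∀ s : Finset ι, ∃ σ : Equiv.Perm α, (∀ x, f (σ x) = f x) ∧
      ∀ i ∈ s, σ (u i) = v i by simpa using H Finset.univ
  intro s
  induction s using Finset.induction_on with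
  | empty => exact ⟨1, by simp, by simp⟩
  | insert i s hi ih =>
    obtain ⟨σ, hσf, hσ⟩ := ih
    refine ⟨Equiv.swap (σ (u i)) (v i) * σ, fun x => ?_, fun j hj => ?_⟩
    · rw [Equiv.Perm.mul_apply, Equiv.swap_apply_def]
      split_ifs with e1 e2
      · rw [← huv, ← hσf x, e1, hσf]
      · rw [hσf, huv, ← e2, hσf]
      · exact hσf x
    · rw [Equiv.Perm.mul_apply]
      rcases Finset.mem_insert.mp hj with rfl | hj
      · simp
      have hji : j ≠ i := fun h => hi (h ▸ hj)
      rw [Equiv.swap_apply_of_ne_of_ne, hσ j hj]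
      · exact fun h => hji (hu (σ.injective h))
      · exact hσ j hj ▸ fun h => hji (hv h)

theorem exists_equiv_of_blockCount_eq {D D' : Finset (Fin n × Fin n)}
    (h : ∀ k m, blockCount c D k m = blockCount c D' k m) :
    ∃ e : D ≃ D', ∀ γ, c.index (e γ).1.1 = c.index γ.1.1 ∧ c.index (e γ).1.2 = c.index γ.1.2 := by
  classical
  let block (γ : Fin n × Fin n) := (c.index γ.1, c.index γ.2)
  have hcard (E : Finset (Fin n × Fin n)) (p) :
      Fintype.card {γ : E // block γ = p} = blockCount c E p.1 p.2 := by
    rw [Fintype.card_subtype, blockCount, ← Finset.card_map (Function.Embedding.subtype _)]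
    congr 1
    ext γ
    simp [block, Prod.ext_iff, and_comm, and_assoc]
  let e (p) : {γ : D // block γ = p} ≃ {γ : D' // block γ = p} :=
    Fintype.equivOfCardEq (by rw [hcard, hcard, h])
  exact ⟨Equiv.ofFiberEquiv e, fun γ => Prod.ext_iff.mp (Equiv.ofFiberEquiv_map e γ)⟩

theorem exists_mul_rookMatrix_mul_eq {D D' : Finset (Fin n × Fin n)}
    (hD : IsRookPlacement Set.univ D) (hD' : IsRookPlacement Set.univ D')
    (h : ∀ k m, blockCount c D k m = blockCount c D' k m) :
    ∃ a b : Par c F, mat a * rookMatrix F D * mat b = rookMatrix F D' := by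
  obtain ⟨e, he⟩ := exists_equiv_of_blockCount_eq h
  obtain ⟨σ, hσ_index, hσ⟩ := exists_perm_apply_eq c.index (u := fun γ : D => (e γ).1.1)
    (v := fun γ => γ.1.1)
    (fun γ γ' h => e.injective (Subtype.ext (hD'.row _ (e γ).2 _ (e γ').2 h)))
    (fun γ γ' h => Subtype.ext (hD.row _ γ.2 _ γ'.2 h)) fun γ => (he γ).1
  obtain ⟨τ, hτ_index, hτ⟩ := exists_perm_apply_eq c.index (u := fun γ : D => γ.1.2)
    (v := fun γ => (e γ).1.2)
    (fun γ γ' h => Subtype.ext (hD.col _ γ.2 _ γ'.2 h))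
    (fun γ γ' h => e.injective (Subtype.ext (hD'.col _ (e γ).2 _ (e γ').2 h)))
    fun γ => (he γ).2.symm
  have he_eq (γ : D) : (e γ).1 = (σ.symm γ.1.1, τ γ.1.2) :=
    Prod.ext (σ.eq_symm_apply.mpr (hσ γ)) (hτ γ).symm
  have hmem (i j) : (σ i, τ.symm j) ∈ D ↔ (i, j) ∈ D' := by
    refine ⟨fun hij => ?_, fun hij => ?_⟩
    · simpa [he_eq] using (e ⟨_, hij⟩).2
    · obtain ⟨hi, hj⟩ : i = _ ∧ j = _ := by
        simpa only [Equiv.apply_symm_apply, Prod.ext_iff] using he_eq (e.symm ⟨_, hij⟩)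
      rw [σ.eq_symm_apply.mp hi, τ.symm_apply_eq.mpr hj]
      exact (e.symm ⟨_, hij⟩).2
  obtain ⟨a, ha⟩ := exists_mat_eq_permMatrix (F := F) hσ_index
  obtain ⟨b, hb⟩ := exists_mat_eq_permMatrix (F := F) hτ_index
  refine ⟨a, b, ?_⟩
  ext i j
  rw [ha, hb, Equiv.Perm.permMatrix, Equiv.Perm.permMatrix, PEquiv.toMatrix_toPEquiv_mul,
    PEquiv.mul_toMatrix_toPEquiv]
  simp [rookMatrix_apply, hmem]

/-! ### Rank invariants -/

open Classical in
/-- The part of a matrix in the rows of the segments `≥ k` and the columns of the segments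
`≤ m`; its rank is invariant under the parabolic subgroup on both sides. -/
def corner (c : Composition n) (k m : Fin c.length) (M : Matrix (Fin n) (Fin n) F) :
    Matrix (Fin n) (Fin n) F :=
  Matrix.of fun i j => if k ≤ c.index i ∧ c.index j ≤ m then M i j else 0

theorem rank_corner_mul_mul_le (k m : Fin c.length) (a b : Par c F)
    (M : Matrix (Fin n) (Fin n) F) :
    (corner c k m (mat a * M * mat b)).rank ≤ (corner c k m M).rank := by
  classical
  let P : Matrix (Fin n) (Fin n) F := Matrix.diagonal fun i => if k ≤ c.index i then 1 else 0
  let Q : Matrix (Fin n) (Fin n) F := Matrix.diagonal fun i => if c.index i ≤ m then 1 else 0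
  have hcorner (X : Matrix (Fin n) (Fin n) F) : corner c k m X = P * X * Q := by
    ext i j
    simp only [corner, Matrix.of_apply, P, Q, Matrix.mul_diagonal, Matrix.diagonal_mul]
    split_ifs <;> simp_all
  have hPa : P * mat a = P * mat a * P := by
    ext i j
    simp only [P, Matrix.mul_diagonal, Matrix.diagonal_mul]
    split_ifs with hi hj <;> simp only [one_mul, zero_mul, mul_one, mul_zero]
    exact mat_block a i j ((not_le.mp hj).trans_le hi)
  have hbQ : mat b * Q = Q * (mat b * Q) := by
    ext i j
    simp only [Q, Matrix.mul_diagonal, Matrix.diagonal_mul]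
    split_ifs with hj hi <;> simp only [one_mul, zero_mul, mul_one, mul_zero]
    exact mat_block b i j (hj.trans_lt (not_le.mp hi))
  have : corner c k m (mat a * M * mat b) = P * mat a * (corner c k m M) * (mat b * Q) := by
    calc corner c k m (mat a * M * mat b) = (P * mat a) * M * (mat b * Q) := by
          simp only [hcorner, Matrix.mul_assoc]
      _ = (P * mat a * P) * M * (Q * (mat b * Q)) := by rw [← hPa, ← hbQ]
      _ = P * mat a * (corner c k m M) * (mat b * Q) := by simp only [hcorner, Matrix.mul_assoc]
  rw [this]
  exact (Matrix.rank_mul_le_left _ _).trans (Matrix.rank_mul_le_right _ _)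

theorem rank_corner_mul_mul (k m : Fin c.length) (a b : Par c F) (M : Matrix (Fin n) (Fin n) F) :
    (corner c k m (mat a * M * mat b)).rank = (corner c k m M).rank := by
  refine (rank_corner_mul_mul_le k m a b M).antisymm ?_
  have hM : mat a⁻¹ * (mat a * M * mat b) * mat b⁻¹ = M := by
    rw [Matrix.mul_assoc (mat a), ← Matrix.mul_assoc, mat_inv_mul, Matrix.one_mul,
      Matrix.mul_assoc, mat_mul_inv, Matrix.mul_one]
  simpa only [hM] using rank_corner_mul_mul_le k m a⁻¹ b⁻¹ (mat a * M * mat b)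

theorem rank_rookMatrix {D : Finset (Fin n × Fin n)} (hD : IsRookPlacement Set.univ D) :
    (rookMatrix F D).rank = D.card := by
  classical
  obtain ⟨σ, -, hσ⟩ := exists_perm_apply_eq (fun _ : Fin n => ()) (u := fun γ : D => γ.1.1)
    (v := fun γ => γ.1.2) (fun γ γ' h => Subtype.ext (hD.row _ γ.2 _ γ'.2 h))
    (fun γ γ' h => Subtype.ext (hD.col _ γ.2 _ γ'.2 h)) fun _ => rfl
  have hmem (i j) : (i, j) ∈ D ↔ i ∈ D.image Prod.fst ∧ σ i = j := by
    refine ⟨fun h => ⟨Finset.mem_image_of_mem Prod.fst h, hσ ⟨_, h⟩⟩, ?_⟩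
    rintro ⟨hi, rfl⟩
    obtain ⟨γ, hγ, rfl⟩ := Finset.mem_image.mp hi
    rwa [hσ ⟨γ, hγ⟩]
  have hrook : rookMatrix F D =
      Matrix.diagonal (fun i => if i ∈ D.image Prod.fst then 1 else 0) * σ.permMatrix F := by
    ext i j
    simp only [rookMatrix_apply, hmem, Matrix.diagonal_mul, Equiv.Perm.permMatrix,
      PEquiv.toMatrix_apply, Equiv.toPEquiv_apply, Option.mem_some_iff, ite_zero_mul_ite_zero,
      mul_one]
  have hdet : IsUnit (σ.permMatrix F).det := by
    rw [Matrix.det_permutation]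
    exact (Units.isUnit _).map (Int.castRingHom F)
  rw [hrook, Matrix.rank_mul_eq_left_of_isUnit_det _ _ hdet, Matrix.rank_diagonal,
    ← Finset.card_image_of_injOn fun γ hγ γ' hγ' => hD.row γ hγ γ' hγ', Fintype.card_subtype]
  simp only [ne_eq, ite_eq_right_iff, one_ne_zero, imp_false, not_not, Finset.filter_univ_mem]

theorem IsRookPlacement.mono {Δ Δ' : Set (Fin n × Fin n)} {D D' : Finset (Fin n × Fin n)}
    (hD : IsRookPlacement Δ D) (h : D' ⊆ D) (h' : ∀ γ ∈ D', γ ∈ Δ') : IsRookPlacement Δ' D' :=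
  ⟨h', fun γ hγ γ' hγ' => hD.row γ (h hγ) γ' (h hγ'), fun γ hγ γ' hγ' =>
    hD.col γ (h hγ) γ' (h hγ')⟩

theorem rank_corner_rookMatrix {D : Finset (Fin n × Fin n)} (hD : IsRookPlacement Set.univ D)
    (k m : Fin c.length) : (corner c k m (rookMatrix F D)).rank =
      (D.filter fun γ => k ≤ c.index γ.1 ∧ c.index γ.2 ≤ m).card := by
  classical
  rw [← rank_rookMatrix (F := F) (hD.mono (Finset.filter_subset _ _) (by simp))]
  congr 1
  ext i j
  simp only [corner, rookMatrix_apply, Matrix.of_apply, Finset.mem_filter]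
  split_ifs <;> simp_all

theorem eq_of_sum_le_eq {P M : Type*} [PartialOrder P] [Fintype P] [DecidableLE P]
    [AddCancelCommMonoid M] {f g : P → M} {S : Set P} (hS : IsLowerSet S)
    (h : ∀ p ∈ S, ∑ q with q ≤ p, f q = ∑ q with q ≤ p, g q) {p : P} (hp : p ∈ S) : f p = g p := by
  classical
  induction p using WellFoundedLT.induction with
  | _ p ih =>
  have hsplit (u : P → M) : ∑ q with q ≤ p, u q = u p + ∑ q with q < p, u q := by
    rw [← Finset.sum_insert (by simp)]
    congr 1
    ext q
    simp [le_iff_eq_or_lt]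
  have hlt : ∑ q with q < p, f q = ∑ q with q < p, g q := Finset.sum_congr rfl fun q hq =>
    ih q (Finset.mem_filter.mp hq).2 (hS (Finset.mem_filter.mp hq).2.le hp)
  have := h p hp
  rwa [hsplit, hsplit, hlt, add_left_inj] at this

theorem card_corner_eq_sum_blockCount (D : Finset (Fin n × Fin n))
    (p : (Fin c.length)ᵒᵈ × Fin c.length) :
    (D.filter fun γ => OrderDual.ofDual p.1 ≤ c.index γ.1 ∧ c.index γ.2 ≤ p.2).card =
      ∑ q with q ≤ p, blockCount c D (OrderDual.ofDual q.1) q.2 := by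
  classical
  rw [Finset.card_eq_sum_card_fiberwise
    (f := fun γ : Fin n × Fin n => (OrderDual.toDual (c.index γ.1), c.index γ.2))
    (t := Finset.univ.filter (· ≤ p)) fun γ hγ => by
      simpa [Prod.le_def, OrderDual.toDual_le] using (Finset.mem_filter.mp hγ).2]
  refine Finset.sum_congr rfl fun q hq => congrArg Finset.card ?_
  have hqp := (Finset.mem_filter.mp hq).2
  ext γ
  simp only [Finset.mem_filter, and_assoc, and_congr_right_iff]
  refine fun _ => ⟨?_, ?_⟩
  · rintro ⟨-, -, rfl⟩
    exact ⟨rfl, rfl⟩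
  · rintro ⟨h₁, h₂⟩
    exact ⟨h₁ ▸ hqp.1, h₂ ▸ hqp.2, Prod.ext (congrArg OrderDual.toDual h₁) h₂⟩

/-- The corners of a matrix at the positions in `S` only see its entries at the positions in `S`,
their ranks are invariant, and the ranks determine the block counts by Möbius inversion. -/
theorem blockCount_eq_of_eqOn {S : Fin c.length → Fin c.length → Prop}
    (hS : ∀ {k m k' m'}, S k m → k ≤ k' → m' ≤ m → S k' m') {D D' : Finset (Fin n × Fin n)}
    (hD : IsRookPlacement Set.univ D) (hD' : IsRookPlacement Set.univ D') {a b : Par c F}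
    (h : ∀ i j, S (c.index i) (c.index j) →
      (mat a * rookMatrix F D * mat b) i j = rookMatrix F D' i j)
    {k m : Fin c.length} (hkm : S k m) : blockCount c D k m = blockCount c D' k m := by
  classical
  refine eq_of_sum_le_eq (P := (Fin c.length)ᵒᵈ × Fin c.length)
    (f := fun p => blockCount c D (OrderDual.ofDual p.1) p.2)
    (g := fun p => blockCount c D' (OrderDual.ofDual p.1) p.2)
    (S := {p | S (OrderDual.ofDual p.1) p.2}) (fun p q (hqp : q.1 ≤ p.1 ∧ q.2 ≤ p.2) hp =>
      hS hp hqp.1 hqp.2)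
    (fun p hp => ?_) (p := (OrderDual.toDual k, m)) hkm
  rw [← card_corner_eq_sum_blockCount, ← card_corner_eq_sum_blockCount,
    ← rank_corner_rookMatrix (F := F) hD, ← rank_corner_rookMatrix (F := F) hD',
    ← rank_corner_mul_mul _ _ a b]
  congr 1
  ext i j
  simp only [corner, Matrix.of_apply]
  split_ifs with hij
  · exact h i j (hS hp hij.1 hij.2)
  · rfl

end Orbits

section Forms

variable {n : ℕ} {c : Composition n} {F : Type*} [Field F]

/-! ### Linear forms on the radical -/

@[simp] theorem coe_lmul (g : Par c F) (x : radical c F) :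
    (lmul g x : Matrix (Fin n) (Fin n) F) = mat g * x := rfl

@[simp] theorem coe_rmul (g : Par c F) (x : radical c F) :
    (rmul g x : Matrix (Fin n) (Fin n) F) = x * mat g := rfl

theorem formAct_apply (a b : Par c F) (lam : Forms c F) (x : radical c F) :
    formAct a lam b x = lam (lmul b (rmul a x)) := rfl

theorem formAct_formAct (a b a' b' : Par c F) (lam : Forms c F) :
    formAct a (formAct a' lam b') b = formAct (a * a') lam (b' * b) := by
  ext x
  simp only [formAct_apply, lmul_mul, rmul_mul, lmul_rmul]

theorem formAct_one (lam : Forms c F) : formAct 1 lam 1 = lam := by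
  ext x
  simp only [formAct_apply, lmul_one, rmul_one]

theorem formOrbit_formAct (a b : Par c F) (lam : Forms c F) :
    formOrbit (formAct a lam b) = formOrbit lam := by
  ext μ
  constructor
  · rintro ⟨a', b', rfl⟩
    exact ⟨_, _, formAct_formAct _ _ _ _ _⟩
  · rintro ⟨a', b', rfl⟩
    refine ⟨a' * a⁻¹, b⁻¹ * b', ?_⟩
    rw [formAct_formAct, inv_mul_cancel_right, mul_inv_cancel_left]

theorem orbitStabilizer_formAct (a b : Par c F) (lam : Forms c F) :
    orbitStabilizer (formAct a lam b) = orbitStabilizer lam := by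
  ext h
  change _ ∧ _ ↔ _ ∧ _
  rw [formOrbit_formAct]

theorem mem_orbitStabilizer_iff (lam : Forms c F) (h : Par c F) :
    h ∈ orbitStabilizer lam ↔ h ∈ levi c F ∧ ∀ (a b : Par c F) (x : radical c F),
      lam (lmul b (rmul a (lmul h x))) = lam (lmul b (rmul a (rmul h x))) := by
  refine and_congr_right fun _ => ⟨fun H a b x => ?_, ?_⟩
  · simpa only [formAct_apply, ← rmul_mul, mul_inv_cancel, rmul_one] using
      H _ ⟨a, b, rfl⟩ (rmul h x)
  · rintro H _ ⟨a, b, rfl⟩ x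
    rw [formAct_apply, formAct_apply, H, ← rmul_mul h⁻¹, inv_mul_cancel, rmul_one]

theorem coe_rootUnit {γ : Fin n × Fin n} (h : γ ∈ jRoots c) :
    (rootUnit γ : radical c F) = Matrix.single γ.1 γ.2 (1 : F) := by
  rw [rootUnit, dif_pos h]

theorem eq_sum_rootUnit (x : radical c F) :
    x = ∑ i, ∑ j, (x : Matrix (Fin n) (Fin n) F) i j • (rootUnit (i, j) : radical c F) := by
  apply Subtype.ext
  simp only [AddSubmonoidClass.coe_finsetSum, SetLike.val_smul]
  conv_lhs => rw [Matrix.matrix_eq_sum_single (x : Matrix (Fin n) (Fin n) F)]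
  refine Finset.sum_congr rfl fun i _ => Finset.sum_congr rfl fun j _ => ?_
  rcases lt_or_ge (c.index i) (c.index j) with hij | hij
  · rw [coe_rootUnit (γ := (i, j)) hij, Matrix.smul_single, smul_eq_mul, mul_one]
  · rw [x.2 i j hij, Matrix.single_zero, zero_smul]

theorem form_eq_iff {lam μ : Forms c F} :
    lam = μ ↔ ∀ γ ∈ jRoots c, lam (rootUnit γ) = μ (rootUnit γ) := by
  refine ⟨fun h γ _ => h ▸ rfl, fun h => LinearMap.ext fun x => ?_⟩
  rw [eq_sum_rootUnit x]
  simp only [map_sum, map_smul]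
  refine Finset.sum_congr rfl fun i _ => Finset.sum_congr rfl fun j _ => ?_
  rcases lt_or_ge (c.index i) (c.index j) with hij | hij
  · rw [h (i, j) hij]
  · rw [x.2 i j hij, zero_smul, zero_smul]

/-- The linear form `x ↦ tr (M x)` on `J`. All linear forms on `J` are of this kind, and only the
entries of `M` strictly below the block diagonal matter. -/
def formOf (M : Matrix (Fin n) (Fin n) F) : Forms c F :=
  Matrix.traceLinearMap (Fin n) F F ∘ₗ LinearMap.mulLeft F M ∘ₗ (radical c F).subtype

theorem formOf_apply (M : Matrix (Fin n) (Fin n) F) (x : radical c F) :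
    formOf M x = (M * x).trace := rfl

theorem formAct_formOf (a b : Par c F) (M : Matrix (Fin n) (Fin n) F) :
    formAct a (formOf M) b = formOf (mat a * M * mat b) := by
  ext x
  rw [formAct_apply, formOf_apply, formOf_apply, coe_lmul, coe_rmul, Matrix.mul_assoc (mat a),
    Matrix.mul_assoc (mat a), Matrix.trace_mul_comm (mat a)]
  simp only [Matrix.mul_assoc]

theorem formOf_rootUnit (M : Matrix (Fin n) (Fin n) F) {γ : Fin n × Fin n} (h : γ ∈ jRoots c) :
    (formOf M : Forms c F) (rootUnit γ) = M γ.2 γ.1 := by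
  rw [formOf_apply, coe_rootUnit h, Matrix.trace_mul_single, MulOpposite.op_one, one_smul]

theorem formOf_eq_iff (M N : Matrix (Fin n) (Fin n) F) :
    (formOf M : Forms c F) = formOf N ↔ ∀ i j, c.index i < c.index j → M j i = N j i := by
  rw [form_eq_iff, Prod.forall]
  exact forall₃_congr fun i j hij => by rw [formOf_rootUnit M hij, formOf_rootUnit N hij]

theorem exists_eq_formOf (lam : Forms c F) : ∃ M, lam = formOf M :=
  ⟨Matrix.of fun j i => lam (rootUnit (i, j)),
    form_eq_iff.mpr fun _ hγ => by rw [formOf_rootUnit _ hγ]; rfl⟩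

theorem rookForm_apply (D : Finset (Fin n × Fin n)) (x : radical c F) :
    rookForm D x = ∑ γ ∈ D, (x : Matrix (Fin n) (Fin n) F) γ.1 γ.2 := by
  simp [rookForm, rootForm]

/-! ### Forms and elements of rook placements -/

theorem sum_single_eq_rookMatrix (D : Finset (Fin n × Fin n)) :
    ∑ γ ∈ D, Matrix.single γ.1 γ.2 1 = rookMatrix F D := by
  ext i j
  simp only [Matrix.sum_apply, Matrix.single_apply, rookMatrix_apply,
    ← Prod.ext_iff (y := (i, j)), Finset.sum_ite_eq']

theorem coe_rookElement {D : Finset (Fin n × Fin n)} (h : ∀ γ ∈ D, γ ∈ jRoots c) :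
    (rookElement D : radical c F) = rookMatrix F D := by
  rw [rookElement, AddSubmonoidClass.coe_finsetSum, ← sum_single_eq_rookMatrix]
  exact Finset.sum_congr rfl fun γ hγ => coe_rootUnit (h γ hγ)

theorem transpose_rookMatrix (D : Finset (Fin n × Fin n)) :
    (rookMatrix F D)ᵀ = rookMatrix F (D.image Prod.swap) := by
  ext i j
  simp [rookMatrix_apply, Finset.mem_image]

theorem rookForm_eq_formOf (D : Finset (Fin n × Fin n)) :
    (rookForm D : Forms c F) = formOf (rookMatrix F (D.image Prod.swap)) := by
  refine form_eq_iff.mpr fun γ hγ => ?_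
  rw [formOf_rootUnit _ hγ, ← transpose_rookMatrix, Matrix.transpose_apply, rookForm_apply,
    coe_rootUnit hγ, rookMatrix_apply]
  simp only [Matrix.single_apply, ← Prod.ext_iff, Finset.sum_ite_eq]

theorem IsRookPlacement.swap {Δ Δ' : Set (Fin n × Fin n)} {D : Finset (Fin n × Fin n)}
    (hD : IsRookPlacement Δ D) (h : ∀ γ ∈ D, γ.swap ∈ Δ') :
    IsRookPlacement Δ' (D.image Prod.swap) := by
  refine ⟨Finset.forall_mem_image.mpr h, ?_, ?_⟩ <;>
    simp only [Finset.forall_mem_image, Prod.fst_swap, Prod.snd_swap]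
  · exact fun γ hγ γ' hγ' heq => congrArg Prod.swap (hD.col γ hγ γ' hγ' heq)
  · exact fun γ hγ γ' hγ' heq => congrArg Prod.swap (hD.row γ hγ γ' hγ' heq)

theorem blockCount_image_swap (D : Finset (Fin n × Fin n)) (k m : Fin c.length) :
    blockCount c (D.image Prod.swap) k m = blockCount c D m k := by
  rw [blockCount, blockCount, Finset.filter_image,
    Finset.card_image_of_injective _ Prod.swap_injective]
  simp only [Prod.fst_swap, Prod.snd_swap, and_comm]

theorem exists_formAct_eq_rookForm (lam : Forms c F) :
    ∃ D, IsRookPlacement (jRoots c) D ∧ ∃ a b : Par c F, formAct a lam b = rookForm D := by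
  classical
  obtain ⟨M, rfl⟩ := exists_eq_formOf lam
  obtain ⟨a, b, E, hE, h⟩ := exists_mul_mul_eq_rookMatrix c M
  refine ⟨(E.image Prod.swap).filter (· ∈ jRoots c), ?_, a, b, ?_⟩
  · exact (hE.swap fun _ _ => Set.mem_univ _).mono (Finset.filter_subset _ _)
      fun γ hγ => (Finset.mem_filter.mp hγ).2
  · rw [formAct_formOf, h, rookForm_eq_formOf, formOf_eq_iff]
    intro i j hij
    have hij : (i, j) ∈ jRoots c := hij
    simp [rookMatrix_apply, Finset.mem_image, hij]

theorem blockCount_eq_zero {D : Finset (Fin n × Fin n)} {k m : Fin c.length}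
    (h : ∀ γ ∈ D, c.index γ.1 = k → c.index γ.2 ≠ m) : blockCount c D k m = 0 := by
  rw [blockCount, Finset.card_eq_zero, Finset.filter_eq_empty_iff]
  exact fun γ hγ hkm => h γ hγ hkm.1 hkm.2

theorem RookEquiv.blockCount_eq {D D' : Finset (Fin n × Fin n)} (h : RookEquiv c D D')
    (hD : ∀ γ ∈ D, γ ∈ jRoots c) (hD' : ∀ γ ∈ D', γ ∈ jRoots c) (k m : Fin c.length) :
    blockCount c D k m = blockCount c D' k m := by
  rcases lt_or_ge k m with hkm | hkm
  · exact h k m hkm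
  · have eq_zero {E : Finset (Fin n × Fin n)} (hE : ∀ γ ∈ E, γ ∈ jRoots c) :
        blockCount c E k m = 0 := by
      refine blockCount_eq_zero ?_
      rintro γ hγ rfl rfl
      exact hkm.not_gt (hE γ hγ)
    rw [eq_zero hD, eq_zero hD']

theorem RookEquiv.exists_formAct {D D' : Finset (Fin n × Fin n)} (h : RookEquiv c D D')
    (hD : IsRookPlacement (jRoots c) D) (hD' : IsRookPlacement (jRoots c) D') :
    ∃ a b : Par c F, formAct a (rookForm D) b = rookForm D' := by
  obtain ⟨a, b, hab⟩ := exists_mul_rookMatrix_mul_eq (F := F)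
    (hD.swap fun _ _ => Set.mem_univ _) (hD'.swap fun _ _ => Set.mem_univ _) fun k m => by
      rw [blockCount_image_swap, blockCount_image_swap, h.blockCount_eq hD.subset hD'.subset]
  exact ⟨a, b, by rw [rookForm_eq_formOf, rookForm_eq_formOf, formAct_formOf, hab]⟩

theorem rookEquiv_of_formAct {D D' : Finset (Fin n × Fin n)}
    (hD : IsRookPlacement (jRoots c) D) (hD' : IsRookPlacement (jRoots c) D') (a b : Par c F)
    (h : formAct a (rookForm D) b = rookForm D') : RookEquiv c D D' := by
  rw [rookForm_eq_formOf, rookForm_eq_formOf, formAct_formOf, formOf_eq_iff] at h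
  intro k m hkm
  rw [← blockCount_image_swap, ← blockCount_image_swap D']
  exact blockCount_eq_of_eqOn (S := fun k m => m < k)
    (fun hkm hk hm => hm.trans_lt (hkm.trans_le hk)) (hD.swap fun _ _ => Set.mem_univ _)
    (hD'.swap fun _ _ => Set.mem_univ _) (fun i j hij => h j i hij) hkm

/-! ### Stabilizers of rook forms -/

theorem mem_rookSubgroup {D : Finset (Fin n × Fin n)} {h : Par c F} :
    h ∈ rookSubgroup F c D ↔
      h ∈ levi c F ∧ ∀ γ ∈ D, IsScalarOn h (c.index γ.1) (c.index γ.2) := by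
  rw [rookSubgroup, Subgroup.mem_inf]
  refine and_congr_right fun hh => ?_
  simp only [Subgroup.mem_iInf]
  exact forall₂_congr fun γ _ => ⟨fun h => h.2, fun h => ⟨hh, h⟩⟩

theorem IsScalarOn.col {h : Par c F} (hh : h ∈ levi c F) {k m : Fin c.length} {a : F}
    (ha : ∀ s t : Fin n, c.index s ∈ Set.Icc k m → c.index t ∈ Set.Icc k m →
      mat h s t = if s = t then a else 0) (s t : Fin n) (ht : c.index t ∈ Set.Icc k m) :
    mat h s t = if s = t then a else 0 := by
  by_cases hst : c.index s = c.index t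
  · exact ha s t (hst ▸ ht) ht
  · rw [hh s t hst, if_neg fun h' : s = t => hst (congrArg c.index h')]

theorem mul_mul_apply_congr (a b : Par c F) (y y' : radical c F) (i j : Fin n)
    (h : ∀ s t, c.index i ≤ c.index s → c.index s < c.index t → c.index t ≤ c.index j →
      (y : Matrix (Fin n) (Fin n) F) s t = (y' : Matrix (Fin n) (Fin n) F) s t) :
    (mat b * (y * mat a)) i j = (mat b * (y' * mat a)) i j := by
  simp only [Matrix.mul_apply, Finset.mul_sum]
  refine Finset.sum_congr rfl fun s _ => Finset.sum_congr rfl fun t _ => ?_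
  rcases lt_or_ge (c.index s) (c.index i) with hs | hs
  · rw [mat_block b i s hs, zero_mul, zero_mul]
  rcases lt_or_ge (c.index j) (c.index t) with ht | ht
  · rw [mat_block a t j ht, mul_zero, mul_zero, mul_zero, mul_zero]
  rcases lt_or_ge (c.index s) (c.index t) with hst | hst
  · rw [h s t hs hst ht]
  · rw [y.2 s t hst, y'.2 s t hst]

theorem rookSubgroup_le_orbitStabilizer (D : Finset (Fin n × Fin n)) :
    rookSubgroup F c D ≤ orbitStabilizer (rookForm D) := by
  intro h hh
  obtain ⟨hL, hs⟩ := mem_rookSubgroup.mp hh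
  refine (mem_orbitStabilizer_iff _ _).mpr ⟨hL, fun a b x => ?_⟩
  rw [rookForm_apply, rookForm_apply]
  refine Finset.sum_congr rfl fun γ hγ => mul_mul_apply_congr a b _ _ _ _ fun s t h1 h2 h3 => ?_
  obtain ⟨z, hz⟩ := hs γ hγ
  rw [coe_lmul, coe_rmul, Matrix.mul_apply, Matrix.mul_apply]
  simp only [IsScalarOn.row hL hz s _ ⟨h1, h2.le.trans h3⟩,
    IsScalarOn.col hL hz _ t ⟨h1.trans h2.le, h3⟩]
  simp [mul_comm]

/-- The largest space of matrices `N`, stable under the parabolic subgroup on both sides, such that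
`N h` and `h N` define the same linear form on `J`. It contains `M` if and only if the orbit of
`formOf M` is fixed by `h`. -/
def formCommutant (h : Par c F) : Submodule F (Matrix (Fin n) (Fin n) F) where
  carrier := {N | ∀ (a b : Par c F) (s t : Fin n), c.index s < c.index t →
    (mat a * N * mat b * mat h) t s = (mat h * (mat a * N * mat b)) t s}
  zero_mem' := by simp
  add_mem' {N N'} hN hN' a b s t hst := by
    simp only [Matrix.mul_add, Matrix.add_mul, Matrix.add_apply, hN a b s t hst, hN' a b s t hst]
  smul_mem' z N hN a b s t hst := by
    simp only [Matrix.mul_smul, Matrix.smul_mul, Matrix.smul_apply, hN a b s t hst]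

theorem mem_orbitStabilizer_formOf_iff (M : Matrix (Fin n) (Fin n) F) (h : Par c F) :
    h ∈ orbitStabilizer (formOf M) ↔ h ∈ levi c F ∧ M ∈ formCommutant h := by
  rw [mem_orbitStabilizer_iff]
  refine and_congr_right fun _ => forall₂_congr fun a b => ?_
  rw [← formOf_eq_iff, LinearMap.ext_iff]
  refine forall_congr' fun x => ?_
  rw [← formAct_apply, ← formAct_apply, formAct_formOf]
  simp only [formOf_apply, coe_lmul, coe_rmul]
  rw [← Matrix.mul_assoc, ← Matrix.mul_assoc, Matrix.trace_mul_comm _ (mat h),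
    Matrix.mul_assoc (mat h)]

theorem mul_mul_mem_formCommutant {h : Par c F} {N : Matrix (Fin n) (Fin n) F}
    (hN : N ∈ formCommutant h) (a b : Par c F) : mat a * N * mat b ∈ formCommutant h :=
  fun a' b' s t hst => by
    simpa only [mat_mul, Matrix.mul_assoc] using hN (a' * a) (b * b') s t hst

theorem exists_mat_eq_transvection {u v : Fin n} (huv : u ≠ v) (h : c.index u ≤ c.index v) :
    ∃ g : Par c F, mat g = 1 + Matrix.single u v 1 := by
  refine exists_mat_eq ?_ fun i j hij => ?_
  · rw [← Matrix.transvection, Matrix.det_transvection_of_ne u v huv]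
    exact one_ne_zero
  · have hne : i ≠ j := by
      rintro rfl
      exact hij.false
    rw [Matrix.add_apply, Matrix.one_apply_ne hne, zero_add, Matrix.single_apply, if_neg]
    rintro ⟨rfl, rfl⟩
    exact hij.not_ge h

theorem single_mul_mem_formCommutant {h : Par c F} {N : Matrix (Fin n) (Fin n) F}
    (hN : N ∈ formCommutant h) {u v : Fin n} (huv : u ≠ v) (hle : c.index u ≤ c.index v) :
    Matrix.single u v 1 * N ∈ formCommutant h := by
  obtain ⟨a, ha⟩ := exists_mat_eq_transvection (F := F) huv hle
  simpa [ha, Matrix.add_mul] using sub_mem (mul_mul_mem_formCommutant hN a 1) hN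

theorem mul_single_mem_formCommutant {h : Par c F} {N : Matrix (Fin n) (Fin n) F}
    (hN : N ∈ formCommutant h) {u v : Fin n} (huv : u ≠ v) (hle : c.index u ≤ c.index v) :
    N * Matrix.single u v 1 ∈ formCommutant h := by
  obtain ⟨b, hb⟩ := exists_mat_eq_transvection (F := F) huv hle
  simpa [hb, Matrix.mul_add] using sub_mem (mul_mul_mem_formCommutant hN 1 b) hN

theorem mul_apply_eq_of_mem_formCommutant {h : Par c F} {N : Matrix (Fin n) (Fin n) F}
    (hN : N ∈ formCommutant h) {s t : Fin n} (hst : c.index s < c.index t) :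
    (N * mat h) t s = (mat h * N) t s := by
  simpa using hN 1 1 s t hst

theorem mat_apply_of_single_mem_left {h : Par c F} {u v : Fin n}
    (hN : Matrix.single u v 1 ∈ formCommutant h) {t : Fin n} (ht : c.index v < c.index t) :
    mat h t u = if t = u then mat h v v else 0 := by
  have := mul_apply_eq_of_mem_formCommutant hN ht
  rw [Matrix.mul_single_apply_same, mul_one] at this
  rw [← this]
  split_ifs with htu
  · rw [htu, Matrix.single_mul_apply_same, one_mul]
  · exact Matrix.single_mul_apply_of_ne _ _ _ _ _ htu _

theorem mat_apply_of_single_mem_right {h : Par c F} {u v : Fin n}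
    (hN : Matrix.single u v 1 ∈ formCommutant h) {s : Fin n} (hs : c.index s < c.index u) :
    mat h v s = if v = s then mat h u u else 0 := by
  have := mul_apply_eq_of_mem_formCommutant hN hs
  rw [Matrix.single_mul_apply_same, one_mul] at this
  rw [this]
  split_ifs with hvs
  · rw [hvs, Matrix.mul_single_apply_same, mul_one]
  · exact Matrix.mul_single_apply_of_ne _ _ _ _ _ (Ne.symm hvs) _

theorem mem_iff_eq_of_row_mem {D : Finset (Fin n × Fin n)} (hD : IsRookPlacement Set.univ D)
    {i j t : Fin n} (hij : (i, j) ∈ D) : (i, t) ∈ D ↔ j = t :=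
  ⟨fun ht => congrArg Prod.snd (hD.row _ hij _ ht rfl), fun ht => ht ▸ hij⟩

theorem mem_iff_eq_of_col_mem {D : Finset (Fin n × Fin n)} (hD : IsRookPlacement Set.univ D)
    {i j s : Fin n} (hij : (i, j) ∈ D) : (s, j) ∈ D ↔ i = s :=
  ⟨fun hs => congrArg Prod.fst (hD.col _ hij _ hs rfl), fun hs => hs ▸ hij⟩

theorem single_mul_rookMatrix {D : Finset (Fin n × Fin n)} (hD : IsRookPlacement Set.univ D)
    {i j : Fin n} (hij : (i, j) ∈ D) (u : Fin n) :
    Matrix.single u i 1 * rookMatrix F D = Matrix.single u j 1 := by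
  ext s t
  rcases eq_or_ne u s with rfl | hs
  · simp [Matrix.single_apply, rookMatrix_apply, mem_iff_eq_of_row_mem hD hij]
  · simp [hs, hs.symm]

theorem rookMatrix_mul_single {D : Finset (Fin n × Fin n)} (hD : IsRookPlacement Set.univ D)
    {i j : Fin n} (hij : (i, j) ∈ D) (v : Fin n) :
    rookMatrix F D * Matrix.single j v 1 = Matrix.single i v 1 := by
  ext s t
  rcases eq_or_ne v t with rfl | ht
  · simp [Matrix.single_apply, rookMatrix_apply, mem_iff_eq_of_col_mem hD hij]
  · simp [ht, ht.symm]

section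

variable {D : Finset (Fin n × Fin n)} {i j : Fin n} {h : Par c F}

theorem single_mem_formCommutant_left (hD : IsRookPlacement Set.univ D) (hij : (i, j) ∈ D)
    (hM : rookMatrix F D ∈ formCommutant h) {u : Fin n} (hu : u ≠ i)
    (hle : c.index u ≤ c.index i) : Matrix.single u j 1 ∈ formCommutant h :=
  single_mul_rookMatrix (F := F) hD hij u ▸ single_mul_mem_formCommutant hM hu hle

theorem single_mem_formCommutant_right (hD : IsRookPlacement Set.univ D) (hij : (i, j) ∈ D)
    (hM : rookMatrix F D ∈ formCommutant h) {v : Fin n} (hv : j ≠ v)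
    (hle : c.index j ≤ c.index v) : Matrix.single i v 1 ∈ formCommutant h :=
  rookMatrix_mul_single (F := F) hD hij v ▸ mul_single_mem_formCommutant hM hv hle

theorem mat_apply_diag_eq (hD : IsRookPlacement Set.univ D) (hij : (i, j) ∈ D)
    (hlt : c.index j < c.index i) (hM : rookMatrix F D ∈ formCommutant h) :
    mat h j j = mat h i i := by
  simpa [Matrix.mul_apply, rookMatrix_apply, mem_iff_eq_of_row_mem hD hij,
    mem_iff_eq_of_col_mem hD hij] using mul_apply_eq_of_mem_formCommutant hM hlt

theorem mat_apply_left (hD : IsRookPlacement Set.univ D) (hij : (i, j) ∈ D)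
    (hlt : c.index j < c.index i) (hM : rookMatrix F D ∈ formCommutant h) {s t : Fin n}
    (hst : c.index s = c.index t) (hs : c.index s ∈ Set.Ioc (c.index j) (c.index i)) :
    mat h s t = if s = t then mat h j j else 0 := by
  by_cases hti : t = i
  · subst hti
    by_cases hs_eq : s = t
    · rw [if_pos hs_eq, hs_eq, mat_apply_diag_eq hD hij hlt hM]
    -- The column of `E_{sj}` can be moved up to that of `E_{ij}` inside the segment of `i`.
    have hsj := single_mem_formCommutant_left hD hij hM hs_eq hst.le
    have hij' : Matrix.single t j 1 ∈ formCommutant h := by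
      simpa using single_mul_mem_formCommutant hsj (Ne.symm hs_eq) hst.ge
    exact mat_apply_of_single_mem_left hij' hs.1
  · exact mat_apply_of_single_mem_left
      (single_mem_formCommutant_left hD hij hM hti (hst ▸ hs.2)) hs.1

theorem mat_apply_right (hD : IsRookPlacement Set.univ D) (hij : (i, j) ∈ D)
    (hlt : c.index j < c.index i) (hM : rookMatrix F D ∈ formCommutant h) {s t : Fin n}
    (hst : c.index s = c.index t) (hs : c.index s ∈ Set.Ico (c.index j) (c.index i)) :
    mat h s t = if s = t then mat h j j else 0 := by
  rw [mat_apply_diag_eq hD hij hlt hM]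
  by_cases hsj : s = j
  · subst hsj
    by_cases ht_eq : s = t
    · rw [if_pos ht_eq, ← ht_eq, mat_apply_diag_eq hD hij hlt hM]
    have hit := single_mem_formCommutant_right hD hij hM ht_eq hst.le
    have hij' : Matrix.single i s 1 ∈ formCommutant h := by
      simpa using mul_single_mem_formCommutant hit (Ne.symm ht_eq) hst.ge
    exact mat_apply_of_single_mem_right hij' (hst ▸ hs.2)
  · exact mat_apply_of_single_mem_right
      (single_mem_formCommutant_right hD hij hM (Ne.symm hsj) hs.1) (hst ▸ hs.2)

theorem isScalarOn_of_mem_formCommutant (hD : IsRookPlacement Set.univ D) (hij : (i, j) ∈ D)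
    (hlt : c.index j < c.index i) (hL : h ∈ levi c F) (hM : rookMatrix F D ∈ formCommutant h) :
    IsScalarOn h (c.index j) (c.index i) := by
  refine ⟨mat h j j, fun s t hs _ => ?_⟩
  by_cases hst : c.index s = c.index t
  · rcases hs.1.lt_or_eq with hs' | hs'
    · exact mat_apply_left hD hij hlt hM hst ⟨hs', hs.2⟩
    · exact mat_apply_right hD hij hlt hM hst ⟨hs.1, hs' ▸ hlt⟩
  · rw [hL s t hst, if_neg fun h' : s = t => hst (congrArg c.index h')]

end

theorem rookSubgroup_eq_orbitStabilizer {D : Finset (Fin n × Fin n)}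
    (hD : IsRookPlacement (jRoots c) D) : rookSubgroup F c D = orbitStabilizer (rookForm D) := by
  refine le_antisymm (rookSubgroup_le_orbitStabilizer D) fun h hh => ?_
  rw [rookForm_eq_formOf, mem_orbitStabilizer_formOf_iff] at hh
  exact mem_rookSubgroup.mpr ⟨hh.1, fun γ hγ =>
    isScalarOn_of_mem_formCommutant (hD.swap fun _ _ => Set.mem_univ _)
      (Finset.mem_image_of_mem Prod.swap hγ) (hD.subset γ hγ) hh.1 hh.2⟩

end Forms

section Superclasses

variable {n : ℕ} {c : Composition n} {F : Type*} [Field F]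

/-! ### The ideals `J_h` -/

theorem conj_mem_orbitStabilizer {lam : Forms c F} {p h : Par c F} (hp : p ∈ levi c F)
    (hh : h ∈ orbitStabilizer lam) : p * h * p⁻¹ ∈ orbitStabilizer lam := by
  obtain ⟨hL, H⟩ := (mem_orbitStabilizer_iff _ _).mp hh
  refine (mem_orbitStabilizer_iff _ _).mpr ⟨mul_mem (mul_mem hp hL) (inv_mem hp), fun a b x => ?_⟩
  have := H (p⁻¹ * a) (b * p) (lmul p⁻¹ (rmul p x))
  simp only [← lmul_rmul, ← lmul_mul, ← rmul_mul] at this ⊢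
  convert this using 4 <;> group

theorem mem_idealOf {h : levi c F} {x : radical c F} :
    x ∈ idealOf h ↔ ∀ lam : Forms c F, (h : Par c F) ∈ orbitStabilizer lam →
      ∀ a b : Par c F, lam (lmul a (rmul b x)) = 0 := by
  rw [idealOf, Submodule.mem_dualCoannihilator]
  constructor
  · intro H lam hlam a b
    refine H (formAct b lam a) ?_
    exact Submodule.mem_iSup_of_mem lam (Submodule.mem_iSup_of_mem hlam
      (Submodule.subset_span ⟨b, a, rfl⟩))
  · intro H φ hφ
    have hle : fixedForms h ≤ LinearMap.ker (Module.Dual.eval F (radical c F) x) := by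
      refine iSup₂_le fun lam hlam => Submodule.span_le.mpr ?_
      rintro _ ⟨a, b, rfl⟩
      exact H lam hlam b a
    exact hle hφ

theorem lmul_rmul_mem_idealOf {h : levi c F} {x : radical c F} (hx : x ∈ idealOf h)
    (a b : Par c F) : lmul a (rmul b x) ∈ idealOf h := by
  rw [mem_idealOf] at hx ⊢
  intro lam hlam a' b'
  have := hx lam hlam (a' * a) (b * b')
  rwa [lmul_mul, rmul_mul, lmul_rmul a b'] at this

theorem idealOf_eq_of_isConj {h h' : levi c F} (hc : IsConj h h') : idealOf h = idealOf h' := by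
  have le {h h' : levi c F} (hc : IsConj h h') : idealOf h ≤ idealOf h' := by
    obtain ⟨p, hp⟩ := isConj_iff.mp hc.symm
    intro x hx
    refine mem_idealOf.mpr fun lam hlam => mem_idealOf.mp hx lam ?_
    rw [← hp]
    exact conj_mem_orbitStabilizer p.2 hlam
  exact le_antisymm (le hc) (le hc.symm)

/-! ### The decomposition into scalar segments -/

theorem IsScalarOn.mono {h : Par c F} {k m k' m' : Fin c.length} (H : IsScalarOn h k m)
    (hk : k ≤ k') (hm : m' ≤ m) : IsScalarOn h k' m' := by
  obtain ⟨a, ha⟩ := H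
  exact ⟨a, fun s t hs ht => ha s t ⟨hk.trans hs.1, hs.2.trans hm⟩ ⟨hk.trans ht.1, ht.2.trans hm⟩⟩

theorem IsScalarOn.union {h : Par c F} (hL : h ∈ levi c F) {k m k' m' t : Fin c.length}
    (H : IsScalarOn h k m) (H' : IsScalarOn h k' m') (ht : t ∈ Set.Icc k m)
    (ht' : t ∈ Set.Icc k' m') : IsScalarOn h (min k k') (max m m') := by
  obtain ⟨a, ha⟩ := H
  obtain ⟨a', ha'⟩ := H'
  obtain ⟨s, rfl⟩ := index_surjective t
  have haa : a = a' := by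
    have h1 := ha s s ht ht
    have h2 := ha' s s ht' ht'
    rw [if_pos rfl] at h1 h2
    rw [← h1, ← h2]
  subst haa
  refine ⟨a, fun u v hu _ => ?_⟩
  have : c.index u ∈ Set.Icc k m ∨ c.index u ∈ Set.Icc k' m' := by
    simp only [Set.mem_Icc] at *
    rcases le_total (c.index u) (c.index s) with h1 | h1
    · rcases min_le_iff.mp hu.1 with h2 | h2
      · exact Or.inl ⟨h2, h1.trans ht.2⟩
      · exact Or.inr ⟨h2, h1.trans ht'.2⟩
    · rcases le_max_iff.mp hu.2 with h2 | h2
      · exact Or.inl ⟨ht.1.trans h1, h2⟩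
      · exact Or.inr ⟨ht'.1.trans h1, h2⟩
  rcases this with h1 | h1
  · exact IsScalarOn.row hL ha u v h1
  · exact IsScalarOn.row hL ha' u v h1

/-- The coarsest decomposition of the set of segments such that `h` is scalar on the unions of
more than one segment. -/
def scalarSetoid (h : levi c F) : Setoid (Fin c.length) where
  r k m := k = m ∨ IsScalarOn (h : Par c F) (min k m) (max k m)
  iseqv :=
    { refl := fun _ => Or.inl rfl
      symm := fun {k m} H => by
        rcases H with rfl | H
        · exact Or.inl rfl
        · exact Or.inr (by rwa [min_comm, max_comm])
      trans := fun {k m l} H H' => by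
        rcases H with rfl | H
        · exact H'
        rcases H' with rfl | H'
        · exact Or.inr H
        · refine Or.inr ((H.union h.2 H' (t := m) ⟨min_le_right _ _, le_max_right _ _⟩
            ⟨min_le_left _ _, le_max_left _ _⟩).mono ?_ ?_)
          · exact le_min (inf_le_left.trans inf_le_left) (inf_le_right.trans inf_le_right)
          · exact max_le (le_sup_left.trans le_sup_left) (le_sup_right.trans le_sup_right) }

theorem scalarSetoid_iff {h : levi c F} {k m : Fin c.length} (hkm : k < m) :
    scalarSetoid h k m ↔ IsScalarOn (h : Par c F) k m := by
  change k = m ∨ IsScalarOn (h : Par c F) (min k m) (max k m) ↔ _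
  rw [min_eq_left hkm.le, max_eq_right hkm.le]
  exact or_iff_right hkm.ne

theorem scalarSetoid_of_mem_Icc {h : levi c F} {k m s t : Fin c.length} (hkm : scalarSetoid h k m)
    (hs : s ∈ Set.Icc k m) (ht : t ∈ Set.Icc k m) : scalarSetoid h s t := by
  rcases hkm with rfl | H
  · obtain rfl : s = k := le_antisymm hs.2 hs.1
    obtain rfl : t = s := le_antisymm ht.2 ht.1
    exact Or.inl rfl
  · have hkm := hs.1.trans hs.2
    rw [min_eq_left hkm, max_eq_right hkm] at H
    exact Or.inr (H.mono (le_min hs.1 ht.1) (max_le hs.2 ht.2))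

theorem isGreatest_scalarSetoid (h : levi c F) :
    IsGreatest {r | IsScalarDecomposition h r} (scalarSetoid h) := by
  constructor
  · intro k m hkm H
    refine ⟨fun t ht => scalarSetoid_of_mem_Icc H (Set.left_mem_Icc.mpr hkm) ht, ?_⟩
    rcases hkm.eq_or_lt with h' | h'
    · exact Or.inl h'
    · exact Or.inr ((scalarSetoid_iff h').mp H)
  · intro r hr
    have of_le {k m : Fin c.length} (hkm : k ≤ m) (H : r k m) : scalarSetoid h k m := by
      rcases (hr k m hkm H).2 with h' | h'
      · exact Or.inl h'
      · rcases hkm.eq_or_lt with h'' | h''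
        · exact Or.inl h''
        · exact (scalarSetoid_iff h'').mpr h'
    intro k m H
    rcases le_total k m with hkm | hkm
    · exact of_le hkm H
    · exact (scalarSetoid h).symm (of_le hkm (r.symm H))

theorem rookSubgroup_singleton_iff {h : levi c F} {i j : Fin n} :
    (h : Par c F) ∈ rookSubgroup F c {(i, j)} ↔
      IsScalarOn (h : Par c F) (c.index i) (c.index j) := by
  simp [mem_rookSubgroup]

theorem apply_eq_zero_of_mem_idealOf {h : levi c F} {x : radical c F} (hx : x ∈ idealOf h)
    {i j : Fin n} (hij : scalarSetoid h (c.index i) (c.index j)) :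
    (x : Matrix (Fin n) (Fin n) F) i j = 0 := by
  rcases lt_or_ge (c.index i) (c.index j) with hlt | hle
  · have hh : (h : Par c F) ∈ rookSubgroup F c {(i, j)} :=
      rookSubgroup_singleton_iff.mpr ((scalarSetoid_iff hlt).mp hij)
    have := mem_idealOf.mp hx _ (rookSubgroup_le_orbitStabilizer _ hh) 1 1
    rwa [lmul_one, rmul_one, rookForm_apply, Finset.sum_singleton] at this
  · exact x.2 i j hle

theorem mem_idealOf_of_mem_coarseRadical {h : levi c F} {x : radical c F}
    (hx : x ∈ coarseRadical (scalarSetoid h)) : x ∈ idealOf h := by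
  refine mem_idealOf.mpr fun lam hlam a b => ?_
  obtain ⟨D, hD, a', b', hab⟩ := exists_formAct_eq_rookForm lam
  have hh : (h : Par c F) ∈ rookSubgroup F c D := by
    rwa [rookSubgroup_eq_orbitStabilizer hD, ← hab, orbitStabilizer_formAct]
  have hlam' : lam = formAct a'⁻¹ (rookForm D) b'⁻¹ := by
    rw [← hab, formAct_formAct, inv_mul_cancel, mul_inv_cancel, formAct_one]
  rw [hlam', formAct_apply, lmul_rmul a, ← rmul_mul, ← lmul_rmul, ← lmul_mul, rookForm_apply]
  refine Finset.sum_eq_zero fun γ hγ => ?_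
  rw [coe_lmul, coe_rmul, mul_mul_apply_congr _ _ x 0]
  · simp
  · intro s t hs hst ht
    have hγ_scalar := (scalarSetoid_iff (hD.subset γ hγ)).mpr ((mem_rookSubgroup.mp hh).2 γ hγ)
    exact hx s t (scalarSetoid_of_mem_Icc hγ_scalar ⟨hs, hst.le.trans ht⟩ ⟨hs.trans hst.le, ht⟩)

theorem coe_idealOf (h : levi c F) :
    (idealOf h : Set (radical c F)) = coarseRadical (scalarSetoid h) :=
  Set.Subset.antisymm (fun _ hx _ _ hij => apply_eq_zero_of_mem_idealOf hx hij)
    fun _ hx => mem_idealOf_of_mem_coarseRadical hx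

theorem mem_idealOf_iff {h : levi c F} {x : radical c F} :
    x ∈ idealOf h ↔ ∀ i j, scalarSetoid h (c.index i) (c.index j) →
      (x : Matrix (Fin n) (Fin n) F) i j = 0 := by
  rw [← SetLike.mem_coe, coe_idealOf]
  rfl

theorem mem_rootsOf_iff {h : levi c F} {γ : Fin n × Fin n} :
    γ ∈ rootsOf h ↔ γ ∈ jRoots c ∧ IsScalarOn (h : Par c F) (c.index γ.1) (c.index γ.2) := by
  refine and_congr_right fun hγ => ?_
  rw [mem_idealOf_iff, coe_rootUnit hγ, ← scalarSetoid_iff hγ]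
  constructor
  · intro H
    by_contra hcon
    refine H fun i j hij => ?_
    rw [Matrix.single_apply, if_neg]
    rintro ⟨rfl, rfl⟩
    exact hcon hij
  · intro H H'
    simpa using H' _ _ H

theorem mem_rookSubgroup_iff_subset {h : levi c F} {D : Finset (Fin n × Fin n)}
    (hD : ∀ γ ∈ D, γ ∈ jRoots c) :
    (h : Par c F) ∈ rookSubgroup F c D ↔ ∀ γ ∈ D, γ ∈ rootsOf h := by
  rw [mem_rookSubgroup]
  constructor
  · exact fun H γ hγ => mem_rootsOf_iff.mpr ⟨hD γ hγ, H.2 γ hγ⟩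
  · exact fun H => ⟨h.2, fun γ hγ => (mem_rootsOf_iff.mp (H γ hγ)).2⟩

theorem idealOf_one : idealOf (1 : levi c F) = ⊥ := by
  rw [eq_bot_iff]
  intro x hx
  rw [Submodule.mem_bot]
  apply Subtype.ext
  ext i j
  refine mem_idealOf_iff.mp hx i j (Or.inr ⟨1, fun s t _ _ => ?_⟩)
  rw [Subgroup.coe_one, mat_one, Matrix.one_apply]

/-! ### The decomposition `g = h (1 + x)` -/

theorem leviPart_mem (g : Par c F) : leviPart g ∈ levi c F := fun i j hij => by
  simp [mat_leviPart, diagPart, hij]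

/-- The Levi component as an element of the Levi subgroup. -/
def leviL (g : Par c F) : levi c F := ⟨leviPart g, leviPart_mem g⟩

theorem coe_radPart (g : Par c F) :
    (radPart g : Matrix (Fin n) (Fin n) F) = mat (leviPart g)⁻¹ * mat g - 1 := rfl

theorem mat_eq (g : Par c F) :
    mat g = mat (leviPart g) * (1 + (radPart g : Matrix (Fin n) (Fin n) F)) := by
  rw [coe_radPart, add_sub_cancel, ← Matrix.mul_assoc, mat_mul_inv, Matrix.one_mul]

theorem leviPart_eq_of_mat_sub {g p : Par c F} (hp : p ∈ levi c F)
    (h : mat g - mat p ∈ radical c F) : leviPart g = p := by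
  apply mat_injective
  ext i j
  rw [mat_leviPart]
  simp only [diagPart, Matrix.of_apply]
  split_ifs with hij
  · have := h i j hij.ge
    rwa [Matrix.sub_apply, sub_eq_zero] at this
  · rw [hp i j hij]

theorem leviPart_of_mem {p : Par c F} (hp : p ∈ levi c F) : leviPart p = p :=
  leviPart_eq_of_mat_sub hp (by simp)

theorem mat_sub_leviPart_mem (g : Par c F) : mat g - mat (leviPart g) ∈ radical c F := by
  rw [mat_eq g, Matrix.mul_add, Matrix.mul_one, add_sub_cancel_left]
  exact mul_mem_radical _ (radPart g).2

theorem leviPart_radPart_eq {g p : Par c F} {x : radical c F} (hp : p ∈ levi c F)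
    (h : mat g = mat p * (1 + (x : Matrix (Fin n) (Fin n) F))) :
    leviPart g = p ∧ radPart g = x := by
  have h1 : leviPart g = p := by
    refine leviPart_eq_of_mat_sub hp ?_
    rw [h, Matrix.mul_add, Matrix.mul_one, add_sub_cancel_left]
    exact mul_mem_radical _ x.2
  refine ⟨h1, Subtype.ext ?_⟩
  rw [coe_radPart, h1, h, ← Matrix.mul_assoc, mat_inv_mul, Matrix.one_mul, add_sub_cancel_left]

theorem leviPart_mul (g g' : Par c F) : leviPart (g * g') = leviPart g * leviPart g' :=
  mat_injective (by rw [mat_mul, mat_leviPart, mat_leviPart, mat_leviPart, diagPart_mul])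

theorem leviPart_one : leviPart (1 : Par c F) = 1 := leviPart_of_mem (one_mem _)

theorem leviPart_inv (g : Par c F) : leviPart g⁻¹ = (leviPart g)⁻¹ := by
  rw [eq_inv_iff_mul_eq_one, ← leviPart_mul, inv_mul_cancel, leviPart_one]

theorem radPart_one : radPart (1 : Par c F) = 0 := by
  apply Subtype.ext
  rw [coe_radPart, leviPart_one]
  simp

/-- The `G × G` orbits of `x` and `y` have the same image in `J / J_h`. -/
def OrbitEquiv (h : levi c F) (x y : radical c F) : Prop :=
  ∃ a b : Par c F, y - lmul a (rmul b x) ∈ idealOf h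

theorem OrbitEquiv.symm {h : levi c F} {x y : radical c F} :
    OrbitEquiv h x y → OrbitEquiv h y x := by
  rintro ⟨a, b, hxy⟩
  have := neg_mem (lmul_rmul_mem_idealOf hxy a⁻¹ b⁻¹)
  rw [map_sub, map_sub, neg_sub, ← lmul_rmul a, ← lmul_mul, ← rmul_mul, inv_mul_cancel,
    mul_inv_cancel, lmul_one, rmul_one] at this
  exact ⟨_, _, this⟩

theorem OrbitEquiv.trans {h : levi c F} {x y z : radical c F} :
    OrbitEquiv h x y → OrbitEquiv h y z → OrbitEquiv h x z := by
  rintro ⟨a, b, hxy⟩ ⟨a', b', hyz⟩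
  have := add_mem hyz (lmul_rmul_mem_idealOf hxy a' b')
  rw [map_sub, map_sub, sub_add_sub_cancel] at this
  exact ⟨a' * a, b * b', by rwa [lmul_mul, rmul_mul, lmul_rmul a b']⟩

theorem orbitEquiv_lmul_rmul (h : levi c F) (a b : Par c F) (x : radical c F) :
    OrbitEquiv h x (lmul a (rmul b x)) :=
  ⟨a, b, by rw [sub_self]; exact zero_mem _⟩

theorem mem_superclass {h : levi c F} {x : radical c F} {g : Par c F} :
    g ∈ superclass h x ↔ IsConj h (leviL g) ∧ OrbitEquiv h x (radPart g) := by
  constructor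
  · rintro ⟨h', y, hc, ⟨_, ⟨a, b, rfl⟩, hy⟩, hg⟩
    obtain ⟨h_levi, h_rad⟩ := leviPart_radPart_eq h'.2 hg
    obtain rfl : leviL g = h' := Subtype.ext h_levi
    exact ⟨hc, a, b, h_rad ▸ (Submodule.Quotient.eq _).mp hy.symm⟩
  · rintro ⟨hc, a, b, hab⟩
    exact ⟨leviL g, radPart g, hc, ⟨_, ⟨a, b, rfl⟩, ((Submodule.Quotient.eq _).mpr hab).symm⟩,
      mat_eq g⟩

theorem superclass_eq {h h' : levi c F} {x x' : radical c F} (hc : IsConj h h')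
    (hx : OrbitEquiv h x x') : superclass h x = superclass h' x' := by
  ext g
  rw [mem_superclass, mem_superclass, OrbitEquiv, OrbitEquiv, ← idealOf_eq_of_isConj hc]
  exact and_congr ⟨hc.symm.trans, hc.trans⟩ ⟨hx.symm.trans, hx.trans⟩

theorem mem_superclass_self (g : Par c F) : g ∈ superclass (leviL g) (radPart g) :=
  mem_superclass.mpr ⟨IsConj.refl _, by
    simpa only [lmul_one, rmul_one] using orbitEquiv_lmul_rmul (leviL g) 1 1 (radPart g)⟩

theorem superclass_one_zero : superclass (1 : levi c F) 0 = {1} := by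
  ext g
  rw [Set.mem_singleton_iff]
  constructor
  · intro hg
    obtain ⟨hc, a, b, h⟩ := mem_superclass.mp hg
    have h_levi : leviPart g = 1 := congrArg Subtype.val (isConj_one_right.mp hc)
    have h_rad : radPart g = 0 := by simpa [idealOf_one] using h
    apply mat_injective
    rw [mat_eq g, h_levi, h_rad, mat_one, Matrix.one_mul, ZeroMemClass.coe_zero, add_zero]
  · rintro rfl
    have h_levi : leviL (1 : Par c F) = 1 := Subtype.ext leviPart_one
    have := mem_superclass_self (1 : Par c F)
    rwa [h_levi, radPart_one] at this

/-! ### Rook placements modulo `J_h` -/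

theorem exists_orbitEquiv_rookElement (h : levi c F) (x : radical c F) :
    ∃ D, IsRookPlacement (rootsOf h) D ∧ OrbitEquiv h x (rookElement D) := by
  classical
  obtain ⟨a, b, E, hE, hab⟩ := exists_mul_mul_eq_rookMatrix c (x : Matrix (Fin n) (Fin n) F)
  have hab' : (lmul a (rmul b x) : Matrix (Fin n) (Fin n) F) = rookMatrix F E := by
    rw [coe_lmul, coe_rmul, ← Matrix.mul_assoc, hab]
  have hEJ : ∀ γ ∈ E, γ ∈ jRoots c := by
    rintro ⟨i, j⟩ hγ
    by_contra hlt
    have := (lmul a (rmul b x)).2 i j (not_lt.mp hlt)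
    rw [hab', rookMatrix_apply, if_pos hγ] at this
    exact one_ne_zero this
  refine ⟨E.filter (· ∈ rootsOf h), hE.mono (Finset.filter_subset _ _)
    (fun γ hγ => (Finset.mem_filter.mp hγ).2), a, b, mem_idealOf_iff.mpr fun i j hr => ?_⟩
  have mem_rootsOf (hij : (i, j) ∈ E) : (i, j) ∈ rootsOf h :=
    mem_rootsOf_iff.mpr ⟨hEJ _ hij, (scalarSetoid_iff (hEJ _ hij)).mp hr⟩
  rw [Submodule.coe_sub, Matrix.sub_apply, hab',
    coe_rookElement fun γ hγ => hEJ γ (Finset.mem_filter.mp hγ).1, sub_eq_zero]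
  simp only [rookMatrix_apply, Finset.mem_filter, and_iff_left_of_imp mem_rootsOf]

theorem RookEquiv.orbitEquiv {D D' : Finset (Fin n × Fin n)} (hDD' : RookEquiv c D D')
    (hD : IsRookPlacement (jRoots c) D) (hD' : IsRookPlacement (jRoots c) D') (h : levi c F) :
    OrbitEquiv h (rookElement D) (rookElement D') := by
  obtain ⟨a, b, hab⟩ := exists_mul_rookMatrix_mul_eq (F := F)
    (hD.mono subset_rfl fun _ _ => Set.mem_univ _) (hD'.mono subset_rfl fun _ _ => Set.mem_univ _)
    (hDD'.blockCount_eq hD.subset hD'.subset)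
  have : rookElement D' = lmul a (rmul b (rookElement D)) := Subtype.ext (by
    rw [coe_rookElement hD'.subset, coe_lmul, coe_rmul, coe_rookElement hD.subset,
      ← Matrix.mul_assoc, hab])
  exact this ▸ orbitEquiv_lmul_rmul h a b _

theorem IsRookPlacement.jRoots {h : levi c F} {D : Finset (Fin n × Fin n)}
    (hD : IsRookPlacement (rootsOf h) D) : IsRookPlacement (jRoots c) D :=
  hD.mono subset_rfl fun γ hγ => (hD.subset γ hγ).1

theorem blockCount_eq_zero_of_not_scalarSetoid {h : levi c F} {D : Finset (Fin n × Fin n)}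
    (hD : ∀ γ ∈ D, γ ∈ rootsOf h) {k m : Fin c.length} (hkm : k < m) (hr : ¬scalarSetoid h k m) :
    blockCount c D k m = 0 := by
  refine blockCount_eq_zero ?_
  rintro γ hγ rfl rfl
  exact hr ((scalarSetoid_iff hkm).mpr (mem_rootsOf_iff.mp (hD γ hγ)).2)

theorem OrbitEquiv.rookEquiv {h : levi c F} {D D' : Finset (Fin n × Fin n)}
    (hD : IsRookPlacement (rootsOf h) D) (hD' : IsRookPlacement (rootsOf h) D')
    (hDD' : OrbitEquiv h (rookElement D) (rookElement D')) : RookEquiv c D D' := by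
  obtain ⟨a, b, hab⟩ := hDD'
  intro k m hkm
  by_cases hr : scalarSetoid h k m
  · refine blockCount_eq_of_eqOn (S := fun k m => k ≤ m → scalarSetoid h k m) (a := a) (b := b)
      (fun H hk hm hkm => scalarSetoid_of_mem_Icc (H (hk.trans (hkm.trans hm)))
        ⟨hk, hkm.trans hm⟩ ⟨hk.trans hkm, hm⟩)
      (hD.mono subset_rfl fun _ _ => Set.mem_univ _)
      (hD'.mono subset_rfl fun _ _ => Set.mem_univ _) (fun i j hij => ?_) fun _ => hr
    rw [← coe_rookElement hD.jRoots.subset, ← coe_rookElement hD'.jRoots.subset,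
      Matrix.mul_assoc, ← coe_rmul, ← coe_lmul]
    rcases le_total (c.index i) (c.index j) with hle | hle
    · have := mem_idealOf_iff.mp hab i j (hij hle)
      rw [Submodule.coe_sub, Matrix.sub_apply] at this
      exact (sub_eq_zero.mp this).symm
    · rw [(rookElement D').2 i j hle, (lmul a (rmul b (rookElement D))).2 i j hle]
  · rw [blockCount_eq_zero_of_not_scalarSetoid hD.subset hkm hr,
      blockCount_eq_zero_of_not_scalarSetoid hD'.subset hkm hr]

end Superclasses

/-! ### The supercharacter formula -/

section Formula

variable {n : ℕ} {c : Composition n} {F : Type*} [Field F]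

/-- Multiplication in `J`, linear in the second factor. -/
def jmul (x : radical c F) : radical c F →ₗ[F] radical c F where
  toFun z := ⟨x * z, by
    intro i j hij
    rw [Matrix.mul_apply]
    refine Finset.sum_eq_zero fun k _ => ?_
    rcases le_or_gt (c.index k) (c.index i) with hk | hk
    · rw [x.2 i k hk, zero_mul]
    · rw [z.2 k j (hij.trans hk.le), mul_zero]⟩
  map_add' y z := Subtype.ext (by simp [Matrix.mul_add])
  map_smul' t y := Subtype.ext (by simp)

@[simp] theorem coe_jmul (x z : radical c F) :
    (jmul x z : Matrix (Fin n) (Fin n) F) = x * z := rfl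

theorem jmul_rmul (x z : radical c F) (a : Par c F) : jmul x (rmul a z) = rmul a (jmul x z) :=
  Subtype.ext (by simp [Matrix.mul_assoc])

theorem exists_mat_eq_add {p : Par c F} (hp : p ∈ levi c F) (z : radical c F) :
    ∃ g : Par c F, mat g = mat p + z ∧ leviPart g = p := by
  obtain ⟨u, hu⟩ := exists_mat_eq_of_upper (c := c)
    (A := 1 + (lmul p⁻¹ z : Matrix (Fin n) (Fin n) F))
    (fun i j hij => by
      rw [Matrix.add_apply, Matrix.one_apply_ne hij.ne', (lmul p⁻¹ z).2 i j (index_mono hij.le),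
        add_zero])
    (fun i => by
      rw [Matrix.add_apply, Matrix.one_apply_eq, (lmul p⁻¹ z).2 i i le_rfl, add_zero]
      exact one_ne_zero)
  have h : mat (p * u) = mat p + z := by
    rw [mat_mul, hu, Matrix.mul_add, Matrix.mul_one, coe_lmul, ← Matrix.mul_assoc, mat_mul_inv,
      Matrix.one_mul]
  refine ⟨p * u, h, leviPart_eq_of_mat_sub hp ?_⟩
  rw [h, add_sub_cancel_left]
  exact z.2

/-- The bijection `p + z ↦ (p, z)` of `G` with `L × J`. -/
def sumEquiv : Par c F ≃ levi c F × radical c F :=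
  Equiv.ofBijective (fun g => (leviL g, ⟨mat g - mat (leviPart g), mat_sub_leviPart_mem g⟩)) (by
    constructor
    · intro g g' h
      have h1 : leviPart g = leviPart g' := congrArg (fun w => (w.1 : Par c F)) h
      have h2 : mat g - mat (leviPart g) = mat g' - mat (leviPart g') :=
        congrArg (fun w => (w.2 : Matrix (Fin n) (Fin n) F)) h
      rw [h1] at h2
      exact mat_injective (sub_left_injective h2)
    · rintro ⟨p, z⟩
      obtain ⟨g, h1, h2⟩ := exists_mat_eq_add p.2 z
      exact ⟨g, Prod.ext (Subtype.ext h2) (Subtype.ext (by simp [h1, h2]))⟩)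

theorem mat_sumEquiv_symm (w : levi c F × radical c F) :
    mat (sumEquiv.symm w) = mat (w.1 : Par c F) + w.2 := by
  obtain ⟨g, rfl⟩ := sumEquiv.surjective w
  rw [Equiv.symm_apply_apply]
  change mat g = mat (leviPart g) + (mat g - mat (leviPart g))
  abel

/-- The bijection `h (1 + x) ↦ (h, x)` of `G` with `L × J`. -/
def leviRadEquiv : Par c F ≃ levi c F × radical c F :=
  Equiv.ofBijective (fun g => (leviL g, radPart g)) (by
    constructor
    · intro g g' h
      have h1 : leviPart g = leviPart g' := congrArg (fun w => (w.1 : Par c F)) h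
      have h2 : radPart g = radPart g' := congrArg Prod.snd h
      apply mat_injective
      rw [mat_eq g, mat_eq g', h1, h2]
    · rintro ⟨p, x⟩
      obtain ⟨g, h1, h2⟩ := exists_mat_eq_add p.2 (lmul p x)
      rw [coe_lmul, ← mul_one_add] at h1
      obtain ⟨h3, h4⟩ := leviPart_radPart_eq p.2 h1
      exact ⟨g, Prod.ext (Subtype.ext h3) h4⟩)

theorem apply_lmul_rmul_comm {lam : Forms c F} {h : Par c F} (hh : h ∈ orbitStabilizer lam)
    (a b : Par c F) (x : radical c F) :
    lam (lmul b (rmul a (lmul h x))) = lam (lmul b (rmul a (rmul h x))) :=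
  ((mem_orbitStabilizer_iff _ _).mp hh).2 a b x

theorem apply_lmul_eq_apply_rmul {lam : Forms c F} {h : Par c F} (hh : h ∈ orbitStabilizer lam)
    (x : radical c F) : lam (lmul h x) = lam (rmul h x) := by
  simpa only [lmul_one, rmul_one] using apply_lmul_rmul_comm hh 1 1 x

theorem radPart_mul (g g' : Par c F) :
    radPart (g * g') = lmul (leviPart g')⁻¹ (rmul g' (radPart g)) + radPart g' := by
  apply Subtype.ext
  rw [Submodule.coe_add, coe_lmul, coe_rmul, coe_radPart, coe_radPart, coe_radPart, leviPart_mul,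
    _root_.mul_inv_rev, mat_mul, mat_mul]
  noncomm_ring

theorem radPart_inv (g : Par c F) :
    radPart g⁻¹ = -lmul (leviPart g) (rmul g⁻¹ (radPart g)) := by
  have := radPart_mul g g⁻¹
  rw [mul_inv_cancel, radPart_one, leviPart_inv, inv_inv] at this
  exact (neg_eq_of_add_eq_zero_right this.symm).symm

theorem apply_lmul_jmul_eq_zero {lam : Forms c F} {h : Par c F} (hh : h ∈ orbitStabilizer lam)
    {r : radical c F} (hr : ∀ z, lam (jmul r z) = 0) (z : radical c F) :
    lam (lmul h (jmul r z)) = 0 := by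
  rw [apply_lmul_eq_apply_rmul hh, ← jmul_rmul, hr]

theorem jmul_radPart_mul (g g' : Par c F) (z : radical c F) :
    jmul (radPart (g * g')) z =
      lmul (leviPart g')⁻¹ (jmul (radPart g) (lmul g' z)) + jmul (radPart g') z :=
  Subtype.ext (by simp [radPart_mul, Matrix.add_mul, Matrix.mul_assoc])

theorem jmul_radPart_inv (g : Par c F) (z : radical c F) :
    jmul (radPart g⁻¹) z = -lmul (leviPart g) (jmul (radPart g) (lmul g⁻¹ z)) :=
  Subtype.ext (by simp [radPart_inv, Matrix.mul_assoc])

theorem lmul_inv_leviPart_mul (g : Par c F) (z : radical c F) :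
    lmul ((leviPart g)⁻¹ * g) z = jmul (radPart g) z + z :=
  Subtype.ext (by simp [coe_radPart, Matrix.sub_mul])

theorem radPart_of_mem {h : Par c F} (hh : h ∈ levi c F) : radPart h = 0 :=
  Subtype.ext (by simp [coe_radPart, leviPart_of_mem hh, mat_inv_mul])

theorem jmul_zero_left (z : radical c F) : jmul 0 z = 0 := Subtype.ext (by simp)

/-- The elements `h (1 + x)` of `G` with `h` in the stabilizer of `lam` and `lam` vanishing on
`x J`. This is the semidirect product of `orbitStabilizer lam` and `rightStabilizer lam`, described
by the components of its elements. -/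
def componentSubgroup (lam : Forms c F) : Subgroup (Par c F) where
  carrier := {g | leviPart g ∈ orbitStabilizer lam ∧ ∀ z, lam (jmul (radPart g) z) = 0}
  one_mem' := by
    refine ⟨by rw [leviPart_one]; exact one_mem _, fun z => ?_⟩
    rw [radPart_one, jmul_zero_left, map_zero]
  mul_mem' := by
    rintro a b ⟨ha, ha'⟩ ⟨hb, hb'⟩
    refine ⟨by rw [leviPart_mul]; exact mul_mem ha hb, fun z => ?_⟩
    rw [jmul_radPart_mul, map_add, hb', add_zero, apply_lmul_jmul_eq_zero (inv_mem hb) ha']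
  inv_mem' := by
    rintro a ⟨ha, ha'⟩
    refine ⟨by rw [leviPart_inv]; exact inv_mem ha, fun z => ?_⟩
    rw [jmul_radPart_inv, map_neg, apply_lmul_jmul_eq_zero ha ha', neg_zero]

theorem semidirect_orbitStabilizer (lam : Forms c F) :
    semidirect (orbitStabilizer lam) lam = componentSubgroup lam := by
  refine le_antisymm (sup_le (fun h hh => ?_) fun u hu => ?_) fun g ⟨hl, hr⟩ => ?_
  · refine ⟨by rwa [leviPart_of_mem hh.1], fun z => ?_⟩
    rw [radPart_of_mem hh.1, jmul_zero_left, map_zero]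
  · have hl : leviPart u = 1 := leviPart_eq_of_mat_sub (one_mem _) hu.1
    refine ⟨by rw [hl]; exact one_mem _, fun z => ?_⟩
    have h := lmul_inv_leviPart_mul u z
    rw [hl, inv_one, one_mul] at h
    rw [← add_eq_right (b := lam z), ← map_add, ← h, hu.2]
  · rw [← mul_inv_cancel_left (leviPart g) g]
    refine Subgroup.mul_mem_sup hl ⟨sub_one_mem_radical g, fun z => ?_⟩
    rw [lmul_inv_leviPart_mul, map_add, hr, zero_add]

theorem mem_semidirect {lam : Forms c F} {g : Par c F} :
    g ∈ semidirect (orbitStabilizer lam) lam ↔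
      leviPart g ∈ orbitStabilizer lam ∧ ∀ z, lam (jmul (radPart g) z) = 0 := by
  rw [semidirect_orbitStabilizer]
  rfl

theorem apply_rmul_radPart_mul {lam : Forms c F} {g g' : Par c F}
    (hg : g ∈ semidirect (orbitStabilizer lam) lam)
    (hg' : g' ∈ semidirect (orbitStabilizer lam) lam) (p : Par c F) :
    lam (rmul p (radPart (g * g'))) = lam (rmul p (radPart g)) + lam (rmul p (radPart g')) := by
  rw [mem_semidirect] at hg hg'
  have h1 : rmul p (radPart (g * g')) =
      lmul (leviPart g')⁻¹ (rmul p (rmul (leviPart g') (radPart g))) +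
      lmul (leviPart g')⁻¹ (jmul (radPart g) (lmul (leviPart g') (rmul p (radPart g')))) +
      rmul p (radPart g') := by
    rw [radPart_mul, map_add, ← lmul_rmul, ← map_add]
    congr 2
    apply Subtype.ext
    simp only [coe_rmul, Submodule.coe_add, coe_jmul, coe_lmul]
    conv_lhs => rw [mat_eq g']
    noncomm_ring
  rw [h1, map_add, map_add, apply_lmul_jmul_eq_zero (inv_mem hg'.1) hg.2, add_zero,
    ← apply_lmul_rmul_comm hg'.1, ← lmul_rmul, ← lmul_mul, inv_mul_cancel, lmul_one]

/-- The projection `h (1 + x) ↦ h` of the semidirect product onto its Levi factor. -/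
def leviHom (lam : Forms c F) : semidirect (orbitStabilizer lam) lam →* orbitStabilizer lam where
  toFun g := ⟨leviPart g, (mem_semidirect.mp g.2).1⟩
  map_one' := Subtype.ext leviPart_one
  map_mul' _ _ := Subtype.ext (leviPart_mul _ _)

/-- The linear character `h (1 + x) ↦ ε^{lam(x p)}` of the semidirect product. -/
def radHom (ε : AddChar F ℂ) (lam : Forms c F) (p : Par c F) :
    semidirect (orbitStabilizer lam) lam →* ℂ where
  toFun g := ε (lam (rmul p (radPart g)))
  map_one' := by rw [Subgroup.coe_one, radPart_one, map_zero, map_zero, AddChar.map_zero_eq_one]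
  map_mul' g g' := by
    rw [Subgroup.coe_mul, apply_rmul_radPart_mul g.2 g'.2, AddChar.map_add_eq_mul]

/-- The character `h (1 + x) ↦ θ(h) ∑_{p ∈ L} ε^{lam(x p)}` of the semidirect product, from which
the supercharacter `chi` is induced. -/
def inducingCharacter (ε : AddChar F ℂ) {lam : Forms c F} (θ : orbitStabilizer lam → ℂ) :
    semidirect (orbitStabilizer lam) lam → ℂ :=
  fun g => ∑ᶠ p : levi c F, xi ε (orbitStabilizer lam) θ (formAct (p : Par c F) lam 1) g

theorem chi_eq_induced (ε : AddChar F ℂ) {lam : Forms c F} (θ : orbitStabilizer lam → ℂ) :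
    chi ε (orbitStabilizer lam) θ lam = induced _ (inducingCharacter ε θ) := rfl

theorem inducingCharacter_apply [Fintype (levi c F)] (ε : AddChar F ℂ) {lam : Forms c F}
    (θ : orbitStabilizer lam → ℂ) (g : semidirect (orbitStabilizer lam) lam) :
    inducingCharacter ε θ g =
      θ (leviHom lam g) * ∑ p : levi c F, ε (lam (rmul (p : Par c F) (radPart (g : Par c F)))) := by
  simp only [inducingCharacter, finsum_eq_sum_of_fintype, xi, formAct_apply, lmul_one,
    ← Finset.mul_sum, extendByZero_of_mem _ _ (mem_semidirect.mp g.2).1]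
  rfl

theorem isCharacter_chi [Finite F] (ε : AddChar F ℂ) {lam : Forms c F}
    {H₀ : Subgroup (Par c F)} (hH : H₀ = orbitStabilizer lam) {θ : H₀ → ℂ}
    (hθ : IsCharacter θ) : IsCharacter (chi ε H₀ θ lam) := by
  subst hH
  have := Fintype.ofFinite (levi c F)
  have hsum : inducingCharacter ε θ =
      ∑ p : levi c F, fun g => (θ ∘ leviHom lam) g * radHom ε lam p g := by
    ext g
    rw [inducingCharacter_apply, Finset.sum_apply, Finset.mul_sum]
    rfl
  rw [chi_eq_induced, hsum]
  exact IsCharacter.induced _ (IsCharacter.sum _ fun p _ => (hθ.comp _).mul_monoidHom _)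

theorem sum_addChar_form {ε : AddChar F ℂ} (hε : ε ≠ 1) [Fintype (radical c F)]
    (ν : Forms c F) [Decidable (ν = 0)] :
    ∑ z, ε (ν z) = if ν = 0 then (Nat.card (radical c F) : ℂ) else 0 := by
  split_ifs with h
  · simp [h]
  · let ψ : AddChar (radical c F) ℂ := ε.compAddMonoidHom ν.toAddMonoidHom
    refine AddChar.sum_eq_zero_of_ne_one (ψ := ψ) fun h1 => hε ?_
    obtain ⟨z, hz⟩ : ∃ z, ν z ≠ 0 := by
      by_contra! hcon
      exact h (LinearMap.ext hcon)
    ext t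
    have := congrArg (fun f : AddChar (radical c F) ℂ => f ((t / ν z) • z)) h1
    simpa [ψ, hz] using this

theorem sum_rmul_eq_mul_sum_jmul [Fintype (Par c F)] [Fintype (levi c F)] [Fintype (radical c F)]
    (ε : AddChar F ℂ) (lam : Forms c F) (x : radical c F) :
    ∑ b : Par c F, ε (lam (rmul b x)) =
      (∑ p : levi c F, ε (lam (rmul (p : Par c F) x))) * ∑ z, ε ((lam ∘ₗ jmul x) z) := by
  rw [Finset.sum_mul_sum, ← Fintype.sum_prod_type']
  refine (Fintype.sum_equiv sumEquiv.symm _ _ fun w => ?_).symm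
  have hw : rmul (sumEquiv.symm w) x = rmul (w.1 : Par c F) x + jmul x w.2 :=
    Subtype.ext (by simp [mat_sumEquiv_symm, Matrix.mul_add])
  rw [hw, map_add, AddChar.map_add_eq_mul]
  rfl

theorem extendByZero_inducingCharacter [Finite F] {ε : AddChar F ℂ} (hε : ε ≠ 1)
    {lam : Forms c F} (θ : orbitStabilizer lam → ℂ) [Fintype (Par c F)] (g : Par c F) :
    extendByZero _ (inducingCharacter ε θ) g = extendByZero (orbitStabilizer lam) θ (leviPart g) *
      ((Nat.card (radical c F) : ℂ)⁻¹ * ∑ b : Par c F, ε (lam (rmul b (radPart g)))) := by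
  classical
  have := Fintype.ofFinite (levi c F)
  have := Fintype.ofFinite (radical c F)
  have hJ : (Nat.card (radical c F) : ℂ) ≠ 0 := Nat.cast_ne_zero.mpr Nat.card_pos.ne'
  rw [sum_rmul_eq_mul_sum_jmul, sum_addChar_form hε]
  by_cases hg : g ∈ semidirect (orbitStabilizer lam) lam
  · obtain ⟨hl, hr⟩ := mem_semidirect.mp hg
    rw [if_pos (LinearMap.ext hr), extendByZero_of_mem _ _ hg, extendByZero_of_mem _ _ hl,
      inducingCharacter_apply, mul_comm _ (Nat.card _ : ℂ), inv_mul_cancel_left₀ hJ]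
    rfl
  · rw [extendByZero_of_notMem _ _ hg]
    by_cases hl : leviPart g ∈ orbitStabilizer lam
    · have hr : lam ∘ₗ jmul (radPart g) ≠ 0 := fun h0 =>
        hg (mem_semidirect.mpr ⟨hl, LinearMap.congr_fun h0⟩)
      rw [if_neg hr, mul_zero, mul_zero, mul_zero]
    · rw [extendByZero_of_notMem _ _ hl, zero_mul]

theorem leviPart_conj (s g : Par c F) :
    leviPart (s * g * s⁻¹) = leviPart s * leviPart g * (leviPart s)⁻¹ := by
  rw [leviPart_mul, leviPart_mul, leviPart_inv]

theorem conj_mem_orbitStabilizer_iff {lam : Forms c F} {p h : Par c F} (hp : p ∈ levi c F) :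
    p * h * p⁻¹ ∈ orbitStabilizer lam ↔ h ∈ orbitStabilizer lam := by
  refine ⟨fun H => ?_, conj_mem_orbitStabilizer hp⟩
  have := conj_mem_orbitStabilizer (inv_mem hp) H
  convert this using 1
  group

theorem rmul_radPart_conj (s g : Par c F) :
    rmul s (radPart (s * g * s⁻¹)) =
      lmul (leviPart s)
        (lmul (leviPart g)⁻¹ (rmul g (radPart s)) - radPart s + radPart g) := by
  rw [radPart_mul, radPart_mul s g, radPart_inv, leviPart_inv, inv_inv]
  simp only [map_add, map_neg, map_sub, ← lmul_rmul, ← rmul_mul, mul_assoc, inv_mul_cancel,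
    mul_one, rmul_one]
  abel

theorem apply_rmul_radPart_conj {lam : Forms c F} {g : Par c F}
    (hg : leviPart g ∈ orbitStabilizer lam) (s d : Par c F) :
    lam (rmul (s * d) (radPart (s * g * s⁻¹))) = lam (lmul s (rmul d (radPart g))) := by
  have hcomm : lam (lmul (leviPart s) (rmul d (lmul (leviPart g)⁻¹ (rmul g (radPart s))))) =
      lam (lmul (leviPart s) (rmul ((leviPart g)⁻¹ * g * d) (radPart s))) := by
    have h := apply_lmul_rmul_comm (inv_mem hg) ((leviPart g)⁻¹ * g * d) (leviPart s)
      (rmul (leviPart g) (radPart s))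
    simpa only [lmul_rmul, ← rmul_mul, mul_assoc, mul_inv_cancel_left] using h
  have hexpand : lmul (leviPart s) (rmul ((leviPart g)⁻¹ * g * d) (radPart s)) -
      lmul (leviPart s) (rmul d (radPart s)) + lmul (leviPart s) (rmul d (radPart g)) =
      lmul s (rmul d (radPart g)) := by
    apply Subtype.ext
    have hs := mat_eq s
    have hgr : mat ((leviPart g)⁻¹ * g) = 1 + radPart g := by
      rw [coe_radPart, add_sub_cancel, mat_mul]
    simp only [coe_rmul, coe_lmul, Submodule.coe_add, Submodule.coe_sub, mat_mul _ d, hgr, hs]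
    noncomm_ring
  rw [rmul_mul, rmul_radPart_conj, ← lmul_rmul]
  simp only [map_add, map_sub]
  rw [hcomm, ← hexpand, map_add, map_sub]

theorem extendByZero_conj {lam : Forms c F} {θ : orbitStabilizer lam → ℂ}
    (hθ : ConjInvariant (levi c F) θ) {p : Par c F} (hp : p ∈ levi c F) (h : Par c F) :
    extendByZero (orbitStabilizer lam) θ (p * h * p⁻¹) =
      extendByZero (orbitStabilizer lam) θ h := by
  by_cases hh : h ∈ orbitStabilizer lam
  · rw [extendByZero_of_mem _ _ hh, extendByZero_of_mem _ _ (conj_mem_orbitStabilizer hp hh)]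
    exact hθ p hp _ _ rfl
  · rw [extendByZero_of_notMem _ _ hh,
      extendByZero_of_notMem _ _ (mt (conj_mem_orbitStabilizer_iff hp).mp hh)]

/-- The sum of `ε^{lam(a x b)}` over `a, b ∈ G`. -/
def orbitSum (ε : AddChar F ℂ) (lam : Forms c F) (x : radical c F) : ℂ :=
  ∑ᶠ a : Par c F, ∑ᶠ b : Par c F, ε (lam (lmul a (rmul b x)))

/-- The factor by which `chi` differs from the product of `θ` and `orbitSum`, by `chi_apply`. -/
def chiFactor (lam : Forms c F) : ℂ :=
  (Nat.card (semidirect (orbitStabilizer lam) lam) : ℂ)⁻¹ * (Nat.card (radical c F) : ℂ)⁻¹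

theorem chi_apply [Finite F] {ε : AddChar F ℂ} (hε : ε ≠ 1) {lam : Forms c F}
    {H₀ : Subgroup (Par c F)} (hH : H₀ = orbitStabilizer lam) {θ : H₀ → ℂ}
    (hθ : ConjInvariant (levi c F) θ) (g : Par c F) :
    chi ε H₀ θ lam g =
      extendByZero H₀ θ (leviPart g) * (chiFactor lam * orbitSum ε lam (radPart g)) := by
  subst hH
  have := Fintype.ofFinite (Par c F)
  have hconj (s : Par c F) : extendByZero _ (inducingCharacter ε θ) (s * g * s⁻¹) =
      extendByZero (orbitStabilizer lam) θ (leviPart g) *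
      ((Nat.card (radical c F) : ℂ)⁻¹ * ∑ d : Par c F, ε (lam (lmul s (rmul d (radPart g))))) := by
    rw [extendByZero_inducingCharacter hε, leviPart_conj, extendByZero_conj hθ (leviPart_mem s)]
    by_cases hg : leviPart g ∈ orbitStabilizer lam
    · congr 2
      refine (Fintype.sum_equiv (Equiv.mulLeft s) _ _ fun d => ?_).symm
      rw [Equiv.coe_mulLeft, apply_rmul_radPart_conj hg]
    · simp only [extendByZero_of_notMem _ _ hg, zero_mul]
  rw [chi_eq_induced, induced, finsum_eq_sum_of_fintype, Finset.sum_congr rfl fun s _ => hconj s,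
    chiFactor, orbitSum]
  simp only [finsum_eq_sum_of_fintype, ← Finset.mul_sum]
  ring

theorem orbitSum_formAct [Finite F] (ε : AddChar F ℂ) (lam : Forms c F) (a b : Par c F)
    (x : radical c F) : orbitSum ε (formAct a lam b) x = orbitSum ε lam x := by
  have := Fintype.ofFinite (Par c F)
  simp only [orbitSum, finsum_eq_sum_of_fintype]
  refine Fintype.sum_equiv (Equiv.mulLeft b) _ _ fun s => ?_
  refine Fintype.sum_equiv (Equiv.mulRight a) _ _ fun d => ?_
  simp only [formAct_apply, Equiv.coe_mulLeft, Equiv.coe_mulRight, ← lmul_rmul, ← lmul_mul,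
    ← rmul_mul]

theorem apply_jmul_radPart_conj {lam : Forms c F} {g : Par c F}
    (hg : leviPart g ∈ orbitStabilizer lam) (s : Par c F) (w : radical c F) :
    lam (jmul (radPart (s * g * s⁻¹)) (lmul s w)) = lam (lmul s (jmul (radPart g) w)) := by
  obtain ⟨u, hu, -⟩ := exists_mat_eq_add (one_mem (levi c F)) w
  have hleft : jmul (radPart (s * g * s⁻¹)) (lmul s w) =
      rmul (s * u) (radPart (s * g * s⁻¹)) - rmul (s * 1) (radPart (s * g * s⁻¹)) :=
    Subtype.ext (by simp [hu, Matrix.mul_add])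
  have hright : lmul s (jmul (radPart g) w) =
      lmul s (rmul u (radPart g)) - lmul s (rmul 1 (radPart g)) :=
    Subtype.ext (by simp [hu, Matrix.mul_add])
  rw [hleft, hright, map_sub, map_sub, apply_rmul_radPart_conj hg,
    apply_rmul_radPart_conj hg]

theorem chiFactor_formAct (lam : Forms c F) (a b : Par c F) :
    chiFactor (formAct a lam b) = chiFactor lam := by
  rw [chiFactor, chiFactor]
  congr 3
  refine Nat.card_congr ((MulAut.conj b).toEquiv.subtypeEquiv fun g => ?_)
  rw [mem_semidirect]
  change _ ↔ b * g * b⁻¹ ∈ semidirect (orbitStabilizer lam) lam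
  rw [mem_semidirect, orbitStabilizer_formAct, leviPart_conj,
    conj_mem_orbitStabilizer_iff (leviPart_mem b)]
  refine and_congr_right fun hg => ⟨fun H z => ?_, fun H z => ?_⟩
  · have := H (rmul a⁻¹ (lmul b⁻¹ z))
    rw [formAct_apply, ← jmul_rmul, ← rmul_mul, inv_mul_cancel, rmul_one,
      ← apply_jmul_radPart_conj hg, ← lmul_mul, mul_inv_cancel, lmul_one] at this
    exact this
  · rw [formAct_apply, ← jmul_rmul, ← apply_jmul_radPart_conj hg]
    exact H _

theorem chi_formAct [Finite F] {ε : AddChar F ℂ} (hε : ε ≠ 1) {lam : Forms c F} (a b : Par c F)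
    {H₀ : Subgroup (Par c F)} (hH : H₀ = orbitStabilizer lam) {θ : H₀ → ℂ}
    (hθ : ConjInvariant (levi c F) θ) : chi ε H₀ θ (formAct a lam b) = chi ε H₀ θ lam := by
  ext g
  rw [chi_apply hε hH hθ, chi_apply hε (hH.trans (orbitStabilizer_formAct a b lam).symm) hθ,
    chiFactor_formAct, orbitSum_formAct]

theorem chiFactor_ne_zero [Finite F] (lam : Forms c F) : chiFactor lam ≠ 0 :=
  mul_ne_zero (inv_ne_zero (Nat.cast_ne_zero.mpr Nat.card_pos.ne'))
    (inv_ne_zero (Nat.cast_ne_zero.mpr Nat.card_pos.ne'))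

theorem orbitSum_zero_ne_zero [Finite F] (ε : AddChar F ℂ) (lam : Forms c F) :
    orbitSum ε lam 0 ≠ 0 := by
  have := Fintype.ofFinite (Par c F)
  simp [orbitSum, finsum_eq_sum_of_fintype]

theorem chi_ne_zero [Finite F] {ε : AddChar F ℂ} (hε : ε ≠ 1) {lam : Forms c F}
    {H₀ : Subgroup (Par c F)} (hH : H₀ = orbitStabilizer lam) {θ : H₀ → ℂ}
    (hθ : ConjInvariant (levi c F) θ) (h0 : θ ≠ 0) : chi ε H₀ θ lam ≠ 0 := by
  obtain ⟨h, hh⟩ := Function.ne_iff.mp h0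
  have hL : (h : Par c F) ∈ levi c F := (hH.le h.2).1
  refine Function.ne_iff.mpr ⟨h, ?_⟩
  rw [chi_apply hε hH hθ, leviPart_of_mem hL, radPart_of_mem hL, extendByZero_of_mem _ _ h.2]
  exact mul_ne_zero hh (mul_ne_zero (chiFactor_ne_zero lam) (orbitSum_zero_ne_zero ε lam))

theorem sum_orbitSum_mul_conj [Finite F] {ε : AddChar F ℂ} (hε : ε ≠ 1) {lam lam' : Forms c F}
    [Fintype (radical c F)] (h : ∀ a b : Par c F, formAct a lam b ≠ lam') :
    ∑ x, orbitSum ε lam x * starRingEnd ℂ (orbitSum ε lam' x) = 0 := by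
  classical
  have := Fintype.ofFinite (Par c F)
  simp only [orbitSum, finsum_eq_sum_of_fintype, map_sum, Finset.sum_mul_sum]
  rw [Finset.sum_comm]
  refine Finset.sum_eq_zero fun s _ => ?_
  rw [Finset.sum_comm]
  refine Finset.sum_eq_zero fun s' _ => ?_
  rw [Finset.sum_comm]
  refine Finset.sum_eq_zero fun d _ => ?_
  rw [Finset.sum_comm]
  refine Finset.sum_eq_zero fun d' _ => ?_
  have hne : formAct d lam s - formAct d' lam' s' ≠ 0 := fun h0 => by
    refine h (d'⁻¹ * d) (s * s'⁻¹) ?_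
    rw [← formAct_formAct, sub_eq_zero.mp h0, formAct_formAct, inv_mul_cancel, mul_inv_cancel,
      formAct_one]
  have hsum := sum_addChar_form hε (formAct d lam s - formAct d' lam' s')
  rw [if_neg hne] at hsum
  rw [← hsum]
  refine Finset.sum_congr rfl fun x _ => ?_
  rw [← AddChar.map_neg_eq_conj, ← AddChar.map_add_eq_mul, LinearMap.sub_apply, sub_eq_add_neg]
  rfl

end Formula

/-! ### The number of supercharacters and of superclasses -/

section Counting

variable {n : ℕ} {c : Composition n} {F : Type*} [Field F]

open Classical in
/-- The matrix with the rows of `M` in the segments satisfying `P`, and the rows of the identity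
matrix in the other segments. For `M` in the Levi subgroup, this replaces some of the factors of
`M` by identity matrices. -/
def mixMatrix (c : Composition n) (P : Fin c.length → Prop) (M : Matrix (Fin n) (Fin n) F) :
    Matrix (Fin n) (Fin n) F :=
  Matrix.of fun s t => if P (c.index s) then M s t else (1 : Matrix (Fin n) (Fin n) F) s t

section MixMatrix

variable {P : Fin c.length → Prop} {s : Fin n}

theorem mixMatrix_of (M : Matrix (Fin n) (Fin n) F) (hs : P (c.index s)) (t : Fin n) :
    mixMatrix c P M s t = M s t := by
  simp [mixMatrix, hs]

theorem mixMatrix_of_not (M : Matrix (Fin n) (Fin n) F) (hs : ¬P (c.index s)) (t : Fin n) :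
    mixMatrix c P M s t = (1 : Matrix (Fin n) (Fin n) F) s t := by
  simp [mixMatrix, hs]

theorem mixMatrix_mul_of (M N : Matrix (Fin n) (Fin n) F) (hs : P (c.index s)) (t : Fin n) :
    (mixMatrix c P M * N) s t = (M * N) s t := by
  simp only [Matrix.mul_apply, mixMatrix_of M hs]

theorem mixMatrix_mul_of_not (M N : Matrix (Fin n) (Fin n) F) (hs : ¬P (c.index s)) (t : Fin n) :
    (mixMatrix c P M * N) s t = N s t := by
  rw [Matrix.mul_apply]
  simp only [mixMatrix_of_not M hs]
  rw [← Matrix.mul_apply, Matrix.one_mul]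

theorem mul_apply_congr_of_mem_levi {p : Par c F} (hp : p ∈ levi c F)
    {M N : Matrix (Fin n) (Fin n) F} (h : ∀ u, c.index u = c.index s → ∀ t, M u t = N u t)
    (t : Fin n) : (mat p * M) s t = (mat p * N) s t := by
  rw [Matrix.mul_apply, Matrix.mul_apply]
  refine Finset.sum_congr rfl fun u _ => ?_
  by_cases hu : c.index u = c.index s
  · rw [h u hu t]
  · rw [hp s u (Ne.symm hu), zero_mul, zero_mul]

theorem mul_mixMatrix_of {p : Par c F} (hp : p ∈ levi c F) (M : Matrix (Fin n) (Fin n) F)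
    (hs : P (c.index s)) (t : Fin n) : (mat p * mixMatrix c P M) s t = (mat p * M) s t :=
  mul_apply_congr_of_mem_levi hp (fun _ hu => mixMatrix_of M (hu ▸ hs)) t

theorem mul_mixMatrix_of_not {p : Par c F} (hp : p ∈ levi c F) (M : Matrix (Fin n) (Fin n) F)
    (hs : ¬P (c.index s)) (t : Fin n) : (mat p * mixMatrix c P M) s t = mat p s t := by
  rw [mul_apply_congr_of_mem_levi hp fun _ hu => mixMatrix_of_not M (hu ▸ hs), Matrix.mul_one]

variable (P)

theorem mixMatrix_mul {p q : Par c F} (hp : p ∈ levi c F) :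
    mixMatrix c P (mat p) * mixMatrix c P (mat q) = mixMatrix c P (mat (p * q)) := by
  ext s t
  by_cases hs : P (c.index s)
  · rw [mixMatrix_mul_of _ _ hs, mul_mixMatrix_of hp _ hs, mixMatrix_of _ hs, mat_mul]
  · rw [mixMatrix_mul_of_not _ _ hs, mixMatrix_of_not _ hs, mixMatrix_of_not _ hs]

theorem mixMatrix_one : mixMatrix c P (1 : Matrix (Fin n) (Fin n) F) = 1 := by
  ext s t
  simp [mixMatrix]

theorem mixMatrix_mul_mixMatrix_not {p : Par c F} (hp : p ∈ levi c F) :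
    mixMatrix c P (mat p) * mixMatrix c (fun k => ¬P k) (mat p) = mat p := by
  ext s t
  by_cases hs : P (c.index s)
  · rw [mixMatrix_mul_of _ _ hs, mul_mixMatrix_of_not hp _ (not_not.mpr hs)]
  · rw [mixMatrix_mul_of_not _ _ hs, mixMatrix_of (P := fun k => ¬P k) _ hs]

theorem exists_mat_eq_mixMatrix {p : Par c F} (hp : p ∈ levi c F) :
    ∃ q ∈ levi c F, mat q = mixMatrix c P (mat p) := by
  have hL : ∀ s t, c.index s ≠ c.index t → mixMatrix c P (mat p) s t = 0 := fun s t hst => by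
    by_cases hs : P (c.index s)
    · rw [mixMatrix_of _ hs, hp s t hst]
    · rw [mixMatrix_of_not _ hs, Matrix.one_apply_ne (fun h => hst (congrArg c.index h))]
  refine ⟨⟨⟨mixMatrix c P (mat p), mixMatrix c P (mat p⁻¹), ?_, ?_⟩, fun i j hij => ?_⟩, hL, rfl⟩
  · rw [mixMatrix_mul P hp, mul_inv_cancel, mat_one, mixMatrix_one]
  · rw [mixMatrix_mul P (inv_mem hp), inv_mul_cancel, mat_one, mixMatrix_one]
  · exact hL i j hij.ne'

end MixMatrix

/-- The segments `k` lying between the two ends of some root of `D`. On these the elements of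
`H(D)` are scalar. -/
def IsCovered (c : Composition n) (D : Finset (Fin n × Fin n)) (k : Fin c.length) : Prop :=
  ∃ γ ∈ D, k ∈ Set.Icc (c.index γ.1) (c.index γ.2)

theorem rookSubgroup_le_levi (D : Finset (Fin n × Fin n)) : rookSubgroup F c D ≤ levi c F :=
  fun _ h => (mem_rookSubgroup.mp h).1

theorem mem_rookSubgroup_of_mat_eq_mixMatrix {D : Finset (Fin n × Fin n)} {q : Par c F}
    (hq : q ∈ levi c F) {M : Matrix (Fin n) (Fin n) F}
    (hM : mat q = mixMatrix c (fun k => ¬IsCovered c D k) M) : q ∈ rookSubgroup F c D := by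
  refine mem_rookSubgroup.mpr ⟨hq, fun γ hγ => ⟨1, fun s t hs _ => ?_⟩⟩
  rw [hM, mixMatrix_of_not (P := fun k => ¬IsCovered c D k) _ (not_not.mpr ⟨γ, hγ, hs⟩),
    Matrix.one_apply]

theorem commute_of_mat_eq_mixMatrix {D : Finset (Fin n × Fin n)} {r h : Par c F}
    (hr : r ∈ levi c F) {M : Matrix (Fin n) (Fin n) F} (hM : mat r = mixMatrix c (IsCovered c D) M)
    (hh : h ∈ rookSubgroup F c D) : Commute r h := by
  obtain ⟨hL, hscalar⟩ := mem_rookSubgroup.mp hh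
  apply mat_injective
  ext s t
  rw [mat_mul, mat_mul]
  by_cases hs : IsCovered c D (c.index s)
  · obtain ⟨γ, hγ, hsγ⟩ := hs
    obtain ⟨a, ha⟩ := hscalar γ hγ
    have hrow (u : Fin n) (hu : c.index u = c.index s) (t : Fin n) :
        mat h u t = (a • (1 : Matrix (Fin n) (Fin n) F)) u t := by
      rw [IsScalarOn.row hL ha u t (hu ▸ hsγ), Matrix.smul_apply, Matrix.one_apply, smul_eq_mul,
        mul_ite, mul_one, mul_zero]
    rw [mul_apply_congr_of_mem_levi hr hrow, Matrix.mul_smul, Matrix.mul_one, Matrix.mul_apply]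
    simp [IsScalarOn.row hL ha s _ hsγ]
  · rw [hM, mixMatrix_mul_of_not _ _ hs, mul_mixMatrix_of_not hL _ hs]

theorem exists_conj_eq (D : Finset (Fin n × Fin n)) {p : Par c F} (hp : p ∈ levi c F) :
    ∃ q ∈ rookSubgroup F c D, ∀ h ∈ rookSubgroup F c D, p * h * p⁻¹ = q * h * q⁻¹ := by
  obtain ⟨r, hrL, hr⟩ := exists_mat_eq_mixMatrix (IsCovered c D) hp
  obtain ⟨q, hqL, hq⟩ := exists_mat_eq_mixMatrix (fun k => ¬IsCovered c D k) hp
  have hpq : p = r * q := mat_injective <| by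
    rw [mat_mul, hr, hq, mixMatrix_mul_mixMatrix_not _ hp]
  have hqD : q ∈ rookSubgroup F c D := mem_rookSubgroup_of_mat_eq_mixMatrix hqL hq
  refine ⟨q, hqD, fun h hh => ?_⟩
  have hcomm : Commute r (q * h * q⁻¹) :=
    commute_of_mat_eq_mixMatrix hrL hr (mul_mem (mul_mem hqD hh) (inv_mem hqD))
  calc p * h * p⁻¹ = r * (q * h * q⁻¹) * r⁻¹ := by rw [hpq]; group
    _ = q * h * q⁻¹ := by rw [hcomm.eq, mul_inv_cancel_right]

theorem conj_mem_rookSubgroup {D : Finset (Fin n × Fin n)} {p h : Par c F} (hp : p ∈ levi c F)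
    (hh : h ∈ rookSubgroup F c D) : p * h * p⁻¹ ∈ rookSubgroup F c D := by
  obtain ⟨q, hq, H⟩ := exists_conj_eq D hp
  rw [H h hh]
  exact mul_mem (mul_mem hq hh) (inv_mem hq)

theorem IsCharacter.conjInvariant {D : Finset (Fin n × Fin n)} {θ : rookSubgroup F c D → ℂ}
    (hθ : IsCharacter θ) : ConjInvariant (levi c F) θ := by
  intro p hp x y hxy
  obtain ⟨q, hq, H⟩ := exists_conj_eq D hp
  have hy : y = ⟨q, hq⟩ * x * ⟨q, hq⟩⁻¹ := Subtype.ext (by rw [hxy, H x x.2]; rfl)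
  rw [hy, hθ.isClassFunction]

theorem isRelIrreducible_iff [Finite F] {D : Finset (Fin n × Fin n)}
    {θ : rookSubgroup F c D → ℂ} :
    IsRelIrreducible (levi c F) θ ↔ IsIrreducibleCharacter θ := by
  constructor
  · intro h
    obtain ⟨ψ, f, hψ, hf, rfl⟩ := h.isCharacter.exists_eq_add h.ne_zero
    have hf0 : f = 0 := (h.indecomposable ψ f hψ.isCharacter hf hψ.isCharacter.conjInvariant
      hf.conjInvariant rfl).resolve_left hψ.ne_zero
    rwa [hf0, add_zero]
  · intro h
    exact ⟨h.isCharacter, h.isCharacter.conjInvariant, h.ne_zero,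
      fun θ₁ θ₂ hθ₁ hθ₂ _ _ hadd => (hadd ▸ h).eq_zero_or_eq_zero hθ₁ hθ₂⟩

theorem IsConjTransversal.eq {G : Type*} [Group G] {T : Set G} (hT : IsConjTransversal T)
    {t t' : G} (ht : t ∈ T) (ht' : t' ∈ T) (h : IsConj t t') : t = t' :=
  (hT t).unique ⟨ht, IsConj.refl t⟩ ⟨ht', h⟩

theorem RookEquiv.symm {D D' : Finset (Fin n × Fin n)} (h : RookEquiv c D D') :
    RookEquiv c D' D := fun k m hkm => (h k m hkm).symm

theorem RookEquiv.trans {D D' D'' : Finset (Fin n × Fin n)} (h : RookEquiv c D D')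
    (h' : RookEquiv c D' D'') : RookEquiv c D D'' := fun k m hkm => (h k m hkm).trans (h' k m hkm)

theorem IsRookTransversal.eq {Δ : Set (Fin n × Fin n)} {R : Set (Finset (Fin n × Fin n))}
    (hR : IsRookTransversal c Δ R) {D D' : Finset (Fin n × Fin n)} (hD : D ∈ R) (hD' : D' ∈ R)
    (h : RookEquiv c D D') : D = D' :=
  (hR.2 D (hR.1 D hD)).unique ⟨hD, fun _ _ _ => rfl⟩ ⟨hD', h⟩

theorem card_conjClasses_rookSubgroup {T : Set (levi c F)} (hT : IsConjTransversal T)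
    (D : Finset (Fin n × Fin n)) : Nat.card (ConjClasses (rookSubgroup F c D)) =
      Nat.card {t : T // ((t : levi c F) : Par c F) ∈ rookSubgroup F c D} := by
  symm
  refine Nat.card_congr (Equiv.ofBijective
    (fun t => ConjClasses.mk (⟨_, t.2⟩ : rookSubgroup F c D)) ⟨fun t t' h => ?_, fun C => ?_⟩)
  · rw [ConjClasses.mk_eq_mk_iff_isConj, isConj_iff] at h
    obtain ⟨q, hq⟩ := h
    refine Subtype.ext (Subtype.ext (hT.eq t.1.2 t'.1.2 (isConj_iff.mpr
      ⟨⟨q, rookSubgroup_le_levi D q.2⟩, Subtype.ext ?_⟩)))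
    exact congrArg (fun x : rookSubgroup F c D => (x : Par c F)) hq
  · obtain ⟨h, rfl⟩ := ConjClasses.exists_rep C
    obtain ⟨t, ⟨htT, hc⟩, -⟩ := hT ⟨h, rookSubgroup_le_levi D h.2⟩
    obtain ⟨p, hp⟩ := isConj_iff.mp hc
    have hp' : (p : Par c F) * h * (p : Par c F)⁻¹ = t :=
      congrArg (fun x : levi c F => (x : Par c F)) hp
    refine ⟨⟨⟨t, htT⟩, hp' ▸ conj_mem_rookSubgroup p.2 h.2⟩, ?_⟩
    rw [ConjClasses.mk_eq_mk_iff_isConj]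
    refine IsConj.symm ?_
    obtain ⟨q, hq, H⟩ := exists_conj_eq D p.2
    refine isConj_iff.mpr ⟨⟨q, hq⟩, Subtype.ext ?_⟩
    rw [← hp', H h h.2]
    rfl

theorem RookEquiv.subset_rootsOf {h : levi c F} {D D' : Finset (Fin n × Fin n)}
    (hDD' : RookEquiv c D D') (hD : ∀ γ ∈ D, γ ∈ rootsOf h) (hD' : ∀ γ ∈ D', γ ∈ jRoots c) :
    ∀ γ ∈ D', γ ∈ rootsOf h := by
  intro γ hγ
  have h1 := hDD' (c.index γ.1) (c.index γ.2) (hD' γ hγ)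
  have h2 : 0 < blockCount c D' (c.index γ.1) (c.index γ.2) :=
    Finset.card_pos.mpr ⟨γ, Finset.mem_filter.mpr ⟨hγ, rfl, rfl⟩⟩
  rw [← h1] at h2
  obtain ⟨δ, hδ⟩ := Finset.card_pos.mp h2
  obtain ⟨hδD, e1, e2⟩ := Finset.mem_filter.mp hδ
  have := (mem_rootsOf_iff.mp (hD δ hδD)).2
  rw [e1, e2] at this
  exact mem_rootsOf_iff.mpr ⟨hD' γ hγ, this⟩

theorem card_rookTransversal {R : Set (Finset (Fin n × Fin n))}
    (hR : IsRookTransversal c (jRoots c) R) (h : levi c F) {Q : Set (Finset (Fin n × Fin n))}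
    (hQ : IsRookTransversal c (rootsOf h) Q) :
    Nat.card {D : R // (h : Par c F) ∈ rookSubgroup F c D} = Nat.card Q := by
  have hmem : ∀ D : {D : R // (h : Par c F) ∈ rookSubgroup F c D},
      IsRookPlacement (rootsOf h) D.1.1 := fun D =>
    (hR.1 _ D.1.2).mono subset_rfl
      ((mem_rookSubgroup_iff_subset (hR.1 _ D.1.2).subset).mp D.2)
  choose f hf using fun D => (hQ.2 _ (hmem D)).exists
  refine Nat.card_congr (Equiv.ofBijective (fun D => ⟨f D, (hf D).1⟩) ⟨fun D D' h => ?_, ?_⟩)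
  · have h' : f D = f D' := congrArg Subtype.val h
    refine Subtype.ext (Subtype.ext (hR.eq D.1.2 D'.1.2 ((hf D).2.trans ?_)))
    rw [h']
    exact (hf D').2.symm
  · rintro ⟨E, hE⟩
    have hE' := (hQ.1 E hE).jRoots
    obtain ⟨D, ⟨hD, hED⟩, -⟩ := hR.2 E hE'
    have hDh := hED.subset_rootsOf (hQ.1 E hE).subset (hR.1 D hD).subset
    let D' : {D : R // (h : Par c F) ∈ rookSubgroup F c D} :=
      ⟨⟨D, hD⟩, (mem_rookSubgroup_iff_subset (hR.1 D hD).subset).mpr hDh⟩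
    exact ⟨D', Subtype.ext (hQ.eq (hf D').1 hE ((hf D').2.symm.trans hED.symm))⟩

theorem card_parameters [Finite F] {R : Set (Finset (Fin n × Fin n))}
    (hR : IsRookTransversal c (jRoots c) R) {T : Set (levi c F)} (hT : IsConjTransversal T)
    {Q : levi c F → Set (Finset (Fin n × Fin n))}
    (hQ : ∀ h ∈ T, IsRookTransversal c (rootsOf h) (Q h)) :
    Nat.card (Σ D : R, Irr (rookSubgroup F c D)) = Nat.card (Σ h : T, Q h) := by
  classical
  have := Fintype.ofFinite T
  let r (D : R) (t : T) : Prop := ((t : levi c F) : Par c F) ∈ rookSubgroup F c D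
  calc Nat.card (Σ D : R, Irr (rookSubgroup F c D))
      = ∑ D : R, Nat.card {t : T // r D t} := by
        rw [Nat.card_sigma]
        exact Finset.sum_congr rfl fun D _ => card_irr.trans (card_conjClasses_rookSubgroup hT D)
    _ = ∑ t : T, Nat.card {D : R // r D t} := by
        simp only [Nat.card_eq_fintype_card, Fintype.card_subtype]
        exact Finset.sum_card_bipartiteAbove_eq_sum_card_bipartiteBelow r
    _ = Nat.card (Σ h : T, Q h) := by
        rw [Nat.card_sigma]
        exact Finset.sum_congr rfl fun t _ => card_rookTransversal hR t.1 (hQ t.1 t.2)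

end Counting

/-! ### The supercharacter theory -/

section SupercharacterTheory

variable {n : ℕ} {c : Composition n} {F : Type*} [Field F]

theorem OrbitEquiv.orbitSum_eq [Finite F] (ε : AddChar F ℂ) {lam : Forms c F} {h : levi c F}
    (hh : (h : Par c F) ∈ orbitStabilizer lam) {x y : radical c F} (hxy : OrbitEquiv h x y) :
    orbitSum ε lam y = orbitSum ε lam x := by
  obtain ⟨a, b, hab⟩ := hxy
  have := Fintype.ofFinite (Par c F)
  simp only [orbitSum, finsum_eq_sum_of_fintype]
  refine Fintype.sum_equiv (Equiv.mulRight a) _ _ fun s => ?_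
  refine Fintype.sum_equiv (Equiv.mulLeft b) _ _ fun d => ?_
  have hval := mem_idealOf.mp hab lam hh s d
  rw [map_sub, map_sub, map_sub, sub_eq_zero] at hval
  rw [hval, Equiv.coe_mulLeft, Equiv.coe_mulRight, lmul_mul, rmul_mul, lmul_rmul a d]

theorem chi_eq_of_mem_superclass [Finite F] {ε : AddChar F ℂ} (hε : ε ≠ 1) {lam : Forms c F}
    {H₀ : Subgroup (Par c F)} (hH : H₀ = orbitStabilizer lam) {θ : H₀ → ℂ}
    (hθ : ConjInvariant (levi c F) θ) {h : levi c F} {x : radical c F} {g : Par c F}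
    (hg : g ∈ superclass h x) :
    chi ε H₀ θ lam g = extendByZero H₀ θ h * (chiFactor lam * orbitSum ε lam x) := by
  obtain ⟨hc, hx⟩ := mem_superclass.mp hg
  obtain ⟨p, hp⟩ := isConj_iff.mp hc
  have hp' : (p : Par c F) * h * (p : Par c F)⁻¹ = leviPart g :=
    congrArg (fun x : levi c F => (x : Par c F)) hp
  rw [chi_apply hε hH hθ]
  subst hH
  rw [← hp', extendByZero_conj hθ p.2]
  by_cases hh : (h : Par c F) ∈ orbitStabilizer lam
  · rw [hx.orbitSum_eq ε hh]
  · rw [extendByZero_of_notMem _ _ hh, zero_mul, zero_mul]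

theorem scalarProduct_chi [Finite F] {ε : AddChar F ℂ} (hε : ε ≠ 1) {lam lam' : Forms c F}
    {H₀ H₀' : Subgroup (Par c F)} (hH : H₀ = orbitStabilizer lam)
    (hH' : H₀' = orbitStabilizer lam') {θ : H₀ → ℂ} {θ' : H₀' → ℂ}
    (hθ : ConjInvariant (levi c F) θ) (hθ' : ConjInvariant (levi c F) θ')
    [Fintype (levi c F)] [Fintype (radical c F)] :
    scalarProduct (chi ε H₀ θ lam) (chi ε H₀' θ' lam') =
      (Nat.card (Par c F) : ℂ)⁻¹ * (chiFactor lam * starRingEnd ℂ (chiFactor lam')) *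
      ((∑ h : levi c F, extendByZero H₀ θ h * starRingEnd ℂ (extendByZero H₀' θ' h)) *
        ∑ x, orbitSum ε lam x * starRingEnd ℂ (orbitSum ε lam' x)) := by
  have := Fintype.ofFinite (Par c F)
  rw [scalarProduct, finsum_eq_sum_of_fintype, Finset.sum_mul_sum, ← Fintype.sum_prod_type',
    Finset.mul_sum, Finset.mul_sum]
  refine Fintype.sum_equiv leviRadEquiv _ _ fun g => ?_
  rw [chi_apply hε hH hθ, chi_apply hε hH' hθ']
  simp only [map_mul]
  change _ = _ *
    (extendByZero H₀ θ (leviPart g) * starRingEnd ℂ (extendByZero H₀' θ' (leviPart g)) *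
      (orbitSum ε lam (radPart g) * starRingEnd ℂ (orbitSum ε lam' (radPart g))))
  ring

theorem sum_levi_extendByZero {H₀ : Subgroup (Par c F)} (hle : H₀ ≤ levi c F) (θ θ' : H₀ → ℂ)
    [Fintype (levi c F)] :
    ∑ h : levi c F, extendByZero H₀ θ h * starRingEnd ℂ (extendByZero H₀ θ' h) =
      Nat.card H₀ * scalarProduct θ θ' := by
  have := Finite.of_injective _ (Subgroup.inclusion_injective hle)
  have := Fintype.ofFinite H₀
  have hc : (Nat.card H₀ : ℂ) ≠ 0 := Nat.cast_ne_zero.mpr Nat.card_pos.ne'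
  rw [scalarProduct, finsum_eq_sum_of_fintype, mul_inv_cancel_left₀ hc]
  refine (Fintype.sum_of_injective (Subgroup.inclusion hle) (Subgroup.inclusion_injective hle) _ _
    (fun h hh => ?_) fun h => ?_).symm
  · rw [extendByZero_of_notMem _ _ fun h' : (h : Par c F) ∈ H₀ => hh ⟨⟨h, h'⟩, rfl⟩, zero_mul]
  · simp only [Subgroup.coe_inclusion, extendByZero_of_mem _ _ h.2]

theorem scalarProduct_chi_eq_zero_of_ne [Finite F] {ε : AddChar F ℂ} (hε : ε ≠ 1) {lam : Forms c F}
    {H₀ : Subgroup (Par c F)} (hH : H₀ = orbitStabilizer lam) {θ θ' : H₀ → ℂ}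
    (hθ : ConjInvariant (levi c F) θ) (hθ' : ConjInvariant (levi c F) θ')
    (hirr : IsIrreducibleCharacter θ) (hirr' : IsIrreducibleCharacter θ') (hne : θ ≠ θ') :
    scalarProduct (chi ε H₀ θ lam) (chi ε H₀ θ' lam) = 0 := by
  have := Fintype.ofFinite (levi c F)
  have := Fintype.ofFinite (radical c F)
  rw [scalarProduct_chi hε hH hH hθ hθ', sum_levi_extendByZero (hH.trans_le fun _ h => h.1),
    hirr.scalarProduct_eq_zero hirr' hne, mul_zero, zero_mul, mul_zero]

theorem scalarProduct_chi_eq_zero_of_formAct_ne [Finite F] {ε : AddChar F ℂ} (hε : ε ≠ 1)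
    {lam lam' : Forms c F} {H₀ H₀' : Subgroup (Par c F)} (hH : H₀ = orbitStabilizer lam)
    (hH' : H₀' = orbitStabilizer lam') {θ : H₀ → ℂ} {θ' : H₀' → ℂ}
    (hθ : ConjInvariant (levi c F) θ) (hθ' : ConjInvariant (levi c F) θ')
    (hlam : ∀ a b : Par c F, formAct a lam b ≠ lam') :
    scalarProduct (chi ε H₀ θ lam) (chi ε H₀' θ' lam') = 0 := by
  have := Fintype.ofFinite (levi c F)
  have := Fintype.ofFinite (radical c F)
  rw [scalarProduct_chi hε hH hH' hθ hθ', sum_orbitSum_mul_conj hε hlam, mul_zero, mul_zero]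

theorem chi_mem_ggSupercharacters (ε : AddChar F ℂ) {lam : Forms c F} {H₀ : Subgroup (Par c F)}
    (hH : H₀ = orbitStabilizer lam) {θ : H₀ → ℂ} (hθ : IsRelIrreducible (levi c F) θ) :
    chi ε H₀ θ lam ∈ ggSupercharacters c ε := by
  subst hH
  exact ⟨lam, θ, hθ, rfl⟩

theorem exists_chi_formAct_eq [Finite F] {ε : AddChar F ℂ} (hε : ε ≠ 1) {lam : Forms c F}
    {θ : orbitStabilizer lam → ℂ} (hθ : IsRelIrreducible (levi c F) θ) (a b : Par c F)
    {H₀ : Subgroup (Par c F)} (hH : H₀ = orbitStabilizer (formAct a lam b)) :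
    ∃ θ' : H₀ → ℂ, IsRelIrreducible (levi c F) θ' ∧
      chi ε H₀ θ' (formAct a lam b) = chi ε (orbitStabilizer lam) θ lam := by
  rw [orbitStabilizer_formAct] at hH
  subst hH
  exact ⟨θ, hθ, chi_formAct hε a b rfl hθ.invariant⟩

variable {R : Set (Finset (Fin n × Fin n))} {T : Set (levi c F)}
  {Q : levi c F → Set (Finset (Fin n × Fin n))}

theorem IsRookTransversal.exists_formAct_eq (hR : IsRookTransversal c (jRoots c) R)
    (lam : Forms c F) : ∃ D ∈ R, ∃ a b : Par c F, formAct a lam b = rookForm D := by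
  obtain ⟨D, hD, a, b, hab⟩ := exists_formAct_eq_rookForm lam
  obtain ⟨D', ⟨hD', hDD'⟩, -⟩ := hR.2 D hD
  obtain ⟨a', b', hab'⟩ := hDD'.exists_formAct (F := F) hD (hR.1 D' hD')
  exact ⟨D', hD', a' * a, b * b', by rw [← formAct_formAct, hab, hab']⟩

theorem range_chi_eq_ggSupercharacters [Finite F] {ε : AddChar F ℂ} (hε : ε ≠ 1)
    (hR : IsRookTransversal c (jRoots c) R) :
    (Set.range fun α : Σ D : R, Irr (rookSubgroup F c D) =>
      chi ε (rookSubgroup F c α.1) α.2.1 (rookForm α.1)) = ggSupercharacters c ε := by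
  apply subset_antisymm
  · rintro _ ⟨⟨D, θ, hθ⟩, rfl⟩
    exact chi_mem_ggSupercharacters ε (rookSubgroup_eq_orbitStabilizer (hR.1 D D.2))
      (isRelIrreducible_iff.mpr hθ)
  · rintro _ ⟨lam, θ, hθ, rfl⟩
    obtain ⟨D, hD, a, b, hab⟩ := hR.exists_formAct_eq lam
    obtain ⟨θ', hθ', hchi⟩ := exists_chi_formAct_eq hε hθ a b
      ((rookSubgroup_eq_orbitStabilizer (hR.1 D hD)).trans (by rw [hab]))
    exact ⟨⟨⟨D, hD⟩, θ', isRelIrreducible_iff.mp hθ'⟩, by rw [← hchi, hab]⟩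

theorem superclass_nonempty (h : levi c F) (x : radical c F) : (superclass h x).Nonempty := by
  obtain ⟨g, hg⟩ := leviRadEquiv.surjective (h, x)
  obtain ⟨rfl, rfl⟩ := Prod.ext_iff.mp hg
  exact ⟨g, mem_superclass_self g⟩

theorem exists_superclass_eq (hT : IsConjTransversal T)
    (hQ : ∀ h ∈ T, IsRookTransversal c (rootsOf h) (Q h)) (h : levi c F) (x : radical c F) :
    ∃ β : Σ t : T, Q t, superclass β.1.1 (rookElement β.2.1) = superclass h x := by
  obtain ⟨t, ⟨ht, hc⟩, -⟩ := hT h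
  obtain ⟨D, hD, hx⟩ := exists_orbitEquiv_rookElement t x
  obtain ⟨D', ⟨hD', hDD'⟩, -⟩ := (hQ t ht).2 D hD
  exact ⟨⟨⟨t, ht⟩, ⟨D', hD'⟩⟩, (superclass_eq hc.symm
    (hx.trans (hDD'.orbitEquiv hD.jRoots ((hQ t ht).1 D' hD').jRoots t)).symm)⟩

theorem range_superclass_eq_ggSuperclasses (hT : IsConjTransversal T)
    (hQ : ∀ h ∈ T, IsRookTransversal c (rootsOf h) (Q h)) :
    (Set.range fun β : Σ t : T, Q t => superclass β.1.1 (rookElement β.2.1)) =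
      ggSuperclasses c F := by
  apply subset_antisymm
  · rintro _ ⟨β, rfl⟩
    exact ⟨_, _, rfl⟩
  · rintro _ ⟨h, x, rfl⟩
    exact exists_superclass_eq hT hQ h x

theorem disjoint_superclass (hT : IsConjTransversal T)
    (hQ : ∀ h ∈ T, IsRookTransversal c (rootsOf h) (Q h)) {β β' : Σ t : T, Q t} (hne : β ≠ β') :
    Disjoint (superclass β.1.1 (rookElement β.2.1)) (superclass β'.1.1 (rookElement β'.2.1)) := by
  obtain ⟨t, D⟩ := β
  obtain ⟨t', D'⟩ := β'
  refine Set.disjoint_left.mpr fun g hg hg' => hne ?_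
  obtain ⟨hc, hx⟩ := mem_superclass.mp hg
  obtain ⟨hc', hx'⟩ := mem_superclass.mp hg'
  obtain rfl : t = t' := Subtype.ext (hT.eq t.2 t'.2 (hc.trans hc'.symm))
  have hQt := hQ t t.2
  have hDD' := (hx.trans hx'.symm).rookEquiv (hQt.1 _ D.2) (hQt.1 _ D'.2)
  rw [Subtype.ext (hQt.eq D.2 D'.2 hDD')]

theorem scalarProduct_chi_rookForm_eq_zero [Finite F] {ε : AddChar F ℂ} (hε : ε ≠ 1)
    (hR : IsRookTransversal c (jRoots c) R) {α α' : Σ D : R, Irr (rookSubgroup F c D)}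
    (hne : α ≠ α') :
    scalarProduct (chi ε (rookSubgroup F c α.1) α.2.1 (rookForm α.1))
      (chi ε (rookSubgroup F c α'.1) α'.2.1 (rookForm α'.1)) = 0 := by
  obtain ⟨D, θ⟩ := α
  obtain ⟨D', θ'⟩ := α'
  have hH (D : R) : rookSubgroup F c D = orbitStabilizer (rookForm D) :=
    rookSubgroup_eq_orbitStabilizer (hR.1 D D.2)
  have hinv {D : R} (θ : Irr (rookSubgroup F c D)) : ConjInvariant (levi c F) θ.1 :=
    θ.2.isCharacter.conjInvariant
  by_cases hD : D = D'
  · subst hD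
    have hθ : θ.1 ≠ θ'.1 := fun h => hne (by rw [Subtype.ext h])
    exact scalarProduct_chi_eq_zero_of_ne hε (hH D) (hinv θ) (hinv θ') θ.2 θ'.2 hθ
  · exact scalarProduct_chi_eq_zero_of_formAct_ne hε (hH D) (hH D') (hinv θ) (hinv θ')
      fun a b hab => hD (Subtype.ext (hR.eq D.2 D'.2
        (rookEquiv_of_formAct (hR.1 _ D.2) (hR.1 _ D'.2) a b hab)))

theorem isSupercharacterTheory [Finite F] {ε : AddChar F ℂ} (hε : ε ≠ 1)
    (hR : IsRookTransversal c (jRoots c) R) (hT : IsConjTransversal T)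
    (hQ : ∀ h ∈ T, IsRookTransversal c (rootsOf h) (Q h)) :
    IsSupercharacterTheory
      (fun α : Σ D : R, Irr (rookSubgroup F c D) =>
        chi ε (rookSubgroup F c α.1) α.2.1 (rookForm α.1))
      (fun β : Σ t : T, Q t => superclass β.1.1 (rookElement β.2.1)) := by
  have hH (D : R) : rookSubgroup F c D = orbitStabilizer (rookForm D) :=
    rookSubgroup_eq_orbitStabilizer (hR.1 D D.2)
  have hinv {D : R} (θ : Irr (rookSubgroup F c D)) : ConjInvariant (levi c F) θ.1 :=
    θ.2.isCharacter.conjInvariant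
  refine
    { isCharacter := fun α => isCharacter_chi ε (hH _) α.2.2.isCharacter
      ne_zero := fun α => chi_ne_zero hε (hH _) (hinv α.2) α.2.2.ne_zero
      orthogonal := fun α α' => scalarProduct_chi_rookForm_eq_zero hε hR
      nonempty := fun β => superclass_nonempty _ _
      disjoint := fun β β' => disjoint_superclass hT hQ
      cover := Set.eq_univ_of_forall fun g => ?_
      one := ?_
      constant := fun α β g hg g' hg' => by
        rw [chi_eq_of_mem_superclass hε (hH _) (hinv α.2) hg,
          chi_eq_of_mem_superclass hε (hH _) (hinv α.2) hg']
      finite_left := inferInstance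
      finite_right := inferInstance
      card_eq := card_parameters hR hT hQ }
  · obtain ⟨β, hβ⟩ := exists_superclass_eq hT hQ (leviL g) (radPart g)
    exact Set.mem_iUnion.mpr ⟨β, hβ ▸ mem_superclass_self g⟩
  · obtain ⟨β, hβ⟩ := exists_superclass_eq hT hQ 1 0
    exact ⟨β, hβ.trans superclass_one_zero⟩

end SupercharacterTheory

end GGParabolic

end

theorem mainTheorem4 {F : Type*} [Field F] [Finite F] (ε : AddChar F ℂ) (hε : ε ≠ 1)
    {n : ℕ} (c : Composition n)
    (R : Set (Finset (Fin n × Fin n))) (hR : IsRookTransversal c (jRoots c) R)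
    (T : Set (levi c F)) (hT : IsConjTransversal T)
    (Q : levi c F → Set (Finset (Fin n × Fin n)))
    (hQ : ∀ h ∈ T, IsRookTransversal c (rootsOf h) (Q h)) :
    let χ : (Σ D : R, Irr (rookSubgroup F c D)) → Par c F → ℂ :=
      fun α => chi ε (rookSubgroup F c α.1) α.2.1 (rookForm α.1)
    let K : (Σ h : T, Q h) → Set (Par c F) :=
      fun β => superclass β.1.1 (rookElement β.2.1)
    -- these characters and subsets form a supercharacter theory
    IsSupercharacterTheory χ K ∧
    -- it is the `GG`-supercharacter theory of the parabolic subgroup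
    Set.range χ = ggSupercharacters c ε ∧
    Set.range K = ggSuperclasses c F ∧
    -- `H(D) = H_{G lam_D G}`
    (∀ D, IsRookPlacement (jRoots c) D → rookSubgroup F c D = orbitStabilizer (rookForm D)) ∧
    -- `J_h` is the radical given by the maximal decomposition into scalar segments
    (∀ h : levi c F, ∃ r : Setoid (Fin c.length),
      IsGreatest {r | IsScalarDecomposition h r} r ∧ (idealOf h : Set (radical c F)) =
        coarseRadical r) := by
  intro χ K
  exact ⟨isSupercharacterTheory hε hR hT hQ, range_chi_eq_ggSupercharacters hε hR,
    range_superclass_eq_ggSuperclasses hT hQ, fun D hD => rookSubgroup_eq_orbitStabilizer hD,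
    fun h => ⟨scalarSetoid h, isGreatest_scalarSetoid h, coe_idealOf h⟩⟩
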